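/- **Corollary (weakly homogeneous and weakly isotropic case).** Let $\nu>0$, $T>0$, and let $C=(C^1,C^2,C^3):\mathbb{R}^3\times[0,T]\to\mathbb{R}^3$, $C=C(u,t)$ (independent of $x$), be Lipschitz continuous in $u$ with a constant independent of $t$, uniformly continuous in $t$ for each $u$, and such that the partial derivatives $\partial C^i/\partial u^i$ exist. Let $p=p(u;x,t)$ be a $\mathcal{C}^{1,1,1}(\mathbb{R}^3\times\mathbb{R}^3\times[0,T])$ function (continuously differentiable in $(u,x,t)$), of at most polynomial growth in $(u,x)$ uniformly in $t\in[0,T]$, whose second derivatives $\partial^2p/\partial (x^i)^2$ exist for $0<t<T$, and which solves (summation over repeated indices) $$\frac{\partial p}{\partial t}+u^i\frac{\partial p}{\partial x^i}-\nu\Delta_xp=\frac{\partial}{\partial u^i}\bigl(p\,C^i(u,t)\bigr)\quad(0<t<T),\qquad p(u;x,0)=p_0(u;x).$$ 1. For every $t\in(0,T]$ and $u\in\mathbb{R}^3$ the system $$dY(s)=C(Y(s),t-s)\,ds,\quad Y(0)=u,\qquad dq(s)=q(s)\,\frac{\partial C^k}{\partial u^k}(Y(s),t-s)\,ds,\quad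 q(0)=1,\qquad s\in[0,t],$$ (understood in integrated form) has a unique continuous solution $(Y,q)$, and for every $x\in\mathbb{R}^3$ $$p(u;x,t)=q(t)\int_{\mathbb{R}^3}H(x,t,z;u)\,p_0(Y(t);z)\,dz,\qquad H(x,t,z;u)=\frac{1}{(4\pi\nu t)^{3/2}}\exp\left(-\frac{\bigl|z-x+\int_0^tY(s)\,ds\bigr|^2}{4\nu t}\right),$$ the integral being absolutely convergent. 2. If $p_0(u;x)\ge0$ for all $(u,x)$, then $p(u;x,t)\ge0$ for all $(u,x)$ and $t\in[0,T]$. 3. Suppose that $p_0(\cdot\,;x)$ is a probability density function on $\mathbb{R}^3$ for every $x$ and that, for some $m>4$, $|u|^mp_0(u;x)\to0$ as $|u|\to\infty$, uniformly in $x$. Then for all $t\in(0,T]$ and $x\in\mathbb{R}^3$ the integral $\int_{\mathbb{R}^3}|u|\,p(u;x,t)\,du$ is finite and each $\int_{\mathbb{R}^3}u^i\,p(u;x,t)\,du$ ($i=1,2,3$) has a partial derivative with respect to $x^i$; and $p(\cdot\,;x,t)$ is a probability density function for all $x\in\mathbb{R}^3$, $t\in(0,T]$ if and only if $$\frac{\partial}{\partial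 x^i}\int_{\mathbb{R}^3}u^i\,p(u;x,t)\,du=0\qquad\text{for all }x\in\mathbb{R}^3,\ t\in(0,T].$$ -/

import Mathlib

open MeasureTheory Set
open scoped NNReal

noncomputable section

/-- Euclidean space of dimension three (velocities `u` and positions `x`). -/
abbrev R3 : Type := EuclideanSpace ℝ (Fin 3)

/-- The `i`-th standard basis vector. -/
def stdVec (i : Fin 3) : R3 := EuclideanSpace.single i 1

/-- The partial derivative of `f` in the `i`-th coordinate exists at `x`. -/
def HasPartial (f : R3 → ℝ) (i : Fin 3) (x : R3) : Prop :=
  LineDifferentiableAt ℝ f x (stdVec i)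

/-- The partial derivative of `f` in the `i`-th coordinate at `x`. -/
def partialD (f : R3 → ℝ) (i : Fin 3) (x : R3) : ℝ :=
  lineDeriv ℝ f x (stdVec i)

/-- The divergence `∑ k, ∂F^k / ∂u^k` of a vector field at `u`. -/
def divergence (F : R3 → R3) (u : R3) : ℝ :=
  ∑ k, partialD (fun v => F v k) k u

/-- The density evolution equation at the point `(u, x, t)`:
`∂p/∂t + u^i ∂p/∂x^i - ν Δ_x p = ∂(p C^i)/∂u^i`. -/
def PDFEquationAt (ν : ℝ) (C : R3 → ℝ → R3) (p : R3 → R3 → ℝ → ℝ) (u x : R3) (t : ℝ) : Prop :=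
  deriv (fun τ => p u x τ) t
      + ∑ i, u i * partialD (fun y => p u y t) i x
      - ν * ∑ i, partialD (fun y => partialD (fun z => p u z t) i y) i x
    = ∑ i, partialD (fun v => p v x t * C v t i) i u

/-- Classical solutions `p(u; x, t)` on `ℝ³ × ℝ³ × [0, T]`: `p` is continuously differentiable in
`(u, x, t)` up to the boundary, the second derivatives that occur in the equation exist, the
equation holds pointwise for `0 < t < T`, and `p₀` is the initial value. -/
structure IsPDFSolution (ν T : ℝ) (C : R3 → ℝ → R3) (p₀ : R3 → R3 → ℝ)
    (p : R3 → R3 → ℝ → ℝ) : Prop where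
  contDiffOn : ContDiffOn ℝ 1 (fun w : R3 × R3 × ℝ => p w.1 w.2.1 w.2.2)
    (univ ×ˢ (univ ×ˢ Icc 0 T))
  second_partial : ∀ u x : R3, ∀ t ∈ Ioo 0 T, ∀ i,
    HasPartial (fun y => partialD (fun z => p u z t) i y) i x
  equation : ∀ u x : R3, ∀ t ∈ Ioo 0 T, PDFEquationAt ν C p u x t
  initial : ∀ u x : R3, p u x 0 = p₀ u x

/-- At most polynomial growth in `(u, x)`, uniformly in `t ∈ [0, T]`. -/
def HasPolyGrowth (T : ℝ) (p : R3 → R3 → ℝ → ℝ) : Prop :=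
  ∃ (L : ℝ) (l : ℕ), ∀ u x : R3, ∀ t ∈ Icc 0 T, |p u x t| ≤ L * (1 + ‖u‖ + ‖x‖) ^ l

/-- `(Y, q)` solves, on `[0, t]` and in integrated form,
`dY(s) = C(Y(s), t - s) ds`, `Y(0) = u`, and
`dq(s) = q(s) (∂C^k/∂u^k)(Y(s), t - s) ds`, `q(0) = 1`. -/
structure IsCharacteristic (C : R3 → ℝ → R3) (t : ℝ) (u : R3) (Y : ℝ → R3) (q : ℝ → ℝ) :
    Prop where
  continuousOn_Y : ContinuousOn Y (Icc 0 t)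
  integrable_Y : IntervalIntegrable (fun r => C (Y r) (t - r)) volume 0 t
  eq_Y : ∀ s ∈ Icc 0 t, Y s = u + ∫ r in (0 : ℝ)..s, C (Y r) (t - r)
  continuousOn_q : ContinuousOn q (Icc 0 t)
  integrable_q : IntervalIntegrable
    (fun r => q r * divergence (fun v => C v (t - r)) (Y r)) volume 0 t
  eq_q : ∀ s ∈ Icc 0 t,
    q s = 1 + ∫ r in (0 : ℝ)..s, q r * divergence (fun v => C v (t - r)) (Y r)

/-- The shifted Gaussian heat kernel
`(4πνt)^(-3/2) exp(-|z - x + ∫₀ᵗ Y(s) ds|² / (4νt))`. -/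
def heatKernelH (ν : ℝ) (Y : ℝ → R3) (x : R3) (t : ℝ) (z : R3) : ℝ :=
  1 / (4 * Real.pi * ν * t) ^ (3 / 2 : ℝ)
    * Real.exp (-(‖z - x + ∫ s in (0 : ℝ)..t, Y s‖ ^ 2 / (4 * ν * t)))

/-- `f` is a probability density function on `ℝ³`. -/
def IsPDF (f : R3 → ℝ) : Prop :=
  (∀ u, 0 ≤ f u) ∧ Integrable f ∧ ∫ u, f u = 1

/-- The first moment `∫ u^i p(u; x, t) du`. -/
def firstMoment (p : R3 → R3 → ℝ → ℝ) (t : ℝ) (i : Fin 3) (x : R3) : ℝ :=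
  ∫ u, u i * p u x t

end

/-! The equation is transport in `(u, x)` with a zeroth-order term and diffusion in `x` only. Fix
`t` and `u`, and traverse the characteristic backwards: `Z(τ) = Y(t - τ)` satisfies `Z' = -C(Z, τ)`,
starts at `Y(t)` and ends at `u`. In the moving frame `W(z, τ) = p(Z(τ); z + ∫₀^τ Z, τ)` the
first-order terms disappear, leaving `∂W/∂τ = νΔW + W div C`, and the factor `Q(τ) = q(t - τ)`
removes the last term. Hence `Q W` is a polynomially growing solution of the heat equation with
initial value `q(t) p₀(Y(t); ·)`. Uniqueness identifies it with the heat semigroup, and reading it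
off at `τ = t` is the representation formula (`IsPDFSolution.eq_heatSG`). Positivity follows,
because the kernel is positive and `q` is an exponential.

The delicate point is regularity. Along a curve, `div C` is merely bounded and measurable in time,
so `q` is Lipschitz and `Q W` satisfies the heat equation only at almost every time; moreover only
pure second derivatives in `x` exist, without any continuity. `heat_unique` is a maximum principle
adapted to this. Subtracting `ε exp(ντ) ∑ cosh zᵢ`, an exact solution, confines the spatial maximum
to a fixed ball. The maximum is then a Lipschitz function of time away from `0`, and its derivative
is nonpositive almost everywhere.

For the mass, characteristics change `1 + |u|` by at most a bounded factor, so the formula carries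
the decay `(1 + |u|)^(-m)` from `p₀` to `p` and, away from `t = 0`, to its `x`-derivatives
(`IsPDFSolution.hasVelocityDecay`). Since `m > 4`, first moments converge in dimension three.
Integrating the equation against velocity cutoffs and moving `∂/∂uⁱ` onto the cutoff leaves a flux
of order `1/n`. In the limit the mass `M` satisfies `∂M/∂t = νΔM - ∑ ∂/∂xⁱ ∫ uⁱ p du` for `0 < t <
T` (`HasVelocityDecay.totalMass_time`). If `M = 1`, the sum vanishes; if the sum vanishes, `M - 1`
solves the heat equation with zero initial value and is zero by `heat_unique`. -/

/-! ### One-variable tools for the maximum principle -/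

/-- At a local maximum the (possibly junk) iterated derivative is nonpositive. -/
theorem deriv_deriv_nonpos_of_isLocalMax {h : ℝ → ℝ} {x : ℝ} (hm : IsLocalMax h x)
    (hc : ContinuousAt h x) : deriv (deriv h) x ≤ 0 := by
  by_contra! hpos
  -- A positive second derivative would make the point a local minimum too, hence `h` locally
  -- constant, with zero second derivative.
  have hmin : IsLocalMin h x := isLocalMin_of_deriv_deriv_pos hpos hm.deriv_eq_zero hc
  have hconst : h =ᶠ[nhds x] fun _ => h x := by
    filter_upwards [hm, hmin] with y h1 h2 using le_antisymm h1 h2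
  have h2 : deriv h =ᶠ[nhds x] fun _ => 0 := by
    have := hconst.deriv
    simpa using this
  have := h2.deriv_eq
  simp at this
  linarith

/-- Lipschitz functions are absolutely continuous, so the increment is the integral of the
derivative. Points without a derivative are harmless: there `deriv` takes its default value zero. -/
theorem LipschitzOnWith.le_of_ae_deriv_nonpos {f : ℝ → ℝ} {K : ℝ≥0} {a b : ℝ} (hab : a ≤ b)
    (hf : LipschitzOnWith K f (Icc a b))
    (hd : ∀ᵐ x, x ∈ Ioo a b → ∀ d, HasDerivAt f d x → d ≤ 0) : f b ≤ f a := by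
  have hac : AbsolutelyContinuousOnInterval f a b := by
    apply LipschitzOnWith.absolutelyContinuousOnInterval (K := K)
    rwa [uIcc_of_le hab]
  have h1 := hac.integral_deriv_eq_sub
  have h2 : 0 ≤ ∫ x in a..b, -deriv f x := by
    rw [intervalIntegral.integral_of_le hab, MeasureTheory.integral_Ioc_eq_integral_Ioo]
    apply integral_nonneg_of_ae
    rw [Filter.EventuallyLE, ae_restrict_iff' measurableSet_Ioo]
    filter_upwards [hd] with x hx hxm
    by_cases hdx : DifferentiableAt ℝ f x
    · simpa using hx hxm _ hdx.hasDerivAt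
    · simp [deriv_zero_of_not_differentiableAt hdx]
  rw [intervalIntegral.integral_neg] at h2
  linarith

/-! ### Partial derivatives as derivatives along coordinate lines -/

theorem coord_add_smul_stdVec (z : R3) (s : ℝ) (i j : Fin 3) :
    (z + s • stdVec i) j = z j + if j = i then s else 0 := by
  simp [stdVec]

theorem hasPartial_iff {f : R3 → ℝ} {i : Fin 3} {x : R3} :
    HasPartial f i x ↔ DifferentiableAt ℝ (fun s : ℝ => f (x + s • stdVec i)) 0 := Iff.rfl

theorem partialD_eq_deriv (f : R3 → ℝ) (i : Fin 3) (x : R3) (s : ℝ) :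
    partialD f i (x + s • stdVec i) = deriv (fun s : ℝ => f (x + s • stdVec i)) s := by
  have : (fun r : ℝ => f (x + s • stdVec i + r • stdVec i))
      = fun r => (fun s : ℝ => f (x + s • stdVec i)) (s + r) := by
    funext r; simp [add_smul, add_assoc]
  simp only [partialD, lineDeriv]
  rw [this, deriv_comp_const_add (fun s : ℝ => f (x + s • stdVec i))]
  simp

theorem HasPartial.differentiableAt {f : R3 → ℝ} {i : Fin 3} {x : R3} {s : ℝ}
    (h : HasPartial f i (x + s • stdVec i)) :
    DifferentiableAt ℝ (fun s : ℝ => f (x + s • stdVec i)) s := by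
  have h1 : DifferentiableAt ℝ (fun r : ℝ => f (x + s • stdVec i + r • stdVec i)) (s - s) := by
    rw [sub_self]; exact h
  have h2 := DifferentiableAt.comp (f := fun r : ℝ => r - s) s h1
    (differentiableAt_id.sub_const s)
  refine h2.congr_of_eventuallyEq (Filter.Eventually.of_forall fun r => ?_)
  simp [add_assoc, ← add_smul]

theorem HasPartial.hasDerivAt_line {f : R3 → ℝ} {i : Fin 3} {x : R3} {s : ℝ}
    (h : HasPartial f i (x + s • stdVec i)) :
    HasDerivAt (fun s : ℝ => f (x + s • stdVec i)) (partialD f i (x + s • stdVec i)) s := by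
  rw [partialD_eq_deriv]
  exact h.differentiableAt.hasDerivAt

theorem HasPartial.hasDerivAt {f : R3 → ℝ} {i : Fin 3} {x : R3} (h : HasPartial f i x) :
    HasDerivAt (fun s : ℝ => f (x + s • stdVec i)) (partialD f i x) 0 :=
  DifferentiableAt.hasDerivAt h

theorem HasDerivAt.hasPartial {f : R3 → ℝ} {i : Fin 3} {x : R3} {d : ℝ}
    (h : HasDerivAt (fun s : ℝ => f (x + s • stdVec i)) d 0) : HasPartial f i x :=
  h.differentiableAt

theorem HasDerivAt.partialD_eq {f : R3 → ℝ} {i : Fin 3} {x : R3} {d : ℝ}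
    (h : HasDerivAt (fun s : ℝ => f (x + s • stdVec i)) d 0) : partialD f i x = d :=
  h.deriv

/-! ### The barrier function -/

/-- The sum of the hyperbolic cosines of the coordinates: a positive solution of `Δφ = φ` that
grows faster than every polynomial. -/
noncomputable def coshSum (z : R3) : ℝ := ∑ i, Real.cosh (z i)

theorem continuous_coshSum : Continuous coshSum := by
  unfold coshSum
  fun_prop

theorem coshSum_pos (z : R3) : 0 < coshSum z :=
  Finset.sum_pos (fun _ _ => Real.cosh_pos _) Finset.univ_nonempty

/-- Some coordinate is at least `‖z‖ / 2` in absolute value: otherwise the three squares would add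
up to at most `3‖z‖² / 4`. -/
theorem exp_norm_le_coshSum (z : R3) : Real.exp (‖z‖ / 2) ≤ 2 * coshSum z := by
  obtain ⟨i, hi⟩ : ∃ i, ‖z‖ / 2 ≤ |z i| := by
    by_contra! h
    have h1 : ‖z‖ ^ 2 = ∑ i, |z i| ^ 2 := by
      simp [EuclideanSpace.norm_sq_eq]
    have h2 : ∑ i, |z i| ^ 2 ≤ ∑ _i : Fin 3, (‖z‖ / 2) ^ 2 :=
      Finset.sum_le_sum fun i _ => pow_le_pow_left₀ (abs_nonneg _) (h i).le 2
    have h3 := lt_of_le_of_lt (abs_nonneg _) (h 0)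
    rw [← h1] at h2
    simp at h2
    nlinarith
  have h1 : Real.exp |z i| ≤ 2 * Real.cosh (z i) := by
    rw [← Real.cosh_abs, Real.cosh_eq]
    have := Real.exp_pos (-|z i|)
    linarith
  have h2 : Real.cosh (z i) ≤ coshSum z :=
    Finset.single_le_sum (f := fun i => Real.cosh (z i)) (fun i _ => (Real.cosh_pos _).le)
      (Finset.mem_univ i)
  linarith [Real.exp_le_exp.2 hi]

theorem exists_radius_poly_lt_coshSum (A L ε : ℝ) (l : ℕ) (hε : 0 < ε) :
    ∃ R : ℝ, 0 < R ∧ ∀ z : R3, R ≤ ‖z‖ → A + L * (1 + ‖z‖) ^ l < ε * coshSum z := by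
  have h : Filter.Tendsto (fun r : ℝ => (|A| + |L|) * ((1 + r) ^ l * Real.exp (-(1 / 2 * (1 + r)))))
      Filter.atTop (nhds ((|A| + |L|) * 0)) := by
    apply Filter.Tendsto.const_mul
    have h1 := Real.tendsto_pow_mul_exp_neg_atTop_nhds_zero l
    have h2 : Filter.Tendsto (fun r : ℝ => 1 / 2 * (1 + r)) Filter.atTop Filter.atTop :=
      (Filter.tendsto_atTop_add_const_left _ _ Filter.tendsto_id).const_mul_atTop (by norm_num)
    have h3 := (h1.comp h2).const_mul ((2 : ℝ) ^ l)
    rw [mul_zero] at h3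
    refine h3.congr fun r => ?_
    simp only [Function.comp]
    rw [← mul_assoc, ← mul_pow]
    congr 2; ring
  rw [mul_zero] at h
  have hpos : 0 < ε / (2 * Real.exp (1 / 2)) := by positivity
  obtain ⟨R, hR⟩ := Filter.eventually_atTop.1 (h.eventually (gt_mem_nhds hpos))
  refine ⟨max R 1, by positivity, fun z hz => ?_⟩
  have h1 := hR ‖z‖ ((le_max_left _ _).trans hz)
  have h2 := exp_norm_le_coshSum z
  have h3 : A + L * (1 + ‖z‖) ^ l ≤ (|A| + |L|) * (1 + ‖z‖) ^ l := by
    have : (1 : ℝ) ≤ (1 + ‖z‖) ^ l := one_le_pow₀ (by linarith [norm_nonneg z])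
    nlinarith [le_abs_self A, le_abs_self L, abs_nonneg A, abs_nonneg L]
  have h4 : Real.exp (-(1 / 2 * (1 + ‖z‖))) * (Real.exp (1 / 2) * Real.exp (‖z‖ / 2)) = 1 := by
    rw [← Real.exp_add, ← Real.exp_add, Real.exp_eq_one_iff]; ring
  rw [lt_div_iff₀ (by positivity)] at h1
  have h5 : (|A| + |L|) * (1 + ‖z‖) ^ l * 2 < ε * Real.exp (‖z‖ / 2) := by
    have := mul_lt_mul_of_pos_right h1 (Real.exp_pos (‖z‖ / 2))
    calc _ = (|A| + |L|) * (1 + ‖z‖) ^ l * 2 *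
          (Real.exp (-(1 / 2 * (1 + ‖z‖))) * (Real.exp (1 / 2) * Real.exp (‖z‖ / 2))) := by
            rw [h4, mul_one]
      _ < _ := by linarith
  nlinarith

theorem coshSum_line_hasDerivAt (z : R3) (i : Fin 3) (s : ℝ) :
    HasDerivAt (fun s : ℝ => coshSum (z + s • stdVec i)) (Real.sinh (z i + s)) s := by
  have h : ∀ j ∈ Finset.univ, HasDerivAt (fun s : ℝ => Real.cosh ((z + s • stdVec i) j))
      (if j = i then Real.sinh (z i + s) else 0) s := by
    intro j _
    simp only [coord_add_smul_stdVec]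
    split_ifs with hj
    · subst hj
      simpa using ((hasDerivAt_id s).const_add (z j)).cosh
    · exact hasDerivAt_const _ _
  simpa [coshSum] using HasDerivAt.fun_sum h

/-! ### Maximum principle and uniqueness for the heat equation -/

/-- One half of the uniqueness of slowly growing solutions of the heat equation. The equation is
only required at almost every time, and only the pure second partial derivatives are assumed to
exist. -/
theorem heat_nonpos {ν t : ℝ} (hν : 0 < ν) {f : R3 → ℝ → ℝ}
    (hc : ContinuousOn (fun w : R3 × ℝ => f w.1 w.2) (univ ×ˢ Icc 0 t)) {L : ℝ} {l : ℕ}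
    (hg : ∀ z, ∀ τ ∈ Icc 0 t, |f z τ| ≤ L * (1 + ‖z‖) ^ l) (h0 : ∀ z, f z 0 = 0)
    (hlip : ∀ R : ℝ, ∀ δ ∈ Ioc 0 t, ∃ K : ℝ≥0, ∀ z : R3, ‖z‖ ≤ R → LipschitzOnWith K (f z) (Icc δ t))
    (heq : ∀ᵐ τ, τ ∈ Ioo 0 t → ∀ z,
      (∀ i, HasPartial (fun y => f y τ) i z) ∧
      (∀ i, HasPartial (fun y => partialD (fun y => f y τ) i y) i z) ∧
      HasDerivAt (f z) (ν * ∑ i, partialD (fun y => partialD (fun y => f y τ) i y) i z) τ) :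
    ∀ z, ∀ τ ∈ Icc 0 t, f z τ ≤ 0 := by
  intro z₀ τ₀ hτ₀
  have ht : 0 ≤ t := hτ₀.1.trans hτ₀.2
  suffices hmain : ∀ ε > 0, f z₀ τ₀ - ε * (Real.exp (ν * τ₀) * coshSum z₀) ≤ 0 by
    by_contra! hpos
    have hc0 : 0 < Real.exp (ν * τ₀) * coshSum z₀ := mul_pos (Real.exp_pos _) (coshSum_pos _)
    have := hmain (f z₀ τ₀ / 2 / (Real.exp (ν * τ₀) * coshSum z₀)) (by positivity)
    rw [div_mul_cancel₀ _ hc0.ne'] at this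
    linarith
  intro ε hε
  -- The subtracted term solves the heat equation exactly, so the equation for `f` passes to `F`,
  -- while `F` is now very negative at infinity.
  set F : R3 → ℝ → ℝ := fun z τ => f z τ - ε * (Real.exp (ν * τ) * coshSum z) with hF
  have hFc : ContinuousOn (fun w : R3 × ℝ => F w.1 w.2) (univ ×ˢ Icc 0 t) := by
    refine hc.sub (Continuous.continuousOn ?_)
    have := continuous_coshSum
    fun_prop
  have hexp1 : ∀ τ ∈ Icc 0 t, 1 ≤ Real.exp (ν * τ) := fun τ hτ =>
    Real.one_le_exp (mul_nonneg hν.le hτ.1)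
  have hexp2 : ∀ τ ∈ Icc 0 t, Real.exp (ν * τ) ≤ Real.exp (ν * t) := fun τ hτ =>
    Real.exp_le_exp.2 (mul_le_mul_of_nonneg_left hτ.2 hν.le)
  -- With this `A`, the bound at radius `R` says that the upper bound for `F z τ` lies below the
  -- lower bound `-L - ε exp(νt) coshSum 0` for `F 0 τ`.
  set A : ℝ := L + ε * (Real.exp (ν * t) * coshSum 0)
  obtain ⟨R, hR, hRz⟩ := exists_radius_poly_lt_coshSum A L ε l hε
  have hout : ∀ τ ∈ Icc 0 t, ∀ z, R ≤ ‖z‖ → F z τ < F 0 τ := by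
    intro τ hτ z hz
    have h1 := hRz z hz
    have h2 := (abs_le.1 (hg z τ hτ)).2
    have h3 := (abs_le.1 (hg 0 τ hτ)).1
    have h4 := mul_le_mul_of_nonneg_right (hexp1 τ hτ) (coshSum_pos z).le
    have h5 := mul_le_mul_of_nonneg_right (hexp2 τ hτ) (coshSum_pos 0).le
    have h6 := mul_le_mul_of_nonneg_left h4 hε.le
    have h7 := mul_le_mul_of_nonneg_left h5 hε.le
    simp only [norm_zero, add_zero, one_pow, mul_one] at h3
    simp only [hF, A] at h1 ⊢
    linarith
  have hmax : ∀ τ, ∃ y : R3, τ ∈ Icc 0 t → ‖y‖ ≤ R ∧ ∀ z, F z τ ≤ F y τ := by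
    intro τ
    by_cases hτ : τ ∈ Icc 0 t
    swap
    · exact ⟨0, fun h => absurd h hτ⟩
    obtain ⟨y, hy, hym⟩ := (isCompact_closedBall (0 : R3) R).exists_isMaxOn
      ⟨0, Metric.mem_closedBall_self hR.le⟩ (f := fun z => F z τ)
      (hFc.comp (f := fun z : R3 => (z, τ)) (by fun_prop) (fun z _ => ⟨mem_univ _, hτ⟩))
    refine ⟨y, fun _ => ⟨by simpa using hy, fun z => ?_⟩⟩
    by_cases hz : ‖z‖ ≤ R
    · exact hym (by simpa using hz)
    · exact (hout τ hτ z (not_le.1 hz).le).le.trans (hym (Metric.mem_closedBall_self hR.le))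
  -- The maximizer is picked separately at each time; no regularity of `y` in `τ` is needed.
  choose y hy using hmax
  set M : ℝ → ℝ := fun τ => F (y τ) τ with hM
  -- time regularity of the maximum
  have hLip : ∀ δ ∈ Ioc 0 t, ∃ K : ℝ≥0, LipschitzOnWith K M (Icc δ t) := by
    intro δ hδ
    obtain ⟨K, hK⟩ := hlip R δ hδ
    obtain ⟨B, hB⟩ := (isCompact_closedBall (0 : R3) R).exists_bound_of_continuousOn
      continuous_coshSum.continuousOn
    have hE : LipschitzOnWith (Real.toNNReal (ν * Real.exp (ν * t)))
        (fun τ => Real.exp (ν * τ)) (Icc δ t) := by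
      refine (convex_Icc δ t).lipschitzOnWith_of_nnnorm_hasDerivWithin_le
        (f' := fun τ => Real.exp (ν * τ) * ν) (fun τ _ => ?_) (fun τ hτ => ?_)
      · simpa using ((hasDerivAt_id τ).const_mul ν).exp.hasDerivWithinAt
      · rw [← NNReal.coe_le_coe, coe_nnnorm, Real.coe_toNNReal _ (by positivity), Real.norm_eq_abs,
          abs_of_nonneg (by positivity), mul_comm]
        exact mul_le_mul_of_nonneg_left (hexp2 τ ⟨hδ.1.le.trans hτ.1, hτ.2⟩) hν.le
    set K' : ℝ := K + ε * (ν * Real.exp (ν * t) * |B|)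
    have hK'0 : 0 ≤ K' := by positivity
    -- Testing the maximum at time `τ'` with the maximizer of time `τ` gives a one-sided estimate at
    -- a fixed point of the ball; exchanging the times gives the other side.
    have hone : ∀ τ ∈ Icc δ t, ∀ τ' ∈ Icc δ t, M τ - M τ' ≤ K' * |τ - τ'| := by
      intro τ hτ τ' hτ'
      have hτ0 : τ ∈ Icc 0 t := ⟨hδ.1.le.trans hτ.1, hτ.2⟩
      have hτ0' : τ' ∈ Icc 0 t := ⟨hδ.1.le.trans hτ'.1, hτ'.2⟩
      obtain ⟨hn, -⟩ := hy τ hτ0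
      have h1 := (hy τ' hτ0').2 (y τ)
      have h2 := (le_abs_self _).trans ((hK (y τ) hn).dist_le_mul τ hτ τ' hτ')
      have h3 := (neg_abs_le _).trans' (neg_le_neg (hE.dist_le_mul τ hτ τ' hτ'))
      rw [Real.coe_toNNReal _ (by positivity)] at h3
      have h4 : coshSum (y τ) ≤ |B| :=
        (le_abs_self _).trans ((hB (y τ) (by simpa using hn)).trans (le_abs_self _))
      have h5 : -(ν * Real.exp (ν * t) * |B| * |τ - τ'|) ≤
          (Real.exp (ν * τ) - Real.exp (ν * τ')) * coshSum (y τ) := by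
        have h6 := mul_le_mul_of_nonneg_right h3 (coshSum_pos (y τ)).le
        have h7 : (ν * Real.exp (ν * t) * |τ - τ'|) * coshSum (y τ) ≤
          (ν * Real.exp (ν * t) * |τ - τ'|) * |B| := by gcongr
        rw [Real.dist_eq] at h6
        linarith
      have h8 := mul_le_mul_of_nonneg_left h5 hε.le
      rw [Real.dist_eq] at h2
      simp only [hM, hF, K'] at h1 ⊢
      linarith
    refine ⟨⟨K', hK'0⟩, LipschitzOnWith.of_dist_le_mul fun τ hτ τ' hτ' => ?_⟩
    rw [Real.dist_eq, Real.dist_eq, abs_le]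
    constructor
    · have := hone τ' hτ' τ hτ
      rw [abs_sub_comm] at this
      change -(K' * |τ - τ'|) ≤ _
      linarith
    · exact hone τ hτ τ' hτ'
  -- the derivative of the maximum
  have hder : ∀ᵐ τ, τ ∈ Ioo 0 t → ∀ d, HasDerivAt M d τ → d ≤ 0 := by
    filter_upwards [heq] with τ hτ hτI d hd
    have hτ0 : τ ∈ Icc 0 t := Ioo_subset_Icc_self hτI
    obtain ⟨hn, hmx⟩ := hy τ hτ0
    have hall := hτ hτI
    have hF' : HasDerivAt (F (y τ)) (ν * ∑ i, partialD (fun w => partialD (fun w => f w τ) i w) i (y τ)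
        - ε * (Real.exp (ν * τ) * ν * coshSum (y τ))) τ := by
      refine (hall (y τ)).2.2.sub ((HasDerivAt.mul_const ?_ _).const_mul ε)
      simpa using ((hasDerivAt_id τ).const_mul ν).exp
    -- `M` lies above the smooth-in-time function `F (y τ)` and touches it at `τ`, so the two
    -- derivatives agree there.
    have hmin : IsLocalMin (M - F (y τ)) τ := by
      filter_upwards [Ioo_mem_nhds hτI.1 hτI.2] with σ hσ
      simp only [Pi.sub_apply, hM, sub_self]
      linarith [(hy σ (Ioo_subset_Icc_self hσ)).2 (y τ)]
    have hd0 := hmin.hasDerivAt_eq_zero (hd.sub hF')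
    have hsec : ∀ i, partialD (fun w => partialD (fun w => f w τ) i w) i (y τ) ≤
        ε * Real.exp (ν * τ) * Real.cosh (y τ i) := by
      intro i
      set h : ℝ → ℝ := fun s => F (y τ + s • stdVec i) τ with hh
      have hd1 : ∀ s, HasDerivAt h (partialD (fun w => f w τ) i (y τ + s • stdVec i)
          - ε * (Real.exp (ν * τ) * Real.sinh (y τ i + s))) s := by
        intro s
        have h1 := ((hall (y τ + s • stdVec i)).1 i).hasDerivAt_line
        exact h1.sub (((coshSum_line_hasDerivAt _ _ _).const_mul _).const_mul _)
      have hd2 : deriv h = fun s => partialD (fun w => f w τ) i (y τ + s • stdVec i)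
          - ε * (Real.exp (ν * τ) * Real.sinh (y τ i + s)) := funext fun s => (hd1 s).deriv
      have hlm : IsLocalMax h 0 := Filter.Eventually.of_forall fun s => by
        simpa [hh] using hmx (y τ + s • stdVec i)
      have h2 := deriv_deriv_nonpos_of_isLocalMax hlm (hd1 0).continuousAt
      rw [hd2] at h2
      have h3 : HasDerivAt (fun s : ℝ => ε * (Real.exp (ν * τ) * Real.sinh (y τ i + s)))
          (ε * (Real.exp (ν * τ) * Real.cosh (y τ i))) 0 := by
        have := ((((hasDerivAt_id (0 : ℝ)).const_add (y τ i)).sinh).const_mul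
          (Real.exp (ν * τ))).const_mul ε
        simpa using this
      have h4 := ((hall (y τ)).2.1 i).hasDerivAt.fun_sub h3
      rw [h4.deriv] at h2
      linarith
    have hsum : ∑ i, partialD (fun w => partialD (fun w => f w τ) i w) i (y τ) ≤
        ε * Real.exp (ν * τ) * coshSum (y τ) := by
      rw [coshSum, Finset.mul_sum]
      exact Finset.sum_le_sum fun i _ => hsec i
    have := mul_le_mul_of_nonneg_left hsum hν.le
    linarith
  -- conclusion
  rcases hτ₀.1.eq_or_lt with h00 | h00
  · rw [← h00, h0]
    have := mul_pos hε (mul_pos (Real.exp_pos (ν * 0)) (coshSum_pos z₀))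
    linarith
  refine le_of_forall_pos_le_add fun η hη => ?_
  have hcpt : IsCompact (Metric.closedBall (0 : R3) R ×ˢ Icc 0 t) :=
    (isCompact_closedBall _ _).prod isCompact_Icc
  -- The Lipschitz bound degenerates at time zero. The gap is closed by uniform continuity: `M δ'`
  -- is within `η` of a value of `F` at time zero, which is nonpositive.
  have huc := hcpt.uniformContinuousOn_of_continuous (hFc.mono (prod_mono_left (subset_univ _)))
  rw [Metric.uniformContinuousOn_iff] at huc
  obtain ⟨δ, hδ, hδη⟩ := huc η hη
  set δ' := min (δ / 2) τ₀
  have hδ'0 : 0 < δ' := lt_min (by linarith) h00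
  have hδ'τ : δ' ≤ τ₀ := min_le_right _ _
  have hδ't : δ' ≤ t := hδ'τ.trans hτ₀.2
  have hδ'm : δ' ∈ Icc 0 t := ⟨hδ'0.le, hδ't⟩
  obtain ⟨K, hK⟩ := hLip δ' ⟨hδ'0, hδ't⟩
  have h1 : M τ₀ ≤ M δ' := by
    refine (hK.mono (Icc_subset_Icc_right hτ₀.2)).le_of_ae_deriv_nonpos hδ'τ ?_
    filter_upwards [hder] with x hx hxI
    exact hx ⟨hδ'0.trans hxI.1, hxI.2.trans_le hτ₀.2⟩
  have h2 := hδη (y δ', δ') ⟨by simpa using (hy δ' hδ'm).1, hδ'm⟩ (y δ', 0)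
    ⟨by simpa using (hy δ' hδ'm).1, ⟨le_rfl, ht⟩⟩ (by
      rw [Prod.dist_eq]
      simp only [dist_self, Real.dist_eq, sub_zero, abs_of_pos hδ'0]
      exact max_lt hδ ((min_le_left _ _).trans_lt (by linarith)))
  have h3 : F (y δ') 0 ≤ 0 := by
    simp only [hF, h0]
    have := mul_pos hε (mul_pos (Real.exp_pos (ν * 0)) (coshSum_pos (y δ')))
    linarith
  have h4 := (abs_lt.1 h2).2
  have h5 := (hy τ₀ hτ₀).2 z₀
  simp only [hM] at h1
  simp only [] at h4
  linarith

theorem HasPartial.neg {f : R3 → ℝ} {i : Fin 3} {x : R3} (h : HasPartial f i x) :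
    HasPartial (fun y => -f y) i x :=
  DifferentiableAt.neg h

theorem partialD_neg (f : R3 → ℝ) (i : Fin 3) (x : R3) :
    partialD (fun y => -f y) i x = -partialD f i x := by
  simp only [partialD, lineDeriv]
  exact deriv.fun_neg

/-- Uniqueness of slowly growing solutions of the heat equation. -/
theorem heat_unique {ν t : ℝ} (hν : 0 < ν) {f : R3 → ℝ → ℝ}
    (hc : ContinuousOn (fun w : R3 × ℝ => f w.1 w.2) (univ ×ˢ Icc 0 t)) {L : ℝ} {l : ℕ}
    (hg : ∀ z, ∀ τ ∈ Icc 0 t, |f z τ| ≤ L * (1 + ‖z‖) ^ l) (h0 : ∀ z, f z 0 = 0)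
    (hlip : ∀ R : ℝ, ∀ δ ∈ Ioc 0 t, ∃ K : ℝ≥0, ∀ z : R3, ‖z‖ ≤ R → LipschitzOnWith K (f z) (Icc δ t))
    (heq : ∀ᵐ τ, τ ∈ Ioo 0 t → ∀ z,
      (∀ i, HasPartial (fun y => f y τ) i z) ∧
      (∀ i, HasPartial (fun y => partialD (fun y => f y τ) i y) i z) ∧
      HasDerivAt (f z) (ν * ∑ i, partialD (fun y => partialD (fun y => f y τ) i y) i z) τ) :
    ∀ z, ∀ τ ∈ Icc 0 t, f z τ = 0 := by
  intro z τ hτ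
  refine le_antisymm (heat_nonpos hν hc hg h0 hlip heq z τ hτ) ?_
  have := heat_nonpos (f := fun z τ => -f z τ) hν hc.neg (L := L) (l := l)
    (fun z τ hτ => by rw [abs_neg]; exact hg z τ hτ) (fun z => by rw [h0, neg_zero])
    (fun R δ hδ => by
      obtain ⟨K, hK⟩ := hlip R δ hδ
      exact ⟨K, fun z hz => (hK z hz).neg⟩) ?_ z τ hτ
  · linarith
  filter_upwards [heq] with σ h hσ w
  obtain ⟨h1, h2, h3⟩ := h hσ w
  simp only [partialD_neg, Finset.sum_neg_distrib, mul_neg]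
  exact ⟨fun i => (h1 i).neg, fun i => (h2 i).neg, h3.neg⟩

/-! ### The heat kernel and its derivatives -/

/-- The heat kernel `(4πνt)^(-3/2) exp(-|y|² / (4νt))`. -/
noncomputable def gaussK (ν t : ℝ) (y : R3) : ℝ :=
  1 / (4 * Real.pi * ν * t) ^ (3 / 2 : ℝ) * Real.exp (-(‖y‖ ^ 2 / (4 * ν * t)))

/-- The partial derivative of `x ↦ gaussK ν t (z - x)` at `z - x = y`. -/
noncomputable def gaussK₁ (ν : ℝ) (i : Fin 3) (t : ℝ) (y : R3) : ℝ :=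
  gaussK ν t y * (y i / (2 * ν * t))

/-- The second partial derivative of `x ↦ gaussK ν t (z - x)` at `z - x = y`. -/
noncomputable def gaussK₂ (ν : ℝ) (i : Fin 3) (t : ℝ) (y : R3) : ℝ :=
  gaussK ν t y * ((y i / (2 * ν * t)) ^ 2 - 1 / (2 * ν * t))

theorem norm_stdVec (i : Fin 3) : ‖stdVec i‖ = 1 := by
  simp [stdVec]

theorem norm_sub_smul_stdVec_sq (y : R3) (i : Fin 3) (s : ℝ) :
    ‖y - s • stdVec i‖ ^ 2 = ‖y‖ ^ 2 - 2 * s * y i + s ^ 2 := by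
  have h : inner ℝ y (stdVec i) = y i := by
    simp [stdVec, EuclideanSpace.inner_single_right]
  rw [norm_sub_sq_real, norm_smul, norm_stdVec, inner_smul_right, h, Real.norm_eq_abs, mul_one,
    sq_abs]
  ring

theorem coord_sub_smul_stdVec (y : R3) (i : Fin 3) (s : ℝ) :
    (y - s • stdVec i) i = y i - s := by
  simp [stdVec]

theorem gaussK_line_hasDerivAt {ν t : ℝ} (hν : 0 < ν) (ht : 0 < t) (i : Fin 3) (y : R3) (s : ℝ) :
    HasDerivAt (fun s : ℝ => gaussK ν t (y - s • stdVec i)) (gaussK₁ ν i t (y - s • stdVec i)) s := by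
  simp only [gaussK, gaussK₁, norm_sub_smul_stdVec_sq, coord_sub_smul_stdVec]
  have h1 : HasDerivAt (fun s : ℝ => -((‖y‖ ^ 2 - 2 * s * y i + s ^ 2) / (4 * ν * t)))
      ((y i - s) / (2 * ν * t)) s := by
    have h : HasDerivAt (fun s : ℝ => ‖y‖ ^ 2 - 2 * s * y i + s ^ 2) (- (2 * y i) + 2 * s) s := by
      have := ((((hasDerivAt_id s).const_mul 2).mul_const (y i)).const_sub (‖y‖ ^ 2)).fun_add
        ((hasDerivAt_id s).pow 2)
      simpa using this
    refine (h.div_const (4 * ν * t)).fun_neg.congr_deriv ?_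
    field_simp
    ring
  refine (h1.exp.const_mul (1 / (4 * Real.pi * ν * t) ^ (3 / 2 : ℝ))).congr_deriv ?_
  ring

theorem gaussK₁_line_hasDerivAt {ν t : ℝ} (hν : 0 < ν) (ht : 0 < t) (i : Fin 3) (y : R3) (s : ℝ) :
    HasDerivAt (fun s : ℝ => gaussK₁ ν i t (y - s • stdVec i))
      (gaussK₂ ν i t (y - s • stdVec i)) s := by
  have h1 : HasDerivAt (fun s : ℝ => (y - s • stdVec i) i / (2 * ν * t)) (-1 / (2 * ν * t)) s := by
    simp only [coord_sub_smul_stdVec]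
    exact ((hasDerivAt_id s).const_sub (y i)).div_const _
  refine ((gaussK_line_hasDerivAt hν ht i y s).fun_mul h1).congr_deriv ?_
  simp only [gaussK₁, gaussK₂]
  ring

/-- Differentiating the prefactor produces `-3 / (2t)`, which is `ν` times the sum of the three
terms `-1 / (2νt)`; the exponent produces the quadratic part. -/
theorem gaussK_time_hasDerivAt {ν t : ℝ} (hν : 0 < ν) (ht : 0 < t) (y : R3) :
    HasDerivAt (fun τ => gaussK ν τ y) (ν * ∑ i, gaussK₂ ν i t y) t := by
  have hc : 0 < 4 * Real.pi * ν * t := by positivity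
  have h1 : HasDerivAt (fun τ : ℝ => 1 / (4 * Real.pi * ν * τ) ^ (3 / 2 : ℝ))
      (1 / (4 * Real.pi * ν * t) ^ (3 / 2 : ℝ) * (-(3 / (2 * t)))) t := by
    have h2 : HasDerivAt (fun τ : ℝ => 4 * Real.pi * ν * τ) (4 * Real.pi * ν) t := by
      simpa using (hasDerivAt_id t).const_mul (4 * Real.pi * ν)
    have h3 := (h2.rpow_const (p := 3 / 2) (Or.inl hc.ne')).fun_inv (Real.rpow_pos_of_pos hc _).ne'
    simp only [one_div]
    refine h3.congr_deriv ?_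
    rw [Real.rpow_sub hc, Real.rpow_one]
    have := (Real.rpow_pos_of_pos hc (3 / 2)).ne'
    field_simp
  have h4 : HasDerivAt (fun τ : ℝ => -(‖y‖ ^ 2 / (4 * ν * τ))) (‖y‖ ^ 2 / (4 * ν * t ^ 2)) t := by
    have h2 : HasDerivAt (fun τ : ℝ => 4 * ν * τ) (4 * ν) t := by
      simpa using (hasDerivAt_id t).const_mul (4 * ν)
    refine ((h2.fun_inv (by positivity)).const_mul (‖y‖ ^ 2)).fun_neg.congr_deriv ?_
    field_simp
  have h5 : ‖y‖ ^ 2 = ∑ i, y i ^ 2 := by simp [EuclideanSpace.norm_sq_eq]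
  refine (h1.fun_mul h4.exp).congr_deriv ?_
  have h6 : ∑ i, ((y i / (2 * ν * t)) ^ 2 - 1 / (2 * ν * t)) =
      ‖y‖ ^ 2 / (2 * ν * t) ^ 2 - 3 / (2 * ν * t) := by
    rw [Finset.sum_sub_distrib, h5, Finset.sum_div]
    simp [div_pow]
    ring
  simp only [gaussK₂, gaussK, ← Finset.mul_sum, h6]
  field_simp
  ring

theorem continuous_gaussK (ν t : ℝ) : Continuous (gaussK ν t) := by
  unfold gaussK; fun_prop

theorem continuous_gaussK₁ (ν : ℝ) (i : Fin 3) (t : ℝ) : Continuous (gaussK₁ ν i t) := by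
  have := continuous_gaussK ν t
  unfold gaussK₁; fun_prop

theorem continuous_gaussK₂ (ν : ℝ) (i : Fin 3) (t : ℝ) : Continuous (gaussK₂ ν i t) := by
  have := continuous_gaussK ν t
  unfold gaussK₂; fun_prop

theorem gaussK_nonneg {ν t : ℝ} (hν : 0 < ν) (ht : 0 ≤ t) (y : R3) : 0 ≤ gaussK ν t y := by
  unfold gaussK; positivity

/-- The heat kernel and its first two partial derivatives decay exponentially, uniformly for times
in a compact subset of `(0, ∞)`. -/
theorem exists_gaussK_bound {ν a : ℝ} (hν : 0 < ν) (ha : 0 < a) (b : ℝ) :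
    ∃ A : ℝ, 0 ≤ A ∧ ∀ t ∈ Icc a b, ∀ y, |gaussK ν t y| ≤ A * Real.exp (-‖y‖) ∧
      ∀ i, |gaussK₁ ν i t y| ≤ A * Real.exp (-‖y‖) ∧ |gaussK₂ ν i t y| ≤ A * Real.exp (-‖y‖) := by
  by_cases hab : a ≤ b
  swap
  · exact ⟨0, le_rfl, fun t ht => absurd (ht.1.trans ht.2) hab⟩
  have hb : 0 < b := ha.trans_le hab
  set P : ℝ := 1 / (4 * Real.pi * ν * a) ^ (3 / 2 : ℝ) with hP
  set c : ℝ := 4 * ν * b with hcdef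
  set k : ℝ := 1 / (2 * ν * a) with hk
  have hc : 0 < c := by positivity
  have hk0 : 0 < k := by positivity
  have hP0 : 0 < P := by positivity
  have hbase : ∀ t ∈ Icc a b, ∀ y, |gaussK ν t y| ≤ P * (Real.exp c * Real.exp (-2 * ‖y‖)) := by
    intro t ht y
    have ht0 : 0 < t := ha.trans_le ht.1
    rw [abs_of_nonneg (gaussK_nonneg hν ht0.le y), gaussK, ← Real.exp_add]
    have h1 : 1 / (4 * Real.pi * ν * t) ^ (3 / 2 : ℝ) ≤ P := by
      rw [hP]
      gcongr
      exact ht.1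
    have h2 : -(‖y‖ ^ 2 / (4 * ν * t)) ≤ c + -2 * ‖y‖ := by
      have h3 : ‖y‖ ^ 2 / c ≤ ‖y‖ ^ 2 / (4 * ν * t) := by
        rw [hcdef]
        gcongr
        exact ht.2
      -- Completing the square, `|y|² / c ≥ 2|y| - c`, turns Gaussian decay into `exp(-2|y|)`.
      have h4 : 0 ≤ ‖y‖ ^ 2 / c - 2 * ‖y‖ + c := by
        have : ‖y‖ ^ 2 / c - 2 * ‖y‖ + c = (‖y‖ - c) ^ 2 / c := by field_simp; ring
        rw [this]; positivity
      linarith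
    gcongr
  -- Half of the exponential rate is spent on the quadratic factors of the kernel derivatives.
  have hexp2 : ∀ r : ℝ, 0 ≤ r → (1 + r ^ 2) * Real.exp (-2 * r) ≤ 2 * Real.exp (-r) := by
    intro r hr
    have h1 : 1 + r + r ^ 2 / 2 ≤ Real.exp r := Real.quadratic_le_exp_of_nonneg hr
    have h2 : Real.exp (-2 * r) = Real.exp (-r) * Real.exp (-r) := by
      rw [← Real.exp_add]; ring_nf
    have h3 : Real.exp r * Real.exp (-r) = 1 := by rw [← Real.exp_add]; simp
    have h4 : 1 + r ^ 2 ≤ 2 * Real.exp r := by nlinarith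
    have h5 := mul_le_mul_of_nonneg_right h4 (Real.exp_pos (-r)).le
    rw [h2, ← mul_assoc]
    refine mul_le_mul_of_nonneg_right ?_ (Real.exp_pos _).le
    linarith
  set Q : ℝ := P * Real.exp c with hQ
  have hQ0 : 0 < Q := by positivity
  refine ⟨Q * (2 * (1 + k + k ^ 2)), by positivity, fun t ht y => ?_⟩
  have ht0 : 0 < t := ha.trans_le ht.1
  have h0 := hbase t ht y
  rw [← mul_assoc] at h0
  have hkt : 1 / (2 * ν * t) ≤ k := by
    rw [hk]; gcongr; exact ht.1
  have hkt0 : 0 < 1 / (2 * ν * t) := by positivity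
  have hgen : ∀ q : ℝ, |q| ≤ (1 + k + k ^ 2) * (1 + ‖y‖ ^ 2) →
      |gaussK ν t y * q| ≤ Q * (2 * (1 + k + k ^ 2)) * Real.exp (-‖y‖) := by
    intro q hq
    have hE := hexp2 ‖y‖ (norm_nonneg y)
    rw [abs_mul]
    calc |gaussK ν t y| * |q| ≤ (Q * Real.exp (-2 * ‖y‖)) * ((1 + k + k ^ 2) * (1 + ‖y‖ ^ 2)) := by
          gcongr
      _ = Q * (1 + k + k ^ 2) * ((1 + ‖y‖ ^ 2) * Real.exp (-2 * ‖y‖)) := by ring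
      _ ≤ Q * (1 + k + k ^ 2) * (2 * Real.exp (-‖y‖)) := by gcongr
      _ = _ := by ring
  refine ⟨?_, fun i => ?_⟩
  · have hA := mul_nonneg hk0.le (sq_nonneg ‖y‖)
    have hB := mul_nonneg (sq_nonneg k) (sq_nonneg ‖y‖)
    have h1 : |(1 : ℝ)| ≤ (1 + k + k ^ 2) * (1 + ‖y‖ ^ 2) := by
      rw [abs_one]
      nlinarith [sq_nonneg ‖y‖, sq_nonneg k]
    simpa only [mul_one] using hgen 1 h1
  · have hyi : |y i| ≤ ‖y‖ := by
      simpa using PiLp.norm_apply_le y i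
    have h1 : |y i / (2 * ν * t)| ≤ k * ‖y‖ := by
      rw [abs_div, abs_of_pos (by positivity : 0 < 2 * ν * t), div_eq_mul_one_div, mul_comm]
      gcongr
    have hA := mul_nonneg hk0.le (sq_nonneg ‖y‖)
    have hB := mul_nonneg (sq_nonneg k) (sq_nonneg ‖y‖)
    have hC := mul_nonneg hk0.le (sq_nonneg (‖y‖ - 1))
    refine ⟨hgen _ (h1.trans ?_), hgen _ ?_⟩
    · nlinarith [sq_nonneg ‖y‖, sq_nonneg k]
    · have h2 : (y i / (2 * ν * t)) ^ 2 ≤ (k * ‖y‖) ^ 2 := by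
        rw [← sq_abs]; gcongr
      have h3 := sq_nonneg (y i / (2 * ν * t))
      rw [abs_le]
      constructor <;> nlinarith [sq_nonneg ‖y‖, sq_nonneg k]

/-- The exponential dominates every power, so the comparison is with `(1 + |y|)^(-4)`, integrable in
dimension three. The constant comes from `rⁿ / n! ≤ exp r` at `r = 1 + |y|`, `n = l + 4`. -/
theorem integrable_poly_mul_exp_neg_norm (l : ℕ) :
    Integrable (fun y : R3 => (1 + ‖y‖) ^ l * Real.exp (-‖y‖)) := by
  have h1 : Integrable (fun y : R3 => (1 + ‖y‖) ^ (-(4 : ℝ))) :=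
    integrable_one_add_norm (by simp; norm_num)
  refine (h1.const_mul ((l + 4).factorial * Real.exp 1)).mono'
    (Continuous.aestronglyMeasurable (by fun_prop)) (Filter.Eventually.of_forall fun y => ?_)
  have hr : 0 < 1 + ‖y‖ := by positivity
  rw [Real.norm_eq_abs, abs_of_nonneg (by positivity), Real.rpow_neg hr.le,
    show (4 : ℝ) = (4 : ℕ) by norm_num, Real.rpow_natCast, ← div_eq_mul_inv, le_div_iff₀ (by positivity)]
  have h2 := Real.pow_div_factorial_le_exp (1 + ‖y‖) hr.le (l + 4)
  rw [div_le_iff₀ (by positivity)] at h2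
  calc (1 + ‖y‖) ^ l * Real.exp (-‖y‖) * (1 + ‖y‖) ^ 4
      = (1 + ‖y‖) ^ (l + 4) * Real.exp (-‖y‖) := by ring
    _ ≤ Real.exp (1 + ‖y‖) * (l + 4).factorial * Real.exp (-‖y‖) := by gcongr
    _ = (l + 4).factorial * Real.exp (1 + ‖y‖ + -‖y‖) := by rw [Real.exp_add (1 + ‖y‖)]; ring
    _ = _ := by simp

theorem one_add_norm_add_le (x y : R3) : 1 + ‖x + y‖ ≤ (1 + ‖x‖) * (1 + ‖y‖) := by
  nlinarith [norm_add_le x y, norm_nonneg x, norm_nonneg y, mul_nonneg (norm_nonneg x) (norm_nonneg y)]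

/-- Submultiplicativity of `1 + |·|` trades growth in `z` for growth in `x` times a function of `z -
x`, whose integral is translation invariant. -/
theorem exp_mul_poly_le (x z : R3) (l : ℕ) :
    Real.exp (-‖z - x‖) * (1 + ‖z‖) ^ l ≤
      (1 + ‖x‖) ^ l * ((1 + ‖z - x‖) ^ l * Real.exp (-‖z - x‖)) := by
  have h : (1 + ‖z‖) ^ l ≤ ((1 + ‖x‖) * (1 + ‖z - x‖)) ^ l := by
    gcongr
    simpa using one_add_norm_add_le x (z - x)
  rw [mul_pow] at h
  calc _ ≤ Real.exp (-‖z - x‖) * ((1 + ‖x‖) ^ l * (1 + ‖z - x‖) ^ l) := by gcongr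
    _ = _ := by ring

theorem integrable_exp_mul_poly (x : R3) (l : ℕ) :
    Integrable (fun z : R3 => Real.exp (-‖z - x‖) * (1 + ‖z‖) ^ l) := by
  have := ((integrable_poly_mul_exp_neg_norm l).comp_sub_right x).const_mul ((1 + ‖x‖) ^ l)
  refine this.mono' (Continuous.aestronglyMeasurable (by fun_prop))
    (Filter.Eventually.of_forall fun z => ?_)
  rw [Real.norm_eq_abs, abs_of_nonneg (by positivity)]
  exact exp_mul_poly_le x z l

/-- The moment `∫ (1 + |y|)^l exp(-|y|) dy`. -/
noncomputable def expMoment (l : ℕ) : ℝ := ∫ y : R3, (1 + ‖y‖) ^ l * Real.exp (-‖y‖)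

theorem expMoment_nonneg (l : ℕ) : 0 ≤ expMoment l :=
  integral_nonneg fun y => by positivity

section Convolution

variable {k g : R3 → ℝ} {A B : ℝ} {l : ℕ}

theorem conv_pointwise_bound (hk : ∀ y, |k y| ≤ A * Real.exp (-‖y‖))
    (hg : ∀ z, |g z| ≤ B * (1 + ‖z‖) ^ l) (x z : R3) :
    ‖k (z - x) * g z‖ ≤ A * B * (Real.exp (-‖z - x‖) * (1 + ‖z‖) ^ l) := by
  rw [Real.norm_eq_abs, abs_mul]
  calc _ ≤ (A * Real.exp (-‖z - x‖)) * (B * (1 + ‖z‖) ^ l) :=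
        mul_le_mul (hk _) (hg _) (abs_nonneg _) ((abs_nonneg _).trans (hk _))
    _ = _ := by ring

theorem integrable_conv (hkc : Continuous k) (hgc : Continuous g)
    (hk : ∀ y, |k y| ≤ A * Real.exp (-‖y‖)) (hg : ∀ z, |g z| ≤ B * (1 + ‖z‖) ^ l) (x : R3) :
    Integrable (fun z => k (z - x) * g z) :=
  ((integrable_exp_mul_poly x l).const_mul (A * B)).mono'
    (Continuous.aestronglyMeasurable (by fun_prop))
    (Filter.Eventually.of_forall fun z => conv_pointwise_bound hk hg x z)

theorem abs_conv_le (hA : 0 ≤ A) (hB : 0 ≤ B)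
    (hk : ∀ y, |k y| ≤ A * Real.exp (-‖y‖)) (hg : ∀ z, |g z| ≤ B * (1 + ‖z‖) ^ l) (x : R3) :
    |∫ z, k (z - x) * g z| ≤ A * B * expMoment l * (1 + ‖x‖) ^ l := by
  have hi := ((integrable_poly_mul_exp_neg_norm l).comp_sub_right x).const_mul
    (A * B * (1 + ‖x‖) ^ l)
  have h1 := norm_integral_le_of_norm_le hi (f := fun z => k (z - x) * g z)
    (Filter.Eventually.of_forall fun z => by
      refine (conv_pointwise_bound hk hg x z).trans ?_
      have := mul_le_mul_of_nonneg_left (exp_mul_poly_le x z l) (mul_nonneg hA hB)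
      linarith)
  rw [integral_const_mul,
    integral_sub_right_eq_self (fun y : R3 => (1 + ‖y‖) ^ l * Real.exp (-‖y‖)) x] at h1
  rw [Real.norm_eq_abs] at h1
  refine h1.trans (le_of_eq ?_)
  rw [expMoment]; ring

/-- Differentiation under the integral sign. For `|s| < 1`, moving the centre by `s` costs at most
the factor `exp 1` in the exponential bound, which yields an integrable majorant independent of `s`.
-/
theorem conv_line_hasDerivAt {k' : R3 → ℝ} (i : Fin 3) (hA : 0 ≤ A) (hB : 0 ≤ B) (hkc : Continuous k)
    (hkc' : Continuous k') (hgc : Continuous g)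
    (hk : ∀ y, |k y| ≤ A * Real.exp (-‖y‖)) (hk' : ∀ y, |k' y| ≤ A * Real.exp (-‖y‖))
    (hd : ∀ y (s : ℝ), HasDerivAt (fun s : ℝ => k (y - s • stdVec i)) (k' (y - s • stdVec i)) s)
    (hg : ∀ z, |g z| ≤ B * (1 + ‖z‖) ^ l) (x : R3) :
    HasDerivAt (fun s : ℝ => ∫ z, k (z - (x + s • stdVec i)) * g z) (∫ z, k' (z - x) * g z) 0 := by
  have h := (hasDerivAt_integral_of_dominated_loc_of_deriv_le (μ := volume)
    (F := fun (s : ℝ) z => k (z - (x + s • stdVec i)) * g z)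
    (F' := fun (s : ℝ) z => k' (z - (x + s • stdVec i)) * g z) (x₀ := 0)
    (bound := fun z => A * Real.exp 1 * B * (Real.exp (-‖z - x‖) * (1 + ‖z‖) ^ l))
    (Metric.ball_mem_nhds (0 : ℝ) one_pos) ?_ ?_ ?_ ?_ ?_ ?_).2
  · simpa using h
  · exact Filter.Eventually.of_forall fun s => Continuous.aestronglyMeasurable (by fun_prop)
  · exact integrable_conv hkc hgc hk hg _
  · exact Continuous.aestronglyMeasurable (by fun_prop)
  · refine Filter.Eventually.of_forall fun z s hs => ?_
    refine (conv_pointwise_bound hk' hg _ z).trans ?_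
    have h1 : Real.exp (-‖z - (x + s • stdVec i)‖) ≤ Real.exp 1 * Real.exp (-‖z - x‖) := by
      rw [← Real.exp_add, Real.exp_le_exp]
      have h2 : ‖s • stdVec i‖ ≤ 1 := by
        rw [norm_smul, norm_stdVec, mul_one]
        exact (mem_ball_zero_iff.1 hs).le
      have h3 := norm_add_le (z - (x + s • stdVec i)) (s • stdVec i)
      rw [show z - (x + s • stdVec i) + s • stdVec i = z - x by abel] at h3
      linarith
    calc _ ≤ A * B * (Real.exp 1 * Real.exp (-‖z - x‖) * (1 + ‖z‖) ^ l) := by gcongr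
      _ = _ := by ring
  · exact (integrable_exp_mul_poly x l).const_mul _
  · refine Filter.Eventually.of_forall fun z s _ => ?_
    have := (hd (z - x) s).mul_const (g z)
    simpa only [sub_add_eq_sub_sub] using this

end Convolution

/-! ### The heat semigroup on polynomially bounded functions -/

/-- The heat semigroup `∫ gaussK(z - x) g(z) dz`. -/
noncomputable def heatSG (ν : ℝ) (g : R3 → ℝ) (t : ℝ) (x : R3) : ℝ := ∫ z, gaussK ν t (z - x) * g z

/-- The first partial derivatives of the heat semigroup. -/
noncomputable def heatSG₁ (ν : ℝ) (i : Fin 3) (g : R3 → ℝ) (t : ℝ) (x : R3) : ℝ :=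
  ∫ z, gaussK₁ ν i t (z - x) * g z

/-- The pure second partial derivatives of the heat semigroup. -/
noncomputable def heatSG₂ (ν : ℝ) (i : Fin 3) (g : R3 → ℝ) (t : ℝ) (x : R3) : ℝ :=
  ∫ z, gaussK₂ ν i t (z - x) * g z

/-- The heat semigroup in the parabolic variable `ξ = (z - x) / √t`. -/
noncomputable def heatSGScaled (ν : ℝ) (g : R3 → ℝ) (t : ℝ) (x : R3) : ℝ :=
  ∫ ξ, gaussK ν 1 ξ * g (x + √t • ξ)

theorem integral_gaussK_one {ν : ℝ} (hν : 0 < ν) : ∫ y, gaussK ν 1 y = 1 := by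
  have h := GaussianFourier.integral_rexp_neg_mul_sq_norm (V := R3) (b := 1 / (4 * ν)) (by positivity)
  have h2 : ∀ y : R3, gaussK ν 1 y =
      1 / (4 * Real.pi * ν) ^ (3 / 2 : ℝ) * Real.exp (-(1 / (4 * ν)) * ‖y‖ ^ 2) := by
    intro y
    rw [gaussK, mul_one, mul_one]
    congr 2
    ring
  simp_rw [h2, integral_const_mul, h]
  have h3 : Real.pi / (1 / (4 * ν)) = 4 * Real.pi * ν := by field_simp
  rw [h3]
  simp only [finrank_euclideanSpace, Fintype.card_fin, Nat.cast_ofNat]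
  exact one_div_mul_cancel (Real.rpow_pos_of_pos (by positivity) _).ne'

/-- Substitute `z = x + √t ξ`. The scaled kernel no longer depends on `t`, so this form makes sense
and is continuous at `t = 0`, where it returns the initial value. -/
theorem heatSG_eq_scaled {ν t : ℝ} (hν : 0 < ν) (ht : 0 < t) (g : R3 → ℝ) (x : R3) :
    heatSG ν g t x = heatSGScaled ν g t x := by
  have hs : 0 < √t := Real.sqrt_pos.2 ht
  have h1 : heatSG ν g t x = ∫ y, gaussK ν t y * g (x + y) := by
    rw [heatSG, ← integral_sub_right_eq_self (fun y => gaussK ν t y * g (x + y)) x]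
    simp
  have h2 := Measure.integral_comp_smul (μ := (volume : Measure R3))
    (fun y => gaussK ν t y * g (x + y)) (√t)
  have h3 : ∀ ξ : R3, gaussK ν t (√t • ξ) = |(√t ^ 3)⁻¹| * gaussK ν 1 ξ := by
    intro ξ
    have h4 : t ^ (3 / 2 : ℝ) = √t ^ 3 := by
      rw [Real.sqrt_eq_rpow, ← Real.rpow_natCast, ← Real.rpow_mul ht.le]
      norm_num
    rw [gaussK, gaussK, norm_smul, mul_pow, Real.norm_eq_abs, sq_abs, Real.sq_sqrt ht.le,
      abs_of_pos (by positivity), mul_one, mul_one, mul_comm (4 * Real.pi * ν) t,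
      Real.mul_rpow ht.le (by positivity), h4]
    rw [show t * ‖ξ‖ ^ 2 / (4 * ν * t) = ‖ξ‖ ^ 2 / (4 * ν) by
      rw [mul_comm t, mul_div_mul_right _ _ ht.ne']]
    ring
  simp only [finrank_euclideanSpace, Fintype.card_fin, h3, smul_eq_mul, mul_assoc] at h2
  rw [integral_const_mul] at h2
  rw [h1, heatSGScaled]
  exact (mul_left_cancel₀ (abs_pos.2 (by positivity)).ne' h2).symm

theorem heatSGScaled_zero {ν : ℝ} (hν : 0 < ν) (g : R3 → ℝ) (x : R3) :
    heatSGScaled ν g 0 x = g x := by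
  simp [heatSGScaled, integral_mul_const, integral_gaussK_one hν]

section

variable {g : R3 → ℝ} {B : ℝ} {l : ℕ} {ν t : ℝ}

theorem heatSG_line_hasDerivAt (hν : 0 < ν) (ht : 0 < t) (hgc : Continuous g) (hB : 0 ≤ B)
    (hg : ∀ z, |g z| ≤ B * (1 + ‖z‖) ^ l) (i : Fin 3) (x : R3) :
    HasDerivAt (fun s : ℝ => heatSG ν g t (x + s • stdVec i)) (heatSG₁ ν i g t x) 0 := by
  obtain ⟨A, hA, hK⟩ := exists_gaussK_bound hν ht t
  have hK := hK t ⟨le_rfl, le_rfl⟩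
  exact conv_line_hasDerivAt i hA hB (continuous_gaussK ν t) (continuous_gaussK₁ ν i t) hgc
    (fun y => (hK y).1) (fun y => ((hK y).2 i).1) (gaussK_line_hasDerivAt hν ht i) hg x

theorem heatSG₁_line_hasDerivAt (hν : 0 < ν) (ht : 0 < t) (hgc : Continuous g) (hB : 0 ≤ B)
    (hg : ∀ z, |g z| ≤ B * (1 + ‖z‖) ^ l) (i : Fin 3) (x : R3) :
    HasDerivAt (fun s : ℝ => heatSG₁ ν i g t (x + s • stdVec i)) (heatSG₂ ν i g t x) 0 := by
  obtain ⟨A, hA, hK⟩ := exists_gaussK_bound hν ht t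
  have hK := hK t ⟨le_rfl, le_rfl⟩
  exact conv_line_hasDerivAt i hA hB (continuous_gaussK₁ ν i t) (continuous_gaussK₂ ν i t) hgc
    (fun y => ((hK y).2 i).1) (fun y => ((hK y).2 i).2) (gaussK₁_line_hasDerivAt hν ht i) hg x

theorem heatSG_integrable (hν : 0 < ν) (ht : 0 < t) (hgc : Continuous g)
    (hg : ∀ z, |g z| ≤ B * (1 + ‖z‖) ^ l) (x : R3) :
    Integrable (fun z => gaussK ν t (z - x) * g z) := by
  obtain ⟨A, hA, hK⟩ := exists_gaussK_bound hν ht t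
  exact integrable_conv (continuous_gaussK ν t) hgc (fun y => (hK t ⟨le_rfl, le_rfl⟩ y).1) hg x

theorem sum_heatSG₂ (hν : 0 < ν) (ht : 0 < t) (hgc : Continuous g)
    (hg : ∀ z, |g z| ≤ B * (1 + ‖z‖) ^ l) (x : R3) :
    ∫ z, (ν * ∑ i, gaussK₂ ν i t (z - x)) * g z = ν * ∑ i, heatSG₂ ν i g t x := by
  obtain ⟨A, hA, hK⟩ := exists_gaussK_bound hν ht t
  simp only [mul_assoc, Finset.sum_mul, integral_const_mul, heatSG₂]
  rw [integral_finsetSum]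
  exact fun i _ => integrable_conv (continuous_gaussK₂ ν i t) hgc
    (fun y => ((hK t ⟨le_rfl, le_rfl⟩ y).2 i).2) hg x

theorem heatSG_time_hasDerivAt (hν : 0 < ν) (ht : 0 < t) (hgc : Continuous g)
    (hg : ∀ z, |g z| ≤ B * (1 + ‖z‖) ^ l) (x : R3) :
    HasDerivAt (fun τ => heatSG ν g τ x) (ν * ∑ i, heatSG₂ ν i g t x) t := by
  obtain ⟨A, hA, hK⟩ := exists_gaussK_bound hν (half_pos ht) (t + t / 2)
  have hmem : ∀ τ ∈ Metric.ball t (t / 2), τ ∈ Icc (t / 2) (t + t / 2) := by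
    intro τ hτ
    rw [Metric.mem_ball, Real.dist_eq, abs_lt] at hτ
    constructor <;> linarith
  rw [← sum_heatSG₂ hν ht hgc hg]
  have hcont : Continuous fun z => ν * ∑ i, gaussK₂ ν i t (z - x) := by
    have := continuous_gaussK₂ ν
    fun_prop
  refine (hasDerivAt_integral_of_dominated_loc_of_deriv_le (μ := volume)
    (F := fun (τ : ℝ) z => gaussK ν τ (z - x) * g z)
    (F' := fun (τ : ℝ) z => (ν * ∑ i, gaussK₂ ν i τ (z - x)) * g z) (x₀ := t)
    (bound := fun z => (ν * (3 * A)) * B * (Real.exp (-‖z - x‖) * (1 + ‖z‖) ^ l))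
    (Metric.ball_mem_nhds t (half_pos ht)) ?_ ?_ ?_ ?_ ?_ ?_).2
  · refine Filter.Eventually.of_forall fun τ => Continuous.aestronglyMeasurable ?_
    have := continuous_gaussK ν τ
    fun_prop
  · exact heatSG_integrable hν ht hgc hg x
  · exact (hcont.mul hgc).aestronglyMeasurable
  · refine Filter.Eventually.of_forall fun z τ hτ => ?_
    refine conv_pointwise_bound (k := fun y => ν * ∑ i, gaussK₂ ν i τ y) (fun y => ?_) hg x z
    rw [abs_mul, abs_of_pos hν, mul_assoc]
    refine mul_le_mul_of_nonneg_left ((Finset.abs_sum_le_sum_abs _ _).trans ?_) hν.le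
    refine (Finset.sum_le_sum fun i _ => ((hK τ (hmem τ hτ) y).2 i).2).trans ?_
    simp [mul_assoc]
  · exact (integrable_exp_mul_poly x l).const_mul _
  · refine Filter.Eventually.of_forall fun z τ hτ => ?_
    exact (gaussK_time_hasDerivAt hν ((half_pos ht).trans_le (hmem τ hτ).1) (z - x)).mul_const _

/-- The constant is chosen before `g`. This uniformity matters because the semigroup will act on `p₀
(Y t)`, a different function for each velocity. -/
theorem exists_heatSG_bound {a : ℝ} (hν : 0 < ν) (ha : 0 < a) (b : ℝ) (l : ℕ) :
    ∃ A : ℝ, 0 ≤ A ∧ ∀ (g : R3 → ℝ) (B : ℝ), 0 ≤ B → (∀ z, |g z| ≤ B * (1 + ‖z‖) ^ l) →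
      ∀ t ∈ Icc a b, ∀ x i, |heatSG₁ ν i g t x| ≤ A * B * (1 + ‖x‖) ^ l ∧
        |heatSG₂ ν i g t x| ≤ A * B * (1 + ‖x‖) ^ l := by
  obtain ⟨A, hA, hK⟩ := exists_gaussK_bound hν ha b
  refine ⟨A * expMoment l, mul_nonneg hA (expMoment_nonneg l), fun g B hB hg t ht x i => ?_⟩
  have h1 := abs_conv_le hA hB (fun y => ((hK t ht y).2 i).1) hg x
  have h2 := abs_conv_le hA hB (fun y => ((hK t ht y).2 i).2) hg x
  rw [show A * expMoment l * B = A * B * expMoment l by ring]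
  exact ⟨h1, h2⟩

theorem scaled_pointwise_bound {A : ℝ} (hA : ∀ ξ, |gaussK ν 1 ξ| ≤ A * Real.exp (-‖ξ‖))
    (hB : 0 ≤ B) (hg : ∀ z, |g z| ≤ B * (1 + ‖z‖) ^ l) {S r : ℝ} (ht : √t ≤ S)
    {x : R3} (hx : ‖x‖ ≤ r) (ξ : R3) :
    ‖gaussK ν 1 ξ * g (x + √t • ξ)‖ ≤
      A * (B * ((1 + r) ^ l * (1 + S) ^ l)) * ((1 + ‖ξ‖) ^ l * Real.exp (-‖ξ‖)) := by
  have hS : 0 ≤ S := (Real.sqrt_nonneg t).trans ht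
  have h1 : 1 + ‖x + √t • ξ‖ ≤ (1 + r) * ((1 + S) * (1 + ‖ξ‖)) := by
    have h2 : ‖√t • ξ‖ ≤ S * ‖ξ‖ := by
      rw [norm_smul, Real.norm_eq_abs, abs_of_nonneg (Real.sqrt_nonneg t)]
      gcongr
    calc _ ≤ (1 + ‖x‖) * (1 + ‖√t • ξ‖) := one_add_norm_add_le _ _
      _ ≤ (1 + r) * (1 + S * ‖ξ‖) := by gcongr; exact (norm_nonneg x).trans hx |> fun h => by linarith
      _ ≤ _ := by
        have := norm_nonneg ξ
        have := (norm_nonneg x).trans hx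
        gcongr
        nlinarith
  have h3 : |g (x + √t • ξ)| ≤ B * ((1 + r) * ((1 + S) * (1 + ‖ξ‖))) ^ l :=
    (hg _).trans (by gcongr)
  rw [Real.norm_eq_abs, abs_mul]
  calc _ ≤ (A * Real.exp (-‖ξ‖)) * (B * ((1 + r) * ((1 + S) * (1 + ‖ξ‖))) ^ l) :=
        mul_le_mul (hA ξ) h3 (abs_nonneg _) ((abs_nonneg _).trans (hA ξ))
    _ = _ := by rw [mul_pow, mul_pow]; ring

theorem exists_heatSGScaled_bound (hν : 0 < ν) (T : ℝ) (l : ℕ) :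
    ∃ A : ℝ, 0 ≤ A ∧ ∀ (g : R3 → ℝ) (B : ℝ), 0 ≤ B → (∀ z, |g z| ≤ B * (1 + ‖z‖) ^ l) →
      ∀ t ≤ T, ∀ x, |heatSGScaled ν g t x| ≤ A * B * (1 + ‖x‖) ^ l := by
  obtain ⟨A, hA, hK⟩ := exists_gaussK_bound hν one_pos 1
  have hK1 : ∀ ξ, |gaussK ν 1 ξ| ≤ A * Real.exp (-‖ξ‖) := fun ξ => (hK 1 ⟨le_rfl, le_rfl⟩ ξ).1
  refine ⟨A * (1 + √T) ^ l * expMoment l, ?_, fun g B hB hg t ht x => ?_⟩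
  · have := expMoment_nonneg l
    positivity
  have h1 := norm_integral_le_of_norm_le
    ((integrable_poly_mul_exp_neg_norm l).const_mul (A * (B * ((1 + ‖x‖) ^ l * (1 + √T) ^ l))))
    (Filter.Eventually.of_forall fun ξ =>
      scaled_pointwise_bound hK1 hB hg (Real.sqrt_le_sqrt ht) le_rfl ξ)
  rw [integral_const_mul, Real.norm_eq_abs] at h1
  refine h1.trans (le_of_eq ?_)
  rw [expMoment]; ring

theorem continuous_heatSGScaled (hν : 0 < ν) (hgc : Continuous g) (hB : 0 ≤ B)
    (hg : ∀ z, |g z| ≤ B * (1 + ‖z‖) ^ l) :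
    Continuous fun w : R3 × ℝ => heatSGScaled ν g w.2 w.1 := by
  obtain ⟨A, hA, hK⟩ := exists_gaussK_bound hν one_pos 1
  have hK1 : ∀ ξ, |gaussK ν 1 ξ| ≤ A * Real.exp (-‖ξ‖) := fun ξ => (hK 1 ⟨le_rfl, le_rfl⟩ ξ).1
  have hkc := continuous_gaussK ν 1
  refine continuous_iff_continuousAt.2 fun w => ?_
  refine continuousAt_of_dominated
    (bound := fun ξ => A * (B * ((1 + (‖w.1‖ + 1)) ^ l * (1 + √(w.2 + 1)) ^ l)) *
      ((1 + ‖ξ‖) ^ l * Real.exp (-‖ξ‖))) ?_ ?_ ?_ ?_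
  · exact Filter.Eventually.of_forall fun v => Continuous.aestronglyMeasurable (by fun_prop)
  · filter_upwards [Metric.ball_mem_nhds w one_pos] with v hv
    rw [Metric.mem_ball, Prod.dist_eq, max_lt_iff] at hv
    refine Filter.Eventually.of_forall fun ξ => scaled_pointwise_bound hK1 hB hg
      (Real.sqrt_le_sqrt ?_) ?_ ξ
    · have := (abs_lt.1 hv.2).2
      linarith
    · have := norm_sub_norm_le v.1 w.1
      rw [← dist_eq_norm] at this
      linarith [hv.1]
  · exact (integrable_poly_mul_exp_neg_norm l).const_mul _
  · exact Filter.Eventually.of_forall fun ξ => Continuous.continuousAt (by fun_prop)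

theorem heatSG_hasPartial (hν : 0 < ν) (ht : 0 < t) (hgc : Continuous g) (hB : 0 ≤ B)
    (hg : ∀ z, |g z| ≤ B * (1 + ‖z‖) ^ l) (i : Fin 3) (x : R3) :
    HasPartial (heatSG ν g t) i x :=
  (heatSG_line_hasDerivAt hν ht hgc hB hg i x).hasPartial

theorem partialD_heatSG (hν : 0 < ν) (ht : 0 < t) (hgc : Continuous g) (hB : 0 ≤ B)
    (hg : ∀ z, |g z| ≤ B * (1 + ‖z‖) ^ l) (i : Fin 3) :
    partialD (heatSG ν g t) i = heatSG₁ ν i g t :=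
  funext fun x => (heatSG_line_hasDerivAt hν ht hgc hB hg i x).partialD_eq

theorem heatSG₁_hasPartial (hν : 0 < ν) (ht : 0 < t) (hgc : Continuous g) (hB : 0 ≤ B)
    (hg : ∀ z, |g z| ≤ B * (1 + ‖z‖) ^ l) (i : Fin 3) (x : R3) :
    HasPartial (heatSG₁ ν i g t) i x :=
  (heatSG₁_line_hasDerivAt hν ht hgc hB hg i x).hasPartial

theorem partialD_heatSG₁ (hν : 0 < ν) (ht : 0 < t) (hgc : Continuous g) (hB : 0 ≤ B)
    (hg : ∀ z, |g z| ≤ B * (1 + ‖z‖) ^ l) (i : Fin 3) :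
    partialD (heatSG₁ ν i g t) i = heatSG₂ ν i g t :=
  funext fun x => (heatSG₁_line_hasDerivAt hν ht hgc hB hg i x).partialD_eq

/-- On bounded sets and away from the initial time, the heat semigroup is Lipschitz in time. -/
theorem heatSG_lipschitzOn {a b : ℝ} (hν : 0 < ν) (ha : 0 < a) (hgc : Continuous g) (hB : 0 ≤ B)
    (hg : ∀ z, |g z| ≤ B * (1 + ‖z‖) ^ l) (R : ℝ) :
    ∃ K : ℝ≥0, ∀ x : R3, ‖x‖ ≤ R → LipschitzOnWith K (fun τ => heatSG ν g τ x) (Icc a b) := by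
  obtain ⟨A, hA, hAb⟩ := exists_heatSG_bound hν ha b l
  refine ⟨Real.toNNReal (ν * (3 * (A * B * (1 + R) ^ l))), fun x hx => ?_⟩
  have hR := (norm_nonneg x).trans hx
  refine (convex_Icc a b).lipschitzOnWith_of_nnnorm_hasDerivWithin_le
    (f' := fun τ => ν * ∑ i, heatSG₂ ν i g τ x)
    (fun τ hτ => (heatSG_time_hasDerivAt hν (ha.trans_le hτ.1) hgc hg x).hasDerivWithinAt)
    (fun τ hτ => ?_)
  rw [← NNReal.coe_le_coe, coe_nnnorm, Real.coe_toNNReal _ (by positivity), Real.norm_eq_abs, abs_mul,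
    abs_of_pos hν]
  refine mul_le_mul_of_nonneg_left ((Finset.abs_sum_le_sum_abs _ _).trans ?_) hν.le
  refine (Finset.sum_le_sum fun i _ => ((hAb g B hB hg τ hτ x i).2).trans
    (show _ ≤ A * B * (1 + R) ^ l by gcongr)).trans ?_
  simp

end

/-! ### Scalar linear equations with bounded measurable coefficient -/

theorem lipschitzOn_integral {d : ℝ → ℝ} {D t : ℝ} (hD : 0 ≤ D) (hi : IntervalIntegrable d volume 0 t)
    (hd : ∀ r ∈ Icc 0 t, |d r| ≤ D) :
    LipschitzOnWith (Real.toNNReal D) (fun s => ∫ r in (0 : ℝ)..s, d r) (Icc 0 t) := by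
  refine LipschitzOnWith.of_dist_le_mul fun a ha b hb => ?_
  have hsub : ∀ c ∈ Icc 0 t, IntervalIntegrable d volume 0 c := fun c hc =>
    hi.mono_set (by rw [uIcc_of_le hc.1, uIcc_of_le (hc.1.trans hc.2)]; exact Icc_subset_Icc_right hc.2)
  rw [dist_eq_norm, intervalIntegral.integral_interval_sub_left (hsub a ha) (hsub b hb),
    Real.coe_toNNReal _ hD, Real.dist_eq]
  refine intervalIntegral.norm_integral_le_of_norm_le_const fun r hr => hd r ?_
  rw [uIoc] at hr
  exact ⟨(le_min hb.1 ha.1).trans hr.1.le, hr.2.trans (max_le hb.2 ha.2)⟩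

theorem ae_hasDerivAt_integral {d : ℝ → ℝ} {t : ℝ} (ht : 0 ≤ t)
    (hi : IntervalIntegrable d volume 0 t) :
    ∀ᵐ s, s ∈ Icc 0 t → HasDerivAt (fun s => ∫ r in (0 : ℝ)..s, d r) (d s) s := by
  filter_upwards [hi.ae_hasDerivAt_integral] with s hs hst
  rw [uIcc_of_le ht] at hs
  exact hs hst 0 ⟨le_rfl, ht⟩

/-- The integral is Lipschitz and stays in `[-Dt, Dt]`, an interval on which `x ↦ exp(cx)` is
Lipschitz. -/
theorem lipschitzOn_exp_integral {d : ℝ → ℝ} {D t : ℝ} (hD : 0 ≤ D)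
    (hi : IntervalIntegrable d volume 0 t) (hd : ∀ r ∈ Icc 0 t, |d r| ≤ D) (c : ℝ) :
    ∃ K : ℝ≥0, LipschitzOnWith K (fun s => Real.exp (c * ∫ r in (0 : ℝ)..s, d r)) (Icc 0 t) := by
  have h1 := lipschitzOn_integral hD hi hd
  have h2 : LipschitzOnWith (Real.toNNReal (Real.exp (|c| * (D * t)) * |c|)) (fun x : ℝ => Real.exp (c * x))
      (Icc (-(D * t)) (D * t)) := by
    refine (convex_Icc _ _).lipschitzOnWith_of_nnnorm_hasDerivWithin_le
      (f' := fun x => Real.exp (c * x) * c)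
      (fun x _ => ?_) (fun x hx => ?_)
    · simpa using ((hasDerivAt_id x).const_mul c).exp.hasDerivWithinAt
    · rw [← NNReal.coe_le_coe, coe_nnnorm, Real.coe_toNNReal _ (by positivity), Real.norm_eq_abs,
        abs_mul, abs_of_pos (Real.exp_pos _)]
      refine mul_le_mul_of_nonneg_right (Real.exp_le_exp.2 ?_) (abs_nonneg c)
      calc c * x ≤ |c| * |x| := (le_abs_self _).trans (abs_mul c x).le
        _ ≤ _ := mul_le_mul_of_nonneg_left (abs_le.2 hx) (abs_nonneg c)
  refine ⟨_, h2.comp h1 fun s hs => ?_⟩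
  have ht := hs.1.trans hs.2
  refine abs_le.1 ?_
  have h3 := h1.dist_le_mul s hs 0 ⟨le_rfl, ht⟩
  simp only [intervalIntegral.integral_same, Real.dist_eq, sub_zero, Real.coe_toNNReal _ hD,
    abs_of_nonneg hs.1] at h3
  exact h3.trans (mul_le_mul_of_nonneg_left hs.2 hD)

theorem exp_integral_solves {d : ℝ → ℝ} {D t : ℝ} (hD : 0 ≤ D)
    (hi : IntervalIntegrable d volume 0 t) (hd : ∀ r ∈ Icc 0 t, |d r| ≤ D) {s : ℝ}
    (hs : s ∈ Icc 0 t) :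
    Real.exp (∫ r in (0 : ℝ)..s, d r) =
      1 + ∫ r in (0 : ℝ)..s, Real.exp (∫ r in (0 : ℝ)..r, d r) * d r := by
  obtain ⟨K, hK⟩ := lipschitzOn_exp_integral hD hi hd 1
  simp only [one_mul] at hK
  have hac : AbsolutelyContinuousOnInterval (fun s => Real.exp (∫ r in (0 : ℝ)..s, d r)) 0 s := by
    apply LipschitzOnWith.absolutelyContinuousOnInterval (K := K)
    rw [uIcc_of_le hs.1]
    exact hK.mono (Icc_subset_Icc_right hs.2)
  have h1 := hac.integral_deriv_eq_sub
  rw [intervalIntegral.integral_same, Real.exp_zero] at h1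
  rw [eq_comm, ← eq_sub_iff_add_eq', ← h1]
  refine intervalIntegral.integral_congr_ae ?_
  filter_upwards [ae_hasDerivAt_integral (hs.1.trans hs.2) hi] with r hr hrs
  rw [uIoc_of_le hs.1] at hrs
  exact (hr ⟨hrs.1.le, hrs.2.trans hs.2⟩).exp.deriv.symm

/-- The product of `q` and `exp(-∫ d)` is absolutely continuous with zero derivative almost
everywhere, hence constant. This argument needs no continuity of the coefficient `d`. -/
theorem eq_exp_integral_of_solves {d q : ℝ → ℝ} {D t : ℝ} (hD : 0 ≤ D)
    (hi : IntervalIntegrable d volume 0 t) (hd : ∀ r ∈ Icc 0 t, |d r| ≤ D)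
    (hqc : ContinuousOn q (Icc 0 t)) (hqi : IntervalIntegrable (fun r => q r * d r) volume 0 t)
    (hq : ∀ s ∈ Icc 0 t, q s = 1 + ∫ r in (0 : ℝ)..s, q r * d r) {s : ℝ} (hs : s ∈ Icc 0 t) :
    q s = Real.exp (∫ r in (0 : ℝ)..s, d r) := by
  have ht := hs.1.trans hs.2
  obtain ⟨B, hB⟩ := isCompact_Icc.exists_bound_of_continuousOn hqc
  have hB0 : 0 ≤ B := (norm_nonneg _).trans (hB 0 ⟨le_rfl, ht⟩)
  have hqd : ∀ r ∈ Icc 0 t, |q r * d r| ≤ B * D := fun r hr => by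
    rw [abs_mul]
    exact mul_le_mul (hB r hr) (hd r hr) (abs_nonneg _) hB0
  obtain ⟨K, hK⟩ := lipschitzOn_exp_integral hD hi hd (-1)
  have hlq := lipschitzOn_integral (mul_nonneg hB0 hD) hqi hqd
  rw [← uIcc_of_le ht] at hK hlq
  have hac := (hlq.absolutelyContinuousOnInterval.add
    (f := fun s => ∫ r in (0 : ℝ)..s, q r * d r) (g := fun _ => (1 : ℝ))
    (LipschitzWith.const (1 : ℝ)).lipschitzOnWith.absolutelyContinuousOnInterval).mul
      hK.absolutelyContinuousOnInterval
  obtain ⟨c, hc⟩ := hac.const_of_ae_hasDerivAt_zero (by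
    filter_upwards [ae_hasDerivAt_integral ht hi, ae_hasDerivAt_integral ht hqi] with r h1 h2 hr
    rw [uIcc_of_le ht] at hr
    -- The integral equation replaces `1 + ∫ q d` by `q`, and the two terms of the product rule
    -- cancel.
    refine ((h2 hr).add_const 1 |>.mul ((h1 hr).const_mul (-1)).exp).congr_deriv ?_
    have := hq r hr
    linear_combination (Real.exp (-1 * ∫ r in (0 : ℝ)..r, d r) * d r) * this)
  rw [uIcc_of_le ht] at hc
  have h0 := hc 0 ⟨le_rfl, ht⟩
  have h1 := hc s hs
  simp only [Pi.mul_apply, Pi.add_apply, intervalIntegral.integral_same, zero_add, mul_zero,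
    Real.exp_zero, mul_one] at h0 h1
  rw [← h0, add_comm, ← hq s hs, neg_one_mul, Real.exp_neg] at h1
  field_simp at h1
  exact h1

/-! ### Vector fields -/

/-- The standing assumptions on the vector field. -/
structure IsLipschitzField (T : ℝ) (K : ℝ≥0) (C : R3 → ℝ → R3) : Prop where
  lipschitz : ∀ t ∈ Icc 0 T, LipschitzWith K (fun u => C u t)
  continuousOn : ∀ u, ContinuousOn (fun t => C u t) (Icc 0 T)
  hasPartial : ∀ t ∈ Icc 0 T, ∀ u, ∀ i, HasPartial (fun v => C v t i) i u

namespace IsLipschitzField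

variable {T : ℝ} {K : ℝ≥0} {C : R3 → ℝ → R3}

theorem continuousOn_uncurry (h : IsLipschitzField T K C) :
    ContinuousOn (fun w : R3 × ℝ => C w.1 w.2) (univ ×ˢ Icc 0 T) :=
  continuousOn_prod_of_continuousOn_lipschitzOnWith _ K (fun u _ => h.continuousOn u)
    fun t ht => (h.lipschitz t ht).lipschitzOnWith

theorem exists_growth (h : IsLipschitzField T K C) :
    ∃ C₀ : ℝ, 0 ≤ C₀ ∧ ∀ s ∈ Icc 0 T, ∀ v, ‖C v s‖ ≤ K * ‖v‖ + C₀ := by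
  obtain ⟨C₀, hC₀⟩ := isCompact_Icc.exists_bound_of_continuousOn (h.continuousOn 0)
  refine ⟨|C₀|, abs_nonneg _, fun s hs v => ?_⟩
  have h1 := (h.lipschitz s hs).dist_le_mul v 0
  rw [dist_eq_norm, dist_zero_right] at h1
  have h2 := norm_add_le (C v s - C 0 s) (C 0 s)
  rw [sub_add_cancel] at h2
  linarith [hC₀ s hs, le_abs_self C₀]

theorem lipschitz_coord (h : IsLipschitzField T K C) {t : ℝ} (ht : t ∈ Icc 0 T) (i : Fin 3) :
    LipschitzWith K (fun u => C u t i) :=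
  LipschitzWith.of_dist_le_mul fun u v => by
    refine le_trans ?_ ((h.lipschitz t ht).dist_le_mul u v)
    rw [dist_eq_norm, dist_eq_norm]
    exact PiLp.norm_apply_le (C u t - C v t) i

theorem abs_divergence_le (h : IsLipschitzField T K C) {t : ℝ} (ht : t ∈ Icc 0 T) (u : R3) :
    |divergence (fun v => C v t) u| ≤ 3 * K := by
  refine (Finset.abs_sum_le_sum_abs _ _).trans
    ((Finset.sum_le_sum fun i _ => (?_ : _ ≤ (K : ℝ))).trans (by simp))
  have := norm_lineDeriv_le_of_lipschitz ℝ (x₀ := u) (v := stdVec i) (h.lipschitz_coord ht i)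
  rwa [norm_stdVec, mul_one] at this

theorem continuousOn_comp (h : IsLipschitzField T K C) {t : ℝ} (htT : t ≤ T) {Y : ℝ → R3}
    (hY : ContinuousOn Y (Icc 0 t)) : ContinuousOn (fun r => C (Y r) (t - r)) (Icc 0 t) :=
  h.continuousOn_uncurry.comp (f := fun r => (Y r, t - r)) (hY.prodMk (by fun_prop))
    fun r hr => ⟨mem_univ _, by linarith [hr.2], by linarith [hr.1]⟩

/-- The partial derivatives need not be continuous, but along the curve they are limits of the
continuous difference quotients with step `1 / (n + 1)`. Measurability follows, and the Lipschitz
constant supplies the bound. -/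
theorem intervalIntegrable_divergence (h : IsLipschitzField T K C) {t : ℝ} (ht0 : 0 ≤ t)
    (htT : t ≤ T) {Y : ℝ → R3} (hY : ContinuousOn Y (Icc 0 t)) :
    IntervalIntegrable (fun r => divergence (fun v => C v (t - r)) (Y r)) volume 0 t := by
  have hmem : ∀ r ∈ Icc 0 t, t - r ∈ Icc 0 T := fun r hr =>
    ⟨by linarith [hr.2], by linarith [hr.1]⟩
  have hmeas : AEStronglyMeasurable (fun r => divergence (fun v => C v (t - r)) (Y r))
      (volume.restrict (Icc 0 t)) := by
    refine Finset.aestronglyMeasurable_fun_sum _ fun k _ => ?_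
    set ε : ℕ → ℝ := fun n => 1 / ((n : ℝ) + 1)
    have hε : Filter.Tendsto ε Filter.atTop (nhdsWithin 0 {0}ᶜ) := by
      refine tendsto_nhdsWithin_iff.2 ⟨tendsto_one_div_add_atTop_nhds_zero_nat,
        Filter.Eventually.of_forall fun n => ?_⟩
      have : ε n ≠ 0 := by simp only [ε]; positivity
      exact this
    refine aestronglyMeasurable_of_tendsto_ae Filter.atTop
      (f := fun n r => (ε n)⁻¹ • (C (Y r + ε n • stdVec k) (t - r) k - C (Y r) (t - r) k))
      (fun n => ?_) ?_
    · refine ContinuousOn.aestronglyMeasurable ?_ measurableSet_Icc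
      have h1 := h.continuousOn_comp htT (hY.add (continuousOn_const (c := ε n • stdVec k)))
      have h2 := h.continuousOn_comp htT hY
      have h3 : Continuous fun v : R3 => v k := by fun_prop
      exact (((h3.comp_continuousOn h1).sub (h3.comp_continuousOn h2)).const_smul (ε n)⁻¹ :)
    · refine (ae_restrict_iff' measurableSet_Icc).2 (Filter.Eventually.of_forall fun r hr => ?_)
      have h1 := (h.hasPartial _ (hmem r hr) (Y r) k).hasDerivAt.tendsto_slope_zero
      simpa [Function.comp_def] using h1.comp hε
  rw [intervalIntegrable_iff_integrableOn_Icc_of_le ht0]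
  refine Integrable.of_bound (C := 3 * K) hmeas ?_
  exact (ae_restrict_iff' measurableSet_Icc).2 (Filter.Eventually.of_forall fun r hr =>
    h.abs_divergence_le (hmem r hr) (Y r))

end IsLipschitzField

/-! ### Linear growth -/

/-- Grönwall's inequality. Using `K + 1` as the rate avoids the separate case `K = 0` and gives `ε /
(K + 1) ≤ ε`. -/
theorem norm_le_of_norm_deriv_le {f f' : ℝ → R3} {K ε t T : ℝ} (hK : 0 ≤ K) (hε : 0 ≤ ε)
    (htT : t ≤ T) (hf : ∀ s ∈ Icc 0 t, HasDerivWithinAt f (f' s) (Icc 0 t) s)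
    (hb : ∀ s ∈ Icc 0 t, ‖f' s‖ ≤ K * ‖f s‖ + ε) :
    ∀ s ∈ Icc 0 t, ‖f s‖ ≤ (‖f 0‖ + ε) * Real.exp ((K + 1) * T) := by
  intro s hs
  have h1 := norm_le_gronwallBound_of_norm_deriv_right_le (f := f) (f' := f') (K := K + 1) (ε := ε)
    (a := 0) (b := t) (fun s hs => (hf s hs).continuousWithinAt)
    (fun s hs => (hf s ⟨hs.1, hs.2.le⟩).mono_of_mem_nhdsWithin
      (mem_nhdsWithin_iff_exists_mem_nhds_inter.2 ⟨Iio t, Iio_mem_nhds hs.2,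
        fun r hr => ⟨hs.1.trans hr.2, (show r < t from hr.1).le⟩⟩)) le_rfl
    (fun s hs => (hb s ⟨hs.1, hs.2.le⟩).trans (by linarith [norm_nonneg (f s)])) s hs
  rw [gronwallBound_of_K_ne_0 (by positivity), sub_zero] at h1
  have h2 : Real.exp ((K + 1) * s) ≤ Real.exp ((K + 1) * T) :=
    Real.exp_le_exp.2 (mul_le_mul_of_nonneg_left (hs.2.trans htT) (by positivity))
  have h3 : ε / (K + 1) ≤ ε := div_le_self hε (by linarith)
  have h4 : (1 : ℝ) ≤ Real.exp ((K + 1) * s) := Real.one_le_exp (mul_nonneg (by positivity) hs.1)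
  calc _ ≤ _ := h1
    _ ≤ ‖f 0‖ * Real.exp ((K + 1) * s) + ε * (Real.exp ((K + 1) * s)) := by
        refine add_le_add_right ?_ _
        exact mul_le_mul h3 (by linarith) (by linarith) hε
    _ ≤ ‖f 0‖ * Real.exp ((K + 1) * T) + ε * (Real.exp ((K + 1) * T)) := by gcongr
    _ = _ := by ring

/-! ### Characteristics -/

/-- Coordinatewise truncation of a vector. -/
noncomputable def clampVec (R : ℝ) (v : R3) : R3 := WithLp.toLp 2 fun i => max (-R) (min (v i) R)

theorem abs_max_min_sub_le (R a b : ℝ) : |max (-R) (min a R) - max (-R) (min b R)| ≤ |a - b| :=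
  calc |max (-R) (min a R) - max (-R) (min b R)| ≤ |min a R - min b R| := by
        rw [max_comm (-R), max_comm (-R)]
        exact abs_max_sub_max_le_abs (min a R) (min b R) (-R)
    _ ≤ |a - b| := by simpa using abs_min_sub_min_le_max a R b R

theorem clampVec_lipschitz (R : ℝ) : LipschitzWith 1 (clampVec R) :=
  LipschitzWith.of_dist_le_mul fun v w => by
    rw [EuclideanSpace.dist_eq, EuclideanSpace.dist_eq, NNReal.coe_one, one_mul]
    refine Real.sqrt_le_sqrt (Finset.sum_le_sum fun i _ => ?_)
    rw [Real.dist_eq, Real.dist_eq]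
    exact pow_le_pow_left₀ (abs_nonneg _) (abs_max_min_sub_le R (v i) (w i)) 2

theorem clampVec_of_norm_le {R : ℝ} {v : R3} (hv : ‖v‖ ≤ R) : clampVec R v = v := by
  ext i
  have h1 : |v i| ≤ R := (PiLp.norm_apply_le v i).trans hv
  rw [abs_le] at h1
  simp only [clampVec]
  rw [min_eq_left h1.2, max_eq_right h1.1]

theorem norm_clampVec_le {R : ℝ} (hR : 0 ≤ R) (v : R3) : ‖clampVec R v‖ ≤ ‖v‖ := by
  have h0 : clampVec R 0 = 0 := clampVec_of_norm_le (by simpa using hR)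
  have := (clampVec_lipschitz R).dist_le_mul v 0
  simpa [h0] using this

theorem norm_clampVec_le_radius {R : ℝ} (hR : 0 ≤ R) (v : R3) : ‖clampVec R v‖ ≤ 2 * R := by
  have h1 : ∀ i, |clampVec R v i| ≤ R := fun i => by
    simp only [clampVec]
    exact abs_le.2 ⟨le_max_left _ _, max_le (by linarith) (min_le_right _ _)⟩
  have h2 : ‖clampVec R v‖ ^ 2 ≤ (2 * R) ^ 2 := by
    rw [EuclideanSpace.norm_sq_eq]
    refine (Finset.sum_le_sum fun i _ => (?_ : _ ≤ R ^ 2)).trans (by simp; nlinarith)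
    exact pow_le_pow_left₀ (norm_nonneg _) (h1 i) 2
  exact (sq_le_sq₀ (norm_nonneg _) (by positivity)).1 h2

namespace IsLipschitzField

variable {T : ℝ} {K : ℝ≥0} {C : R3 → ℝ → R3}

/-- Picard–Lindelöf on the whole interval requires a bounded field. Composition with the truncation
makes the field bounded and keeps its Lipschitz constant; the radius `R` is the a priori Grönwall
bound, so the solution never sees the truncation. -/
theorem exists_solution (h : IsLipschitzField T K C) {t : ℝ} (ht0 : 0 ≤ t) (htT : t ≤ T) (u : R3) :
    ∃ Y : ℝ → R3, Y 0 = u ∧ ∀ s ∈ Icc 0 t, HasDerivWithinAt Y (C (Y s) (t - s)) (Icc 0 t) s := by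
  obtain ⟨C₀, hC₀, hgr⟩ := h.exists_growth
  have hmem : ∀ r ∈ Icc 0 t, t - r ∈ Icc 0 T := fun r hr =>
    ⟨by linarith [hr.2], by linarith [hr.1]⟩
  set R : ℝ := (‖u‖ + C₀) * Real.exp ((K + 1) * T) with hR
  have hR0 : 0 ≤ R := by positivity
  set L : ℝ := K * (2 * R) + C₀
  have hL0 : 0 ≤ L := by positivity
  have hP : IsPicardLindelof (fun s v => C (clampVec R v) (t - s)) (⟨0, le_rfl, ht0⟩ : Icc 0 t) u
      (Real.toNNReal (L * t)) 0 (Real.toNNReal L) K := by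
    refine ⟨fun s hs => ?_, fun v _ => ?_, fun s hs v _ => ?_, ?_⟩
    · have := (h.lipschitz _ (hmem s hs)).comp (clampVec_lipschitz R)
      rw [mul_one] at this
      exact this.lipschitzOnWith
    · exact h.continuousOn_comp htT continuousOn_const
    · rw [Real.coe_toNNReal _ hL0]
      refine (hgr _ (hmem s hs) _).trans ?_
      have := mul_le_mul_of_nonneg_left (norm_clampVec_le_radius hR0 v) K.2
      simp only [L]
      exact add_le_add_left this C₀
    · rw [Real.coe_toNNReal _ hL0, Real.coe_toNNReal _ (by positivity)]
      simp [ht0]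
  obtain ⟨Y, hY0, hY⟩ := hP.exists_eq_forall_mem_Icc_hasDerivWithinAt₀
  refine ⟨Y, hY0, fun s hs => ?_⟩
  -- Truncation does not increase the norm, so the truncated field obeys the same linear growth
  -- bound.
  have hb := norm_le_of_norm_deriv_le K.2 hC₀ htT hY (fun r hr =>
    (hgr _ (hmem r hr) _).trans (by
      have := mul_le_mul_of_nonneg_left (norm_clampVec_le hR0 (Y r)) K.2
      exact add_le_add_left this C₀)) s hs
  have h1 := hY s hs
  rw [show Y 0 = u from hY0] at hb
  rwa [clampVec_of_norm_le (R := R) hb] at h1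

end IsLipschitzField

namespace IsCharacteristic

variable {T t : ℝ} {K : ℝ≥0} {C : R3 → ℝ → R3} {u : R3} {Y : ℝ → R3} {q : ℝ → ℝ}

theorem Y_zero (hY : IsCharacteristic C t u Y q) (ht0 : 0 ≤ t) : Y 0 = u := by
  simpa using hY.eq_Y 0 ⟨le_rfl, ht0⟩

theorem hasDerivWithinAt_Y (h : IsLipschitzField T K C) (ht0 : 0 ≤ t) (htT : t ≤ T)
    (hY : IsCharacteristic C t u Y q) {s : ℝ} (hs : s ∈ Icc 0 t) :
    HasDerivWithinAt Y (C (Y s) (t - s)) (Icc 0 t) s := by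
  have hc := h.continuousOn_comp htT hY.continuousOn_Y
  -- Extending the integrand continuously beyond `[0, t]` allows the fundamental theorem of calculus
  -- to be used at the endpoints too.
  set H : ℝ → R3 := IccExtend ht0 ((Icc 0 t).domRestrict fun r => C (Y r) (t - r))
  have hH : Continuous H := (continuousOn_iff_continuous_domRestrict.1 hc).Icc_extend'
  have hHe : ∀ r ∈ Icc 0 t, H r = C (Y r) (t - r) := fun r hr => IccExtend_of_mem ht0 _ hr
  have h1 : HasDerivWithinAt (fun s => u + ∫ r in (0 : ℝ)..s, H r) (H s) (Icc 0 t) s :=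
    ((intervalIntegral.integral_hasDerivAt_right (hH.intervalIntegrable _ _)
      (hH.stronglyMeasurableAtFilter _ _) hH.continuousAt).const_add u).hasDerivWithinAt
  rw [hHe s hs] at h1
  refine h1.congr_of_mem (fun r hr => ?_) hs
  rw [hY.eq_Y r hr]
  congr 1
  refine intervalIntegral.integral_congr fun x hx => (hHe x ?_).symm
  rw [uIcc_of_le hr.1] at hx
  exact ⟨hx.1, hx.2.trans hr.2⟩

theorem q_eq (h : IsLipschitzField T K C) (htT : t ≤ T)
    (hY : IsCharacteristic C t u Y q) {s : ℝ} (hs : s ∈ Icc 0 t) :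
    q s = Real.exp (∫ r in (0 : ℝ)..s, divergence (fun v => C v (t - r)) (Y r)) :=
  eq_exp_integral_of_solves (D := 3 * K) (by positivity)
    (h.intervalIntegrable_divergence (hs.1.trans hs.2) htT hY.continuousOn_Y)
    (fun r hr => h.abs_divergence_le ⟨by linarith [hr.2], by linarith [hr.1]⟩ (Y r))
    hY.continuousOn_q hY.integrable_q hY.eq_q hs

theorem unique (h : IsLipschitzField T K C) (ht0 : 0 ≤ t) (htT : t ≤ T)
    (hY : IsCharacteristic C t u Y q) {Y' : ℝ → R3} {q' : ℝ → ℝ} (hY' : IsCharacteristic C t u Y' q') :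
    EqOn Y' Y (Icc 0 t) ∧ EqOn q' q (Icc 0 t) := by
  have h1 : EqOn Y' Y (Icc 0 t) := by
    intro s hs
    have hd : ∀ r ∈ Icc 0 t, HasDerivWithinAt (Y' - Y) (C (Y' r) (t - r) - C (Y r) (t - r)) (Icc 0 t) r :=
      fun r hr => (hY'.hasDerivWithinAt_Y h ht0 htT hr).sub (hY.hasDerivWithinAt_Y h ht0 htT hr)
    have h2 := norm_le_of_norm_deriv_le K.2 le_rfl htT hd (fun r hr => by
      rw [add_zero, ← dist_eq_norm, Pi.sub_apply, ← dist_eq_norm]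
      exact (h.lipschitz _ ⟨by linarith [hr.2], by linarith [hr.1]⟩).dist_le_mul _ _) s hs
    rw [Pi.sub_apply, Pi.sub_apply, hY.Y_zero ht0, hY'.Y_zero ht0, sub_self, norm_zero, add_zero,
      zero_mul] at h2
    exact sub_eq_zero.1 (norm_le_zero_iff.1 h2)
  refine ⟨h1, fun s hs => ?_⟩
  rw [hY.q_eq h htT hs, hY'.q_eq h htT hs]
  congr 1
  refine intervalIntegral.integral_congr fun r hr => ?_
  rw [uIcc_of_le hs.1] at hr
  rw [h1 ⟨hr.1, hr.2.trans hs.2⟩]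

end IsCharacteristic

theorem IsLipschitzField.exists_characteristic {T t : ℝ} {K : ℝ≥0} {C : R3 → ℝ → R3}
    (h : IsLipschitzField T K C) (ht0 : 0 ≤ t) (htT : t ≤ T) (u : R3) :
    ∃ (Y : ℝ → R3) (q : ℝ → ℝ), IsCharacteristic C t u Y q := by
  obtain ⟨Y, hY0, hY⟩ := h.exists_solution ht0 htT u
  have hYc : ContinuousOn Y (Icc 0 t) := fun s hs => (hY s hs).continuousWithinAt
  have hcc := h.continuousOn_comp htT hYc
  have hi := h.intervalIntegrable_divergence ht0 htT hYc
  have hd : ∀ r ∈ Icc 0 t, |divergence (fun v => C v (t - r)) (Y r)| ≤ 3 * K := fun r hr =>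
    h.abs_divergence_le ⟨by linarith [hr.2], by linarith [hr.1]⟩ (Y r)
  have hD : (0 : ℝ) ≤ 3 * K := by positivity
  obtain ⟨K', hK'⟩ := lipschitzOn_exp_integral hD hi hd 1
  simp only [one_mul] at hK'
  refine ⟨Y, fun s => Real.exp (∫ r in (0 : ℝ)..s, divergence (fun v => C v (t - r)) (Y r)),
    hYc, ?_, fun s hs => ?_, hK'.continuousOn, ?_, fun s hs => exp_integral_solves hD hi hd hs⟩
  · exact ContinuousOn.intervalIntegrable (by rwa [uIcc_of_le ht0])
  · have hsub : Icc 0 s ⊆ Icc 0 t := Icc_subset_Icc_right hs.2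
    have := intervalIntegral.integral_eq_sub_of_hasDeriv_right_of_le hs.1 (hYc.mono hsub)
      (f' := fun r => C (Y r) (t - r)) (fun r hr => ?_) ?_
    · rw [this, hY0]; abel
    · exact ((hY r (hsub (Ioo_subset_Icc_self hr))).hasDerivAt
        (Icc_mem_nhds hr.1 (hr.2.trans_le hs.2))).hasDerivWithinAt
    · exact ContinuousOn.intervalIntegrable (by rw [uIcc_of_le hs.1]; exact hcc.mono hsub)
  · exact hi.continuousOn_mul (by rw [uIcc_of_le ht0]; exact hK'.continuousOn)

/-- Grönwall forwards in time gives the first bound; applied to `s ↦ Y (t - s)`, which solves the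
equation for `-C` from `Y t` to `u`, it gives the second. The second bound later turns decay in `Y
t` into decay in `u`. -/
theorem IsCharacteristic.exists_growth {T : ℝ} {K : ℝ≥0} {C : R3 → ℝ → R3}
    (h : IsLipschitzField T K C) :
    ∃ E : ℝ, 1 ≤ E ∧ ∀ t ∈ Icc 0 T, ∀ u Y q, IsCharacteristic C t u Y q →
      (∀ s ∈ Icc 0 t, 1 + ‖Y s‖ ≤ E * (1 + ‖u‖)) ∧ 1 + ‖u‖ ≤ E * (1 + ‖Y t‖) := by
  obtain ⟨C₀, hC₀, hgr⟩ := h.exists_growth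
  set G := Real.exp ((K + 1) * T)
  have hG : 0 < G := Real.exp_pos _
  refine ⟨1 + G * (1 + C₀), by nlinarith, fun t ht u Y q hY => ?_⟩
  have hmem : ∀ r ∈ Icc 0 t, t - r ∈ Icc 0 t := fun r hr =>
    ⟨by linarith [hr.2], by linarith [hr.1]⟩
  have hmemT : ∀ r ∈ Icc 0 t, r ∈ Icc 0 T := fun r hr => ⟨hr.1, hr.2.trans ht.2⟩
  have hd := fun s hs => hY.hasDerivWithinAt_Y h ht.1 ht.2 (s := s) hs
  have key : ∀ a b : ℝ, 0 ≤ b → a ≤ (b + C₀) * G → 1 + a ≤ (1 + G * (1 + C₀)) * (1 + b) := by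
    intro a b hb hab
    nlinarith [mul_nonneg hG.le hC₀, mul_nonneg (mul_nonneg hG.le hC₀) hb, mul_nonneg hG.le hb]
  constructor
  · intro s hs
    refine key _ _ (norm_nonneg _) ?_
    have := norm_le_of_norm_deriv_le K.2 hC₀ ht.2 hd
      (fun r hr => hgr _ (hmemT _ (hmem r hr)) _) s hs
    rwa [hY.Y_zero ht.1] at this
  · refine key _ _ (norm_nonneg _) ?_
    have hd' : ∀ s ∈ Icc 0 t, HasDerivWithinAt (fun s => Y (t - s)) (-C (Y (t - s)) s) (Icc 0 t) s := by
      intro s hs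
      have h1 := (hd (t - s) (hmem s hs)).scomp s
        ((hasDerivWithinAt_id s (Icc 0 t)).const_sub t) hmem
      simpa [Function.comp_def] using h1
    have := norm_le_of_norm_deriv_le K.2 hC₀ ht.2 hd'
      (fun r hr => by rw [norm_neg]; exact hgr _ (hmemT _ hr) _) t ⟨ht.1, le_rfl⟩
    simpa [hY.Y_zero ht.1] using this

/-! ### Classical solutions and their derivatives on the slab -/

/-- The space-time domain `ℝ³ × ℝ³ × [0, T]`. -/
abbrev slab (T : ℝ) : Set (R3 × R3 × ℝ) := univ ×ˢ (univ ×ˢ Icc 0 T)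

/-- The derivative of `p` in all variables, on the slab. -/
noncomputable def slabDeriv (T : ℝ) (p : R3 → R3 → ℝ → ℝ) (w : R3 × R3 × ℝ) : R3 × R3 × ℝ →L[ℝ] ℝ :=
  fderivWithin ℝ (fun w : R3 × R3 × ℝ => p w.1 w.2.1 w.2.2) (slab T) w

theorem mem_slab {T : ℝ} {u x : R3} {t : ℝ} (ht : t ∈ Icc 0 T) : (u, x, t) ∈ slab T :=
  ⟨mem_univ _, mem_univ _, ht⟩

/-- The pure second partial derivatives add up to the Laplacian. -/
noncomputable def laplacianP (f : R3 → ℝ) (x : R3) : ℝ :=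
  ∑ i, partialD (fun y => partialD f i y) i x

theorem partialD_const_mul_comp_add (c : ℝ) (f : R3 → ℝ) (b : R3) (i : Fin 3) (z : R3) :
    partialD (fun y => c * f (y + b)) i z = c * partialD f i (z + b) := by
  simp only [partialD, lineDeriv]
  rw [deriv_const_mul_field]
  simp only [add_right_comm]

theorem HasPartial.const_mul_comp_add {c : ℝ} {f : R3 → ℝ} {b : R3} {i : Fin 3} {z : R3}
    (h : HasPartial f i (z + b)) : HasPartial (fun y => c * f (y + b)) i z := by
  have h1 : DifferentiableAt ℝ (fun s : ℝ => c * f (z + b + s • stdVec i)) 0 :=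
    DifferentiableAt.const_mul h c
  rw [hasPartial_iff]
  simpa only [add_right_comm] using h1

theorem HasPartial.sub {f g : R3 → ℝ} {i : Fin 3} {z : R3} (hf : HasPartial f i z)
    (hg : HasPartial g i z) : HasPartial (fun y => f y - g y) i z :=
  DifferentiableAt.sub hf hg

theorem partialD_sub {f g : R3 → ℝ} {i : Fin 3} {z : R3} (hf : HasPartial f i z)
    (hg : HasPartial g i z) :
    partialD (fun y => f y - g y) i z = partialD f i z - partialD g i z :=
  (hf.hasDerivAt.sub hg.hasDerivAt).deriv

theorem sum_coord_smul_stdVec (v : R3) : ∑ i, v i • stdVec i = v := by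
  ext j
  simp [stdVec, Finset.sum_apply, Pi.single_apply]

namespace IsPDFSolution

variable {ν T : ℝ} {C : R3 → ℝ → R3} {p₀ : R3 → R3 → ℝ} {p : R3 → R3 → ℝ → ℝ}

theorem continuousOn (hp : IsPDFSolution ν T C p₀ p) :
    ContinuousOn (fun w : R3 × R3 × ℝ => p w.1 w.2.1 w.2.2) (slab T) :=
  hp.contDiffOn.continuousOn

theorem hasFDerivWithinAt (hp : IsPDFSolution ν T C p₀ p) {w : R3 × R3 × ℝ} (hw : w ∈ slab T) :
    HasFDerivWithinAt (fun w : R3 × R3 × ℝ => p w.1 w.2.1 w.2.2) (slabDeriv T p w) (slab T) w :=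
  (hp.contDiffOn.differentiableOn one_ne_zero w hw).hasFDerivWithinAt

theorem continuousOn_slabDeriv (hp : IsPDFSolution ν T C p₀ p) (hT : 0 < T) :
    ContinuousOn (slabDeriv T p) (slab T) :=
  hp.contDiffOn.continuousOn_fderivWithin
    (uniqueDiffOn_univ.prod (uniqueDiffOn_univ.prod (uniqueDiffOn_Icc hT))) le_rfl

/-- A line in `x` at fixed `t` stays inside the slab, so the derivative within the slab is a genuine
two-sided one, even at `t = 0` and `t = T`. -/
theorem line_x_hasDerivAt (hp : IsPDFSolution ν T C p₀ p) {t : ℝ} (ht : t ∈ Icc 0 T) (u x : R3)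
    (i : Fin 3) : HasDerivAt (fun s : ℝ => p u (x + s • stdVec i) t)
      (slabDeriv T p (u, x, t) (0, stdVec i, 0)) 0 := by
  have hγ : HasDerivAt (fun s : ℝ => (u, x + s • stdVec i, t)) (0, stdVec i, 0) 0 := by
    refine (hasDerivAt_const _ _).prodMk (HasDerivAt.prodMk ?_ (hasDerivAt_const _ _))
    simpa using ((hasDerivAt_id (0 : ℝ)).smul_const (stdVec i)).const_add x
  refine HasFDerivWithinAt.comp_hasDerivAt_of_eq (𝕜 := ℝ) (t := slab T) (0 : ℝ)
    (hp.hasFDerivWithinAt (mem_slab ht)) hγ (Filter.Eventually.of_forall fun s => mem_slab ht) ?_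
  simp

theorem line_u_hasDerivAt (hp : IsPDFSolution ν T C p₀ p) {t : ℝ} (ht : t ∈ Icc 0 T) (u x : R3)
    (i : Fin 3) : HasDerivAt (fun s : ℝ => p (u + s • stdVec i) x t)
      (slabDeriv T p (u, x, t) (stdVec i, 0, 0)) 0 := by
  have hγ : HasDerivAt (fun s : ℝ => (u + s • stdVec i, x, t)) (stdVec i, 0, 0) 0 := by
    refine HasDerivAt.prodMk ?_ ((hasDerivAt_const _ _).prodMk (hasDerivAt_const _ _))
    simpa using ((hasDerivAt_id (0 : ℝ)).smul_const (stdVec i)).const_add u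
  refine HasFDerivWithinAt.comp_hasDerivAt_of_eq (𝕜 := ℝ) (t := slab T) (0 : ℝ)
    (hp.hasFDerivWithinAt (mem_slab ht)) hγ (Filter.Eventually.of_forall fun s => mem_slab ht) ?_
  simp

theorem time_hasDerivAt (hp : IsPDFSolution ν T C p₀ p) {t : ℝ} (ht : t ∈ Ioo 0 T) (u x : R3) :
    HasDerivAt (fun τ => p u x τ) (slabDeriv T p (u, x, t) (0, 0, 1)) t := by
  have hγ : HasDerivAt (fun s : ℝ => (u, x, s)) ((0 : R3), (0 : R3), (1 : ℝ)) t :=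
    (hasDerivAt_const _ _).prodMk ((hasDerivAt_const _ _).prodMk (hasDerivAt_id t))
  refine HasFDerivWithinAt.comp_hasDerivAt (𝕜 := ℝ) (t := slab T) t
    (hp.hasFDerivWithinAt (mem_slab (Ioo_subset_Icc_self ht))) hγ ?_
  filter_upwards [Ioo_mem_nhds ht.1 ht.2] with s hs using mem_slab (Ioo_subset_Icc_self hs)

theorem hasPartial_x (hp : IsPDFSolution ν T C p₀ p) {t : ℝ} (ht : t ∈ Icc 0 T) (u x : R3)
    (i : Fin 3) : HasPartial (fun y => p u y t) i x :=
  (hp.line_x_hasDerivAt ht u x i).hasPartial (f := fun y => p u y t)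

theorem partialD_x (hp : IsPDFSolution ν T C p₀ p) {t : ℝ} (ht : t ∈ Icc 0 T) (u x : R3)
    (i : Fin 3) : partialD (fun y => p u y t) i x = slabDeriv T p (u, x, t) (0, stdVec i, 0) :=
  (hp.line_x_hasDerivAt ht u x i).partialD_eq (f := fun y => p u y t)

theorem partialD_u (hp : IsPDFSolution ν T C p₀ p) {t : ℝ} (ht : t ∈ Icc 0 T) (u x : R3)
    (i : Fin 3) : partialD (fun v => p v x t) i u = slabDeriv T p (u, x, t) (stdVec i, 0, 0) :=
  (hp.line_u_hasDerivAt ht u x i).partialD_eq (f := fun v => p v x t)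

theorem slabDeriv_apply (w : R3 × R3 × ℝ) (v y : R3) (c : ℝ) :
    slabDeriv T p w (v, y, c) = ∑ i, v i * slabDeriv T p w (stdVec i, 0, 0)
      + ∑ i, y i * slabDeriv T p w (0, stdVec i, 0) + c * slabDeriv T p w (0, 0, 1) := by
  have h1 : ((v, y, c) : R3 × R3 × ℝ) = ∑ i, v i • (stdVec i, (0 : R3), (0 : ℝ))
      + ∑ i, y i • ((0 : R3), stdVec i, (0 : ℝ)) + c • ((0 : R3), (0 : R3), (1 : ℝ)) := by
    refine Prod.ext ?_ (Prod.ext ?_ ?_)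
    · simp [Prod.fst_sum, sum_coord_smul_stdVec]
    · simp [Prod.fst_sum, Prod.snd_sum, sum_coord_smul_stdVec]
    · simp [Prod.snd_sum]
  rw [h1]
  simp only [map_add, map_sum, map_smul, smul_eq_mul]

/-- The equation with the products on the right-hand side expanded. -/
theorem equation_expanded {K : ℝ≥0} (hp : IsPDFSolution ν T C p₀ p) (hC : IsLipschitzField T K C)
    {t : ℝ} (ht : t ∈ Ioo 0 T) (u x : R3) :
    slabDeriv T p (u, x, t) (-C u t, u, 1) =
      ν * laplacianP (fun y => p u y t) x + p u x t * divergence (fun v => C v t) u := by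
  have htI := Ioo_subset_Icc_self ht
  have h := hp.equation u x t ht
  have h1 : ∀ i, partialD (fun v => p v x t * C v t i) i u =
      slabDeriv T p (u, x, t) (stdVec i, 0, 0) * C u t i + p u x t * partialD (fun v => C v t i) i u := by
    intro i
    have := (hp.line_u_hasDerivAt htI u x i).fun_mul (hC.hasPartial t htI u i).hasDerivAt
    rw [zero_smul, add_zero] at this
    exact this.partialD_eq (f := fun v => p v x t * C v t i)
  rw [PDFEquationAt, (hp.time_hasDerivAt ht u x).deriv] at h
  simp only [h1, hp.partialD_x htI, Finset.sum_add_distrib, ← Finset.mul_sum] at h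
  rw [slabDeriv_apply, divergence, laplacianP]
  simp only [hp.partialD_x htI, PiLp.neg_apply, neg_mul, Finset.sum_neg_distrib, one_mul]
  simp only [mul_comm (slabDeriv T p (u, x, t) _)] at h
  linarith

end IsPDFSolution

theorem lipschitzOn_mul_of_bounded {f g : ℝ → ℝ} {s : Set ℝ} {A B : ℝ} {Kf Kg : ℝ≥0} (hA : 0 ≤ A)
    (hB : 0 ≤ B) (hf : LipschitzOnWith Kf f s) (hg : LipschitzOnWith Kg g s)
    (hfA : ∀ x ∈ s, |f x| ≤ A) (hgB : ∀ x ∈ s, |g x| ≤ B) :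
    LipschitzOnWith (Real.toNNReal (A * Kg + B * Kf)) (fun x => f x * g x) s := by
  refine LipschitzOnWith.of_dist_le_mul fun x hx y hy => ?_
  have h1 := hf.dist_le_mul x hx y hy
  have h2 := hg.dist_le_mul x hx y hy
  rw [Real.coe_toNNReal _ (by positivity), Real.dist_eq]
  rw [Real.dist_eq] at h1 h2
  calc |f x * g x - f y * g y| = |f x * (g x - g y) + g y * (f x - f y)| := by congr 1; ring
    _ ≤ |f x| * |g x - g y| + |g y| * |f x - f y| := by
        rw [← abs_mul, ← abs_mul]; exact abs_add_le _ _
    _ ≤ A * (Kg * dist x y) + B * (Kf * dist x y) := by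
        gcongr
        · exact hfA x hx
        · exact hgB y hy
    _ = _ := by ring

/-! ### The representation formula -/

/-- Along the characteristics, a solution is transported by the heat semigroup. -/
theorem IsPDFSolution.eq_heatSG {ν T : ℝ} {K : ℝ≥0} {C : R3 → ℝ → R3} {p₀ : R3 → R3 → ℝ}
    {p : R3 → R3 → ℝ → ℝ} (hν : 0 < ν) (hT : 0 < T) (hC : IsLipschitzField T K C)
    (hp : IsPDFSolution ν T C p₀ p) (hGrowth : HasPolyGrowth T p) {t : ℝ} (ht : t ∈ Ioc 0 T)
    {u : R3} {Y : ℝ → R3} {q : ℝ → ℝ} (hY : IsCharacteristic C t u Y q) (x : R3) :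
    p u x t = q t * heatSG ν (p₀ (Y t)) t (x - ∫ s in (0 : ℝ)..t, Y s) := by
  obtain ⟨L, l, hL⟩ := hGrowth
  have hmem : ∀ r ∈ Icc 0 t, t - r ∈ Icc 0 t := fun r hr =>
    ⟨by linarith [hr.2], by linarith [hr.1]⟩
  have hmemT : ∀ r ∈ Icc 0 t, r ∈ Icc 0 T := fun r hr => ⟨hr.1, hr.2.trans ht.2⟩
  have hsubc : ContinuousOn (fun τ : ℝ => t - τ) (Icc 0 t) := by fun_prop
  set Z : ℝ → R3 := fun τ => Y (t - τ) with hZ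
  set Q : ℝ → ℝ := fun τ => q (t - τ) with hQ
  -- The constant extension of `Z` outside `[0, t]` makes `b` differentiable in the two-sided sense
  -- at the endpoints.
  set b : ℝ → R3 := fun τ => ∫ r in (0 : ℝ)..τ, IccExtend ht.1.le ((Icc 0 t).domRestrict Z) r with hb
  have hZc : ContinuousOn Z (Icc 0 t) := hY.continuousOn_Y.comp hsubc hmem
  have hQc : ContinuousOn Q (Icc 0 t) := hY.continuousOn_q.comp hsubc hmem
  have hZe : Continuous (IccExtend ht.1.le ((Icc 0 t).domRestrict Z)) :=
    (continuousOn_iff_continuous_domRestrict.1 hZc).Icc_extend'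
  have hbd : ∀ τ ∈ Icc 0 t, HasDerivAt b (Z τ) τ := fun τ hτ => by
    have := intervalIntegral.integral_hasDerivAt_right (hZe.intervalIntegrable 0 τ)
      (hZe.stronglyMeasurableAtFilter _ _) hZe.continuousAt
    rwa [IccExtend_of_mem ht.1.le _ hτ] at this
  have hbc : ContinuousOn b (Icc 0 t) := fun τ hτ => (hbd τ hτ).continuousAt.continuousWithinAt
  have hb0 : b 0 = 0 := by simp [hb]
  have hbt : b t = ∫ s in (0 : ℝ)..t, Y s := by
    have h1 := intervalIntegral.integral_comp_sub_left (a := 0) (b := t) Y t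
    rw [sub_self, sub_zero] at h1
    rw [← h1]
    refine intervalIntegral.integral_congr fun r hr => ?_
    rw [uIcc_of_le ht.1.le] at hr
    exact IccExtend_of_mem ht.1.le _ hr
  have hZd : ∀ τ ∈ Icc 0 t, HasDerivWithinAt Z (-C (Z τ) τ) (Icc 0 t) τ := by
    intro τ hτ
    have h1 := (hY.hasDerivWithinAt_Y hC ht.1.le ht.2 (hmem τ hτ)).scomp τ
      ((hasDerivWithinAt_id τ (Icc 0 t)).const_sub t) hmem
    simpa [Function.comp_def] using h1
  -- the solution in the moving frame
  set W : R3 → ℝ → ℝ := fun z τ => p (Z τ) (z + b τ) τ with hW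
  set g : R3 → ℝ := fun z => q t * p₀ (Y t) z with hg
  have hW0 : ∀ z, Q 0 * W z 0 = g z := fun z => by
    simp [hQ, hW, hZ, hg, hb0, hp.initial]
  -- The frame moves in the direction `(-C, Z, 1)`, exactly the direction of differentiation in
  -- `equation_expanded`.
  have hγd : ∀ z, ∀ τ ∈ Icc 0 t, HasDerivWithinAt (W z)
      (slabDeriv T p (Z τ, z + b τ, τ) (-C (Z τ) τ, Z τ, 1)) (Icc 0 t) τ := by
    intro z τ hτ
    have hγ : HasDerivWithinAt (fun τ => (Z τ, z + b τ, τ)) (-C (Z τ) τ, Z τ, (1 : ℝ)) (Icc 0 t) τ :=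
      (hZd τ hτ).prodMk (((hbd τ hτ).hasDerivWithinAt.const_add z).prodMk (hasDerivWithinAt_id τ _))
    exact HasFDerivWithinAt.comp_hasDerivWithinAt (𝕜 := ℝ) (t := slab T) τ
      (hp.hasFDerivWithinAt (mem_slab (hmemT τ hτ))) hγ fun r hr => mem_slab (hmemT r hr)
  obtain ⟨BZ, hBZ⟩ := isCompact_Icc.exists_bound_of_continuousOn hZc
  obtain ⟨Bb, hBb⟩ := isCompact_Icc.exists_bound_of_continuousOn hbc
  obtain ⟨BQ, hBQ⟩ := isCompact_Icc.exists_bound_of_continuousOn hQc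
  have h0mem : (0 : ℝ) ∈ Icc 0 t := ⟨le_rfl, ht.1.le⟩
  have hBZ0 := (norm_nonneg _).trans (hBZ 0 h0mem)
  have hBb0 := (norm_nonneg _).trans (hBb 0 h0mem)
  have hBQ0 := (norm_nonneg _).trans (hBQ 0 h0mem)
  have hWb : ∀ z, ∀ τ ∈ Icc 0 t, |W z τ| ≤ |L| * (1 + BZ + Bb) ^ l * (1 + ‖z‖) ^ l := by
    intro z τ hτ
    refine (hL _ _ τ (hmemT τ hτ)).trans ?_
    rw [mul_assoc, ← mul_pow]
    have h1 : 1 + ‖Z τ‖ + ‖z + b τ‖ ≤ (1 + BZ + Bb) * (1 + ‖z‖) := by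
      nlinarith [norm_add_le z (b τ), hBZ τ hτ, hBb τ hτ, norm_nonneg z,
        mul_nonneg hBZ0 (norm_nonneg z), mul_nonneg hBb0 (norm_nonneg z)]
    calc _ ≤ |L| * (1 + ‖Z τ‖ + ‖z + b τ‖) ^ l := by
          gcongr; exact le_abs_self L
      _ ≤ _ := by gcongr
  set Bg : ℝ := BQ * (|L| * (1 + BZ + Bb) ^ l) with hBg
  have hBg0 : 0 ≤ Bg := by positivity
  have hQW : ∀ z, ∀ τ ∈ Icc 0 t, |Q τ * W z τ| ≤ Bg * (1 + ‖z‖) ^ l := by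
    intro z τ hτ
    rw [abs_mul, hBg, mul_assoc]
    exact mul_le_mul (hBQ τ hτ) (hWb z τ hτ) (abs_nonneg _) hBQ0
  have hgb : ∀ z, |g z| ≤ Bg * (1 + ‖z‖) ^ l := fun z => by
    rw [← hW0]; exact hQW z 0 h0mem
  have hgc : Continuous g := by
    have h1 : Continuous fun z => p (Y t) z 0 :=
      continuousOn_univ.1 (hp.continuousOn.comp (f := fun z : R3 => (Y t, z, (0 : ℝ)))
        (by fun_prop) fun z _ => mem_slab ⟨le_rfl, hT.le⟩)
    simp only [hp.initial] at h1
    exact continuous_const.mul h1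
  -- regularity of `q`
  have hdi := hC.intervalIntegrable_divergence ht.1.le ht.2 hY.continuousOn_Y
  have hdb : ∀ r ∈ Icc 0 t, |divergence (fun v => C v (t - r)) (Y r)| ≤ 3 * K := fun r hr =>
    hC.abs_divergence_le (hmemT _ (hmem r hr)) (Y r)
  obtain ⟨Kq, hKq⟩ := lipschitzOn_exp_integral (by positivity) hdi hdb 1
  simp only [one_mul] at hKq
  have hqL : LipschitzOnWith Kq q (Icc 0 t) := fun r hr s hs => by
    rw [hY.q_eq hC ht.2 hr, hY.q_eq hC ht.2 hs]
    exact hKq hr hs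
  have hQL : LipschitzOnWith Kq Q (Icc 0 t) := LipschitzOnWith.of_dist_le_mul fun r hr s hs => by
    have := hqL.dist_le_mul (t - r) (hmem r hr) (t - s) (hmem s hs)
    rwa [dist_sub_left] at this
  have hqd : ∀ᵐ s, s ∈ Ioo 0 t →
      HasDerivAt q (q s * divergence (fun v => C v (t - s)) (Y s)) s := by
    filter_upwards [ae_hasDerivAt_integral ht.1.le hY.integrable_q] with s hs hst
    refine ((hs (Ioo_subset_Icc_self hst)).const_add 1).congr_of_eventuallyEq ?_
    filter_upwards [Ioo_mem_nhds hst.1 hst.2] with r hr using hY.eq_q r (Ioo_subset_Icc_self hr)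
  have hQd : ∀ᵐ τ, τ ∈ Ioo 0 t →
      HasDerivAt Q (-(Q τ * divergence (fun v => C v τ) (Z τ))) τ := by
    -- The reflection `τ ↦ t - τ` preserves null sets, so almost-everywhere differentiability passes
    -- from `q` to `Q`.
    filter_upwards [(Measure.measurePreserving_sub_left volume t).quasiMeasurePreserving.ae hqd] with τ h hτ
    have h1 := (h ⟨by linarith [hτ.2], by linarith [hτ.1]⟩).scomp τ ((hasDerivAt_id τ).const_sub t)
    simpa [Function.comp_def, hQ, hZ] using h1
  -- uniqueness
  have key := heat_unique (t := t) hν (f := fun z τ => Q τ * W z τ - heatSGScaled ν g τ z)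
    (L := Bg + Classical.choose (exists_heatSGScaled_bound hν t l) * Bg) (l := l) ?_ ?_ ?_ ?_ ?_
    (x - b t) t ⟨ht.1.le, le_rfl⟩
  -- At `τ = t` the frame has velocity `u` and `Q = q 0 = 1`; the choice `z = x - b t` places it at
  -- the position `x`.
  · simp only [hQ, hW, hZ, sub_self, hY.Y_zero ht.1.le, hY.eq_q 0 h0mem,
      intervalIntegral.integral_same, add_zero, one_mul, sub_add_cancel] at key
    rw [sub_eq_zero.1 key, ← heatSG_eq_scaled hν ht.1, hbt, heatSG, heatSG, ← integral_const_mul]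
    exact integral_congr_ae (Filter.Eventually.of_forall fun z => by simp only [hg]; ring)
  · refine ContinuousOn.sub (ContinuousOn.mul ?_ ?_) (continuous_heatSGScaled hν hgc hBg0 hgb).continuousOn
    · exact hQc.comp continuous_snd.continuousOn fun w hw => hw.2
    · refine hp.continuousOn.comp (f := fun w : R3 × ℝ => (Z w.2, w.1 + b w.2, w.2)) ?_
        fun w hw => mem_slab (hmemT _ hw.2)
      have hs : MapsTo (fun w : R3 × ℝ => w.2) (univ ×ˢ Icc 0 t) (Icc 0 t) := fun w hw => hw.2
      exact (hZc.comp continuous_snd.continuousOn hs).prodMk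
        ((continuous_fst.continuousOn.add (hbc.comp continuous_snd.continuousOn hs)).prodMk
          continuous_snd.continuousOn)
  · intro z τ hτ
    refine (abs_sub _ _).trans ?_
    rw [add_mul]
    exact add_le_add (hQW z τ hτ)
      ((Classical.choose_spec (exists_heatSGScaled_bound hν t l)).2 g Bg hBg0 hgb τ hτ.2 z)
  · intro z
    rw [hW0, heatSGScaled_zero hν, sub_self]
  · intro R δ hδ
    obtain ⟨KS, hKS⟩ := heatSG_lipschitzOn hν hδ.1 hgc hBg0 hgb R (b := t)
    have hsub : Icc δ t ⊆ Icc 0 t := Icc_subset_Icc_left hδ.1.le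
    have hcpt : IsCompact (Metric.closedBall (0 : R3) BZ ×ˢ
        (Metric.closedBall (0 : R3) (R + Bb) ×ˢ Icc 0 T)) :=
      (isCompact_closedBall _ _).prod ((isCompact_closedBall _ _).prod isCompact_Icc)
    -- For `‖z‖ ≤ R` the moving frame stays in one compact part of the slab, so one bound on the
    -- derivative of `p` serves all such `z`.
    obtain ⟨BD, hBD⟩ := hcpt.exists_bound_of_continuousOn ((hp.continuousOn_slabDeriv hT).mono
      (prod_mono (subset_univ _) (prod_mono_left (subset_univ _))))
    have hCc : ContinuousOn (fun τ => ‖((-C (Z τ) τ, Z τ, (1 : ℝ)) : R3 × R3 × ℝ)‖) (Icc 0 t) := by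
      have : ContinuousOn (fun τ => C (Z τ) τ) (Icc 0 t) :=
        hC.continuousOn_uncurry.comp (f := fun τ => (Z τ, τ)) (hZc.prodMk continuousOn_id)
          fun τ hτ => ⟨mem_univ _, hmemT τ hτ⟩
      exact (this.neg.prodMk (hZc.prodMk continuousOn_const)).norm
    obtain ⟨BV, hBV⟩ := isCompact_Icc.exists_bound_of_continuousOn hCc
    have hBV0 := (norm_nonneg _).trans (hBV 0 h0mem)
    set A : ℝ := |L| * (1 + BZ + Bb) ^ l * (1 + |R|) ^ l
    have hWL : ∀ z : R3, ‖z‖ ≤ R → LipschitzOnWith (Real.toNNReal (|BD| * BV)) (W z) (Icc 0 t) := by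
      intro z hz
      refine (convex_Icc 0 t).lipschitzOnWith_of_nnnorm_hasDerivWithin_le (hγd z) fun τ hτ => ?_
      rw [← NNReal.coe_le_coe, coe_nnnorm, Real.coe_toNNReal _ (by positivity)]
      refine (ContinuousLinearMap.le_opNorm _ _).trans ?_
      have h1 := hBV τ hτ
      rw [norm_norm] at h1
      refine mul_le_mul ((hBD _ ⟨?_, ?_, hmemT τ hτ⟩).trans (le_abs_self _)) h1 (norm_nonneg _)
        (abs_nonneg _)
      · simpa using hBZ τ hτ
      · simpa using (norm_add_le z (b τ)).trans (add_le_add hz (hBb τ hτ))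
    refine ⟨Real.toNNReal (BQ * Real.toNNReal (|BD| * BV) + A * Kq) + KS, fun z hz => ?_⟩
    have hL1 := (lipschitzOn_mul_of_bounded (A := BQ) (B := A) hBQ0 (by positivity) hQL (hWL z hz)
      (fun τ hτ => hBQ τ hτ) (fun τ hτ => (hWb z τ hτ).trans (by
        have : ‖z‖ ≤ |R| := hz.trans (le_abs_self R)
        simp only [A]
        gcongr))).mono hsub
    refine hL1.sub fun r hr s hs => ?_
    rw [← heatSG_eq_scaled hν (hδ.1.trans_le hr.1), ← heatSG_eq_scaled hν (hδ.1.trans_le hs.1)]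
    exact hKS z hz hr hs
  · filter_upwards [hQd] with τ hQτ hτ z
    have hτI := Ioo_subset_Icc_self hτ
    have hτT : τ ∈ Ioo 0 T := ⟨hτ.1, hτ.2.trans_le ht.2⟩
    have hsc : (fun y => heatSGScaled ν g τ y) = heatSG ν g τ :=
      funext fun y => (heatSG_eq_scaled hν hτ.1 g y).symm
    have hP1 : ∀ y i, HasPartial (fun y => Q τ * W y τ) i y := fun y i =>
      (hp.hasPartial_x (hmemT τ hτI) (Z τ) (y + b τ) i).const_mul_comp_add
        (f := fun y => p (Z τ) y τ)
    have hS1 : ∀ y i, HasPartial (fun y => heatSGScaled ν g τ y) i y := fun y i => by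
      rw [hsc]; exact heatSG_hasPartial hν hτ.1 hgc hBg0 hgb i y
    have hpd : ∀ i, (fun y => partialD (fun y => Q τ * W y τ - heatSGScaled ν g τ y) i y) =
        fun y => Q τ * partialD (fun y => p (Z τ) y τ) i (y + b τ) - heatSG₁ ν i g τ y := by
      intro i
      funext y
      rw [partialD_sub (hP1 y i) (hS1 y i), hsc, partialD_heatSG hν hτ.1 hgc hBg0 hgb]
      congr 1
      exact partialD_const_mul_comp_add (Q τ) (fun y => p (Z τ) y τ) (b τ) i y
    have hP2 : ∀ i, HasPartial (fun y => Q τ * partialD (fun y => p (Z τ) y τ) i (y + b τ)) i z :=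
      fun i => (hp.second_partial (Z τ) (z + b τ) τ hτT i).const_mul_comp_add
    have hS2 : ∀ i, HasPartial (heatSG₁ ν i g τ) i z := fun i =>
      heatSG₁_hasPartial hν hτ.1 hgc hBg0 hgb i z
    refine ⟨fun i => (hP1 z i).sub (hS1 z i), fun i => ?_, ?_⟩
    · rw [hpd]; exact (hP2 i).sub (hS2 i)
    · have hWd := (hγd z τ hτI).hasDerivAt (Icc_mem_nhds hτ.1 hτ.2)
      rw [hp.equation_expanded hC hτT] at hWd
      have hSd := (heatSG_time_hasDerivAt hν hτ.1 hgc hgb z).congr_of_eventuallyEq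
        (f₁ := fun τ => heatSGScaled ν g τ z) (by
          filter_upwards [Ioi_mem_nhds hτ.1] with r hr using (heatSG_eq_scaled hν hr g z).symm)
      -- The divergence terms from `Q'` and from the equation for `W` cancel, leaving the Laplacian.
      refine (((hQτ hτ).fun_mul hWd).fun_sub hSd).congr_deriv ?_
      simp only [hpd]
      have h3 : ∀ i, partialD (fun y => Q τ * partialD (fun y => p (Z τ) y τ) i (y + b τ)
          - heatSG₁ ν i g τ y) i z =
          Q τ * partialD (fun y => partialD (fun y => p (Z τ) y τ) i y) i (z + b τ)
            - heatSG₂ ν i g τ z := by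
        intro i
        rw [partialD_sub (hP2 i) (hS2 i), partialD_heatSG₁ hν hτ.1 hgc hBg0 hgb,
          partialD_const_mul_comp_add]
      simp only [h3, Finset.sum_sub_distrib, ← Finset.mul_sum, laplacianP, hW]
      ring

/-! ### Decay in the velocity variable -/

/-- The weight `(1 + |u|)^(-m)`. -/
noncomputable def decayWeight (m : ℝ) (u : R3) : ℝ := (1 + ‖u‖) ^ (-m)

theorem decayWeight_pos (m : ℝ) (u : R3) : 0 < decayWeight m u :=
  Real.rpow_pos_of_pos (by positivity) _

theorem integrable_decayWeight {m : ℝ} (hm : 3 < m) : Integrable (decayWeight m) :=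
  integrable_one_add_norm (by simpa using hm)

theorem one_add_norm_mul_decayWeight (m : ℝ) (u : R3) :
    (1 + ‖u‖) * decayWeight m u = decayWeight (m - 1) u := by
  have h : 0 < 1 + ‖u‖ := by positivity
  rw [decayWeight, decayWeight, show -(m - 1) = 1 + -m by ring, Real.rpow_add h, Real.rpow_one]

theorem decayWeight_le_of_le {m E : ℝ} {u v : R3} (hm : 0 ≤ m) (hE : 0 ≤ E)
    (h : 1 + ‖u‖ ≤ E * (1 + ‖v‖)) : decayWeight m v ≤ E ^ m * decayWeight m u := by
  have hu : 0 < 1 + ‖u‖ := by positivity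
  have hv : 0 < 1 + ‖v‖ := by positivity
  rw [decayWeight, decayWeight, Real.rpow_neg hu.le, Real.rpow_neg hv.le, ← div_eq_mul_inv,
    le_div_iff₀ (Real.rpow_pos_of_pos hu _), inv_mul_eq_div, div_le_iff₀ (Real.rpow_pos_of_pos hv _),
    ← Real.mul_rpow hE hv.le]
  exact Real.rpow_le_rpow hu.le h hm

theorem one_le_mul_decayWeight {m E : ℝ} {u : R3} (hm : 0 ≤ m) (h : 1 + ‖u‖ ≤ E) :
    1 ≤ E ^ m * decayWeight m u := by
  have hu : 0 < 1 + ‖u‖ := by positivity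
  rw [decayWeight, Real.rpow_neg hu.le, ← div_eq_mul_inv, le_div_iff₀ (Real.rpow_pos_of_pos hu _),
    one_mul]
  exact Real.rpow_le_rpow hu.le h hm

section Decay

variable {T m : ℝ} {K : ℝ≥0} {C : R3 → ℝ → R3} {p₀ : R3 → R3 → ℝ}

/-- Pointwise decay of the initial density in the velocity variable. -/
theorem exists_initial_decay {L : ℝ} {l : ℕ} (hm : 0 ≤ m)
    (hL : ∀ u x, |p₀ u x| ≤ L * (1 + ‖u‖ + ‖x‖) ^ l)
    (hdec : TendstoUniformly (fun u x : R3 => ‖u‖ ^ m * p₀ u x) (fun _ => 0)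
      (Bornology.cobounded R3)) :
    ∃ R B : ℝ, 0 ≤ R ∧ 0 ≤ B ∧ (∀ v : R3, ‖v‖ ≤ R → ∀ z, |p₀ v z| ≤ B * (1 + ‖z‖) ^ l) ∧
      ∀ v : R3, R < ‖v‖ → ∀ z, |p₀ v z| ≤ 2 ^ m * decayWeight m v := by
  have h1 := Metric.tendstoUniformly_iff.1 hdec 1 one_pos
  rw [Filter.HasBasis.eventually_iff (Metric.hasBasis_cobounded_compl_closedBall (0 : R3))] at h1
  obtain ⟨r, -, hr⟩ := h1
  refine ⟨max r 1, |L| * (1 + max r 1) ^ l, by positivity, by positivity, fun v hv z => ?_,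
    fun v hv z => ?_⟩
  · refine (hL v z).trans ?_
    rw [mul_assoc, ← mul_pow]
    have h2 : 1 + ‖v‖ + ‖z‖ ≤ (1 + max r 1) * (1 + ‖z‖) := by
      nlinarith [norm_nonneg z, le_max_right r 1, mul_nonneg (zero_le_one.trans (le_max_right r 1))
        (norm_nonneg z)]
    calc _ ≤ |L| * (1 + ‖v‖ + ‖z‖) ^ l := by gcongr; exact le_abs_self L
      _ ≤ _ := by gcongr
  · have hv1 : 1 < ‖v‖ := (le_max_right r 1).trans_lt hv
    have h2 := hr (x := v) (by simpa using (le_max_left r 1).trans_lt hv) z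
    rw [dist_zero_left, norm_mul, Real.norm_eq_abs,
      abs_of_pos (Real.rpow_pos_of_pos (by linarith) _), Real.norm_eq_abs] at h2
    have hu : 0 < 1 + ‖v‖ := by positivity
    rw [decayWeight, Real.rpow_neg hu.le, ← div_eq_mul_inv, le_div_iff₀ (Real.rpow_pos_of_pos hu _)]
    -- Since `‖v‖ > 1`, one has `1 + ‖v‖ ≤ 2‖v‖`; this is the source of the factor `2 ^ m`.
    have h3 : (1 + ‖v‖) ^ m ≤ 2 ^ m * ‖v‖ ^ m := by
      rw [← Real.mul_rpow (by norm_num) (norm_nonneg _)]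
      exact Real.rpow_le_rpow hu.le (by linarith) hm
    calc |p₀ v z| * (1 + ‖v‖) ^ m ≤ |p₀ v z| * (2 ^ m * ‖v‖ ^ m) := by gcongr
      _ = 2 ^ m * (‖v‖ ^ m * |p₀ v z|) := by ring
      _ ≤ 2 ^ m * 1 := by
        have : (0 : ℝ) ≤ 2 ^ m := Real.rpow_nonneg (by norm_num) _
        gcongr
      _ = 2 ^ m := mul_one _

/-- Operators on polynomially bounded functions transport the decay of the initial density along the
characteristics. -/
theorem exists_transported_decay {R B : ℝ} {l : ℕ} (hT : 0 ≤ T) (hC : IsLipschitzField T K C)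
    (hm : 0 ≤ m) (hR : 0 ≤ R) (hB : 0 ≤ B)
    (h1 : ∀ v : R3, ‖v‖ ≤ R → ∀ z, |p₀ v z| ≤ B * (1 + ‖z‖) ^ l)
    (h2 : ∀ v : R3, R < ‖v‖ → ∀ z, |p₀ v z| ≤ 2 ^ m * decayWeight m v)
    {Φ : (R3 → ℝ) → ℝ → R3 → ℝ} {S : Set ℝ} (hS : S ⊆ Icc 0 T)
    (hΦ : ∀ l : ℕ, ∃ A : ℝ, 0 ≤ A ∧ ∀ (g : R3 → ℝ) (B : ℝ), 0 ≤ B →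
      (∀ z, |g z| ≤ B * (1 + ‖z‖) ^ l) → ∀ t ∈ S, ∀ x, |Φ g t x| ≤ A * B * (1 + ‖x‖) ^ l) :
    ∃ A : ℝ, 0 ≤ A ∧ ∀ t ∈ S, ∀ u Y q, IsCharacteristic C t u Y q → ∀ x,
      |q t * Φ (p₀ (Y t)) t (x - ∫ s in (0 : ℝ)..t, Y s)| ≤
        A * decayWeight m u * (1 + ‖x‖) ^ l := by
  obtain ⟨E, hE, hEb⟩ := IsCharacteristic.exists_growth hC
  -- Exponent `0` serves large `Y t`, where `p₀ (Y t)` is bounded uniformly in position; exponent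
  -- `l` serves `‖Y t‖ ≤ R`, where only polynomial growth is known.
  obtain ⟨A₀, hA₀, hΦ₀⟩ := hΦ 0
  obtain ⟨A₁, hA₁, hΦ₁⟩ := hΦ l
  have hE0 : 0 ≤ E := zero_le_one.trans hE
  have h2m : (0 : ℝ) ≤ 2 ^ m := Real.rpow_nonneg (by norm_num) _
  have hEm : 0 ≤ E ^ m := Real.rpow_nonneg hE0 _
  set U : ℝ := E * (1 + R) with hU
  have hU0 : 0 ≤ U := by positivity
  have hUm : 0 ≤ U ^ m := Real.rpow_nonneg hU0 _
  set G : ℝ := Real.exp (3 * K * T)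
  set a₀ : ℝ := A₀ * (2 ^ m * E ^ m)
  set a₁ : ℝ := A₁ * B * (1 + T * (E * U)) ^ l * U ^ m
  have ha₀ : 0 ≤ a₀ := by positivity
  have ha₁ : 0 ≤ a₁ := by positivity
  refine ⟨G * (a₀ + a₁), by positivity, fun t htS u Y q hY x => ?_⟩
  have ht := hS htS
  have hw := (decayWeight_pos m u).le
  obtain ⟨hb1, hb2⟩ := hEb t ht u Y q hY
  have hq : |q t| ≤ G := by
    rw [hY.q_eq hC ht.2 ⟨ht.1, le_rfl⟩, abs_of_pos (Real.exp_pos _), Real.exp_le_exp]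
    refine (le_abs_self _).trans ?_
    have := intervalIntegral.norm_integral_le_of_norm_le_const (a := (0 : ℝ)) (b := t) (C := 3 * K)
      (f := fun r => divergence (fun v => C v (t - r)) (Y r)) (fun r hr => by
        rw [uIoc_of_le ht.1] at hr
        exact hC.abs_divergence_le ⟨by linarith [hr.2], by linarith [hr.1, ht.2]⟩ (Y r))
    rw [Real.norm_eq_abs, sub_zero, abs_of_nonneg ht.1] at this
    exact this.trans (mul_le_mul_of_nonneg_left ht.2 (by positivity))
  have hxl : (1 : ℝ) ≤ (1 + ‖x‖) ^ l := one_le_pow₀ (by linarith [norm_nonneg x])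
  suffices h : |Φ (p₀ (Y t)) t (x - ∫ s in (0 : ℝ)..t, Y s)| ≤
      (a₀ + a₁) * (decayWeight m u * (1 + ‖x‖) ^ l) by
    rw [abs_mul]
    calc _ ≤ G * ((a₀ + a₁) * (decayWeight m u * (1 + ‖x‖) ^ l)) :=
          mul_le_mul hq h (abs_nonneg _) (Real.exp_pos _).le
      _ = _ := by ring
  have hwx : 0 ≤ decayWeight m u * (1 + ‖x‖) ^ l := by positivity
  rw [add_mul]
  -- If `‖Y t‖ ≤ R`, then `1 + ‖u‖ ≤ U`, so the weight at `u` is bounded below and can be inserted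
  -- at the cost of `U ^ m`. Otherwise the decay is present at `Y t` and is moved to `u` at the cost
  -- of `E ^ m`.
  rcases le_or_gt ‖Y t‖ R with hYR | hYR
  · refine le_trans ?_ (le_add_of_nonneg_left (mul_nonneg ha₀ hwx))
    have h3 := hΦ₁ (p₀ (Y t)) B hB (h1 _ hYR) t htS (x - ∫ s in (0 : ℝ)..t, Y s)
    have hu : 1 + ‖u‖ ≤ U := hb2.trans (mul_le_mul_of_nonneg_left (by linarith) hE0)
    have h4 : ‖∫ s in (0 : ℝ)..t, Y s‖ ≤ T * (E * U) := by
      have := intervalIntegral.norm_integral_le_of_norm_le_const (a := (0 : ℝ)) (b := t)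
        (C := E * U) (f := Y) (fun r hr => by
          rw [uIoc_of_le ht.1] at hr
          have := hb1 r ⟨hr.1.le, hr.2⟩
          have h5 := mul_le_mul_of_nonneg_left hu hE0
          linarith)
      rw [sub_zero, abs_of_nonneg ht.1, mul_comm] at this
      exact this.trans (mul_le_mul_of_nonneg_right ht.2 (by positivity))
    have h5 : (1 + ‖x - ∫ s in (0 : ℝ)..t, Y s‖) ^ l ≤ (1 + ‖x‖) ^ l * (1 + T * (E * U)) ^ l := by
      rw [← mul_pow]
      gcongr
      refine (by rw [sub_eq_add_neg]; exact one_add_norm_add_le _ _ :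
        _ ≤ (1 + ‖x‖) * (1 + ‖-∫ s in (0 : ℝ)..t, Y s‖)).trans ?_
      rw [norm_neg]
      gcongr
    have h6 := one_le_mul_decayWeight hm hu
    calc _ ≤ A₁ * B * ((1 + ‖x‖) ^ l * (1 + T * (E * U)) ^ l) := h3.trans (by gcongr)
      _ ≤ A₁ * B * ((1 + ‖x‖) ^ l * (1 + T * (E * U)) ^ l) * (U ^ m * decayWeight m u) :=
        le_mul_of_one_le_right (by positivity) h6
      _ = _ := by simp only [a₁]; ring
  · refine le_trans ?_ (le_add_of_nonneg_right (mul_nonneg ha₁ hwx))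
    have h3 := hΦ₀ (p₀ (Y t)) (2 ^ m * decayWeight m (Y t))
      (mul_nonneg h2m (decayWeight_pos _ _).le) (fun z => by simpa using h2 _ hYR z) t htS
      (x - ∫ s in (0 : ℝ)..t, Y s)
    rw [pow_zero, mul_one] at h3
    have h4 := decayWeight_le_of_le hm hE0 hb2
    calc _ ≤ A₀ * (2 ^ m * (E ^ m * decayWeight m u)) := h3.trans (by gcongr)
      _ = a₀ * decayWeight m u * 1 := by simp only [a₀]; ring
      _ ≤ a₀ * decayWeight m u * (1 + ‖x‖) ^ l := by gcongr
      _ = _ := by ring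

end Decay

/-- Decay in the velocity variable of a density, of its first and of its pure second position
derivatives. -/
structure HasVelocityDecay (T m : ℝ) (l : ℕ) (p : R3 → R3 → ℝ → ℝ) : Prop where
  bound : ∃ A : ℝ, 0 ≤ A ∧ ∀ t ∈ Icc 0 T, ∀ u x, |p u x t| ≤ A * decayWeight m u * (1 + ‖x‖) ^ l
  second_partial : ∀ t ∈ Ioc 0 T, ∀ u x i, HasPartial (fun y => partialD (fun z => p u z t) i y) i x
  bound_partial : ∀ δ > 0, ∀ i, ∃ A : ℝ, 0 ≤ A ∧ ∀ t ∈ Icc δ T, ∀ u x,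
    |partialD (fun y => p u y t) i x| ≤ A * decayWeight m u * (1 + ‖x‖) ^ l
  bound_second_partial : ∀ δ > 0, ∀ i, ∃ A : ℝ, 0 ≤ A ∧ ∀ t ∈ Icc δ T, ∀ u x,
    |partialD (fun y => partialD (fun z => p u z t) i y) i x| ≤ A * decayWeight m u * (1 + ‖x‖) ^ l

namespace IsPDFSolution

variable {ν T m : ℝ} {K : ℝ≥0} {C : R3 → ℝ → R3} {p₀ : R3 → R3 → ℝ} {p : R3 → R3 → ℝ → ℝ}

theorem initial_bound (hT : 0 < T) (hp : IsPDFSolution ν T C p₀ p) {L : ℝ} {l : ℕ}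
    (hL : ∀ u x : R3, ∀ t ∈ Icc 0 T, |p u x t| ≤ L * (1 + ‖u‖ + ‖x‖) ^ l) (u x : R3) :
    |p₀ u x| ≤ L * (1 + ‖u‖ + ‖x‖) ^ l := by
  rw [← hp.initial]
  exact hL u x 0 ⟨le_rfl, hT.le⟩

theorem initial_bound_fixed (hT : 0 < T) (hp : IsPDFSolution ν T C p₀ p) {L : ℝ} {l : ℕ}
    (hL : ∀ u x : R3, ∀ t ∈ Icc 0 T, |p u x t| ≤ L * (1 + ‖u‖ + ‖x‖) ^ l) (u x : R3) :
    |p₀ u x| ≤ (|L| * (1 + ‖u‖) ^ l) * (1 + ‖x‖) ^ l := by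
  refine (hp.initial_bound hT hL u x).trans ?_
  rw [mul_assoc, ← mul_pow]
  have h2 : 1 + ‖u‖ + ‖x‖ ≤ (1 + ‖u‖) * (1 + ‖x‖) := by
    nlinarith [mul_nonneg (norm_nonneg u) (norm_nonneg x)]
  calc _ ≤ |L| * (1 + ‖u‖ + ‖x‖) ^ l := by gcongr; exact le_abs_self L
    _ ≤ _ := by gcongr

theorem continuous_x (hp : IsPDFSolution ν T C p₀ p) {t : ℝ} (ht : t ∈ Icc 0 T) (u : R3) :
    Continuous fun x => p u x t :=
  continuousOn_univ.1 (hp.continuousOn.comp (f := fun x : R3 => (u, x, t))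
    (by fun_prop) fun x _ => mem_slab ht)

theorem continuous_u (hp : IsPDFSolution ν T C p₀ p) {t : ℝ} (ht : t ∈ Icc 0 T) (x : R3) :
    Continuous fun u => p u x t :=
  continuousOn_univ.1 (hp.continuousOn.comp (f := fun u : R3 => (u, x, t))
    (by fun_prop) fun x _ => mem_slab ht)

theorem continuous_initial (hT : 0 < T) (hp : IsPDFSolution ν T C p₀ p) (u : R3) :
    Continuous (p₀ u) := by
  have h1 := hp.continuous_x (t := 0) ⟨le_rfl, hT.le⟩ u
  simpa only [hp.initial] using h1

/-- By the representation formula, `p` and its `x`-derivatives are `q t` times semigroup operators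
applied to `p₀ (Y t)`, whose uniform bounds are transported. The formula also yields second
derivatives at `t = T`, where the equation itself says nothing. -/
theorem hasVelocityDecay (hν : 0 < ν) (hT : 0 < T) (hC : IsLipschitzField T K C)
    (hp : IsPDFSolution ν T C p₀ p) {L : ℝ} {l : ℕ}
    (hL : ∀ u x : R3, ∀ t ∈ Icc 0 T, |p u x t| ≤ L * (1 + ‖u‖ + ‖x‖) ^ l) (hm : 0 ≤ m)
    (hdec : TendstoUniformly (fun u x : R3 => ‖u‖ ^ m * p₀ u x) (fun _ => 0)
      (Bornology.cobounded R3)) : HasVelocityDecay T m l p := by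
  obtain ⟨R, B, hR, hB, hd1, hd2⟩ := exists_initial_decay hm (hp.initial_bound hT hL) hdec
  have hrep : ∀ t ∈ Ioc 0 T, ∀ u Y q, IsCharacteristic C t u Y q →
      (fun x => p u x t) = fun x => q t * heatSG ν (p₀ (Y t)) t (x + -∫ s in (0 : ℝ)..t, Y s) :=
    fun t ht u Y q hY => funext fun x => by
      rw [hp.eq_heatSG hν hT hC ⟨L, l, hL⟩ ht hY, sub_eq_add_neg]
  have hgc := hp.continuous_initial hT
  have hgb := hp.initial_bound_fixed hT hL
  have hB0 : ∀ u : R3, 0 ≤ |L| * (1 + ‖u‖) ^ l := fun u => by positivity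
  have hrep1 : ∀ t ∈ Ioc 0 T, ∀ u Y q, IsCharacteristic C t u Y q → ∀ i,
      partialD (fun x => p u x t) i =
        fun x => q t * heatSG₁ ν i (p₀ (Y t)) t (x + -∫ s in (0 : ℝ)..t, Y s) := by
    intro t ht u Y q hY i
    funext x
    rw [hrep t ht u Y q hY, partialD_const_mul_comp_add, partialD_heatSG hν ht.1 (hgc _) (hB0 _) (hgb _)]
  have hrep2 : ∀ t ∈ Ioc 0 T, ∀ u Y q, IsCharacteristic C t u Y q → ∀ i,
      partialD (fun y => partialD (fun x => p u x t) i y) i =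
        fun x => q t * heatSG₂ ν i (p₀ (Y t)) t (x + -∫ s in (0 : ℝ)..t, Y s) := by
    intro t ht u Y q hY i
    funext x
    rw [hrep1 t ht u Y q hY, partialD_const_mul_comp_add,
      partialD_heatSG₁ hν ht.1 (hgc _) (hB0 _) (hgb _)]
  refine ⟨?_, fun t ht u x i => ?_, fun δ hδ i => ?_, fun δ hδ i => ?_⟩
  · obtain ⟨A, hA, hAb⟩ := exists_transported_decay hT.le hC hm hR hB hd1 hd2
      (Φ := fun g t x => heatSGScaled ν g t x) (S := Icc 0 T) subset_rfl (fun l => by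
        obtain ⟨A, hA, h⟩ := exists_heatSGScaled_bound hν T l
        exact ⟨A, hA, fun g B hB hg t ht x => h g B hB hg t ht.2 x⟩)
    refine ⟨A, hA, fun t ht u x => ?_⟩
    obtain ⟨Y, q, hY⟩ := hC.exists_characteristic ht.1 ht.2 u
    have h1 := hAb t ht u Y q hY x
    rcases ht.1.eq_or_lt with h0 | h0
    · subst h0
      have h2 := hY.eq_q 0 ⟨le_rfl, le_rfl⟩
      rw [heatSGScaled_zero hν] at h1
      simpa [h2, hY.Y_zero le_rfl, hp.initial] using h1
    · rw [hp.eq_heatSG hν hT hC ⟨L, l, hL⟩ ⟨h0, ht.2⟩ hY, heatSG_eq_scaled hν h0]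
      exact h1
  · obtain ⟨Y, q, hY⟩ := hC.exists_characteristic ht.1.le ht.2 u
    rw [hrep1 t ht u Y q hY]
    exact (heatSG₁_hasPartial hν ht.1 (hgc _) (hB0 _) (hgb _) i _).const_mul_comp_add
  · obtain ⟨A, hA, hAb⟩ := exists_transported_decay hT.le hC hm hR hB hd1 hd2
      (Φ := fun g t x => heatSG₁ ν i g t x) (S := Icc δ T) (Icc_subset_Icc_left hδ.le) (fun l => by
        obtain ⟨A, hA, h⟩ := exists_heatSG_bound hν hδ T l
        exact ⟨A, hA, fun g B hB hg t ht x => (h g B hB hg t ht x i).1⟩)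
    refine ⟨A, hA, fun t ht u x => ?_⟩
    have ht' : t ∈ Ioc 0 T := ⟨hδ.trans_le ht.1, ht.2⟩
    obtain ⟨Y, q, hY⟩ := hC.exists_characteristic ht'.1.le ht'.2 u
    rw [hrep1 t ht' u Y q hY]
    simpa only [← sub_eq_add_neg] using hAb t ht u Y q hY x
  · obtain ⟨A, hA, hAb⟩ := exists_transported_decay hT.le hC hm hR hB hd1 hd2
      (Φ := fun g t x => heatSG₂ ν i g t x) (S := Icc δ T) (Icc_subset_Icc_left hδ.le) (fun l => by
        obtain ⟨A, hA, h⟩ := exists_heatSG_bound hν hδ T l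
        exact ⟨A, hA, fun g B hB hg t ht x => (h g B hB hg t ht x i).2⟩)
    refine ⟨A, hA, fun t ht u x => ?_⟩
    have ht' : t ∈ Ioc 0 T := ⟨hδ.trans_le ht.1, ht.2⟩
    obtain ⟨Y, q, hY⟩ := hC.exists_characteristic ht'.1.le ht'.2 u
    rw [hrep2 t ht' u Y q hY]
    simpa only [← sub_eq_add_neg] using hAb t ht u Y q hY x

end IsPDFSolution

/-! ### Differentiation under the velocity integral -/

/-- A partial derivative in `x` is a limit of difference quotients along the sequence `1 / (n + 1)`,
each measurable in `u`. -/
theorem aestronglyMeasurable_partialD {f : R3 → R3 → ℝ} {i : Fin 3} {x : R3}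
    (hm : ∀ x, AEStronglyMeasurable (fun u => f u x)) (hd : ∀ u, HasPartial (f u) i x) :
    AEStronglyMeasurable (fun u => partialD (f u) i x) := by
  set ε : ℕ → ℝ := fun n => 1 / ((n : ℝ) + 1)
  have hε : Filter.Tendsto ε Filter.atTop (nhdsWithin 0 {0}ᶜ) := by
    refine tendsto_nhdsWithin_iff.2 ⟨tendsto_one_div_add_atTop_nhds_zero_nat,
      Filter.Eventually.of_forall fun n => ?_⟩
    have : ε n ≠ 0 := by simp only [ε]; positivity
    exact this
  refine aestronglyMeasurable_of_tendsto_ae Filter.atTop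
    (f := fun n u => (ε n)⁻¹ • (f u (x + ε n • stdVec i) - f u x))
    (fun n => ((hm _).sub (hm _)).const_smul (ε n)⁻¹) (Filter.Eventually.of_forall fun u => ?_)
  have h1 := (hd u).hasDerivAt.tendsto_slope_zero
  simpa [Function.comp_def] using h1.comp hε

theorem integral_line_hasDerivAt {f : R3 → R3 → ℝ} {w : R3 → ℝ} {A : ℝ} {l : ℕ} {i : Fin 3}
    (hA : 0 ≤ A) (hw : Integrable w) (hw0 : ∀ u, 0 ≤ w u)
    (hm : ∀ x, AEStronglyMeasurable (fun u => f u x)) (hd : ∀ u x, HasPartial (f u) i x)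
    (hf : ∀ x, Integrable fun u => f u x)
    (hb : ∀ u x, |partialD (f u) i x| ≤ A * w u * (1 + ‖x‖) ^ l) (x : R3) :
    HasDerivAt (fun s : ℝ => ∫ u, f u (x + s • stdVec i)) (∫ u, partialD (f u) i x) 0 := by
  have h := (hasDerivAt_integral_of_dominated_loc_of_deriv_le (μ := volume)
    (F := fun (s : ℝ) u => f u (x + s • stdVec i))
    (F' := fun (s : ℝ) u => partialD (f u) i (x + s • stdVec i)) (x₀ := 0)
    (bound := fun u => A * w u * (1 + (‖x‖ + 1)) ^ l)
    (Metric.ball_mem_nhds (0 : ℝ) one_pos) ?_ ?_ ?_ ?_ ?_ ?_).2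
  · simpa using h
  · exact Filter.Eventually.of_forall fun s => hm _
  · exact hf _
  · exact aestronglyMeasurable_partialD hm fun u => hd u _
  · refine Filter.Eventually.of_forall fun u s hs => (hb u _).trans ?_
    have h2 : ‖x + s • stdVec i‖ ≤ ‖x‖ + 1 := by
      refine (norm_add_le _ _).trans ?_
      rw [norm_smul, norm_stdVec, mul_one]
      exact add_le_add_right (mem_ball_zero_iff.1 hs).le _
    have := hw0 u
    gcongr
  · exact (hw.const_mul A).mul_const _
  · exact Filter.Eventually.of_forall fun u s _ => (hd u _).hasDerivAt_line

theorem HasPartial.const_mul {c : ℝ} {f : R3 → ℝ} {i : Fin 3} {z : R3} (h : HasPartial f i z) :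
    HasPartial (fun y => c * f y) i z :=
  DifferentiableAt.const_mul h c

theorem partialD_const_mul (c : ℝ) (f : R3 → ℝ) (i : Fin 3) (z : R3) :
    partialD (fun y => c * f y) i z = c * partialD f i z := by
  simp only [partialD, lineDeriv]
  rw [deriv_const_mul_field]

/-- A factor `uⁱ` uses up one power of decay. Integrability of what remains requires `m - 1 > 3`,
which is the condition `m > 4`. -/
theorem abs_coord_mul_decay_le {m A X a : ℝ} {u : R3} (i : Fin 3)
    (h : |a| ≤ A * decayWeight m u * X) : |u i * a| ≤ A * decayWeight (m - 1) u * X := by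
  rw [abs_mul]
  have h1 : |u i| ≤ 1 + ‖u‖ := by
    have := PiLp.norm_apply_le u i
    rw [Real.norm_eq_abs] at this
    linarith
  calc _ ≤ (1 + ‖u‖) * (A * decayWeight m u * X) :=
        mul_le_mul h1 h (abs_nonneg _) (by positivity)
    _ = A * ((1 + ‖u‖) * decayWeight m u) * X := by ring
    _ = _ := by rw [one_add_norm_mul_decayWeight]

/-! ### Mass and first moments -/

/-- The total mass `∫ p(u; x, t) du`. -/
noncomputable def totalMass (p : R3 → R3 → ℝ → ℝ) (t : ℝ) (x : R3) : ℝ := ∫ u, p u x t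

section Mass

variable {ν T m : ℝ} {l : ℕ} {K : ℝ≥0} {C : R3 → ℝ → R3} {p₀ : R3 → R3 → ℝ} {p : R3 → R3 → ℝ → ℝ}

theorem integrable_of_decay {f w : R3 → ℝ} {A X : ℝ} (hf : AEStronglyMeasurable f)
    (hw : Integrable w) (hb : ∀ u, |f u| ≤ A * w u * X) : Integrable f :=
  ((hw.const_mul A).mul_const X).mono' hf (Filter.Eventually.of_forall hb)

namespace HasVelocityDecay

theorem integrable (hp : IsPDFSolution ν T C p₀ p) (hD : HasVelocityDecay T m l p) (hm : 4 < m)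
    {t : ℝ} (ht : t ∈ Icc 0 T) (x : R3) : Integrable fun u => p u x t := by
  obtain ⟨A, hA, h⟩ := hD.bound
  exact integrable_of_decay (hp.continuous_u ht x).aestronglyMeasurable
    (integrable_decayWeight (by linarith)) fun u => h t ht u x

theorem integrable_coord_mul (hp : IsPDFSolution ν T C p₀ p) (hD : HasVelocityDecay T m l p)
    (hm : 4 < m) {t : ℝ} (ht : t ∈ Icc 0 T) (x : R3) (i : Fin 3) :
    Integrable fun u => u i * p u x t := by
  obtain ⟨A, hA, h⟩ := hD.bound
  have := hp.continuous_u ht x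
  exact integrable_of_decay (Continuous.aestronglyMeasurable (by fun_prop))
    (integrable_decayWeight (m := m - 1) (by linarith))
    fun u => abs_coord_mul_decay_le i (h t ht u x)

theorem integrable_norm_mul (hp : IsPDFSolution ν T C p₀ p) (hD : HasVelocityDecay T m l p)
    (hm : 4 < m) {t : ℝ} (ht : t ∈ Icc 0 T) (x : R3) : Integrable fun u => ‖u‖ * p u x t := by
  obtain ⟨A, hA, h⟩ := hD.bound
  have := hp.continuous_u ht x
  refine integrable_of_decay (A := A) (X := (1 + ‖x‖) ^ l)
    (Continuous.aestronglyMeasurable (by fun_prop))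
    (integrable_decayWeight (m := m - 1) (by linarith)) fun u => ?_
  rw [← one_add_norm_mul_decayWeight, abs_mul, abs_norm]
  calc _ ≤ (1 + ‖u‖) * (A * decayWeight m u * (1 + ‖x‖) ^ l) :=
        mul_le_mul (by linarith) (h t ht u x) (abs_nonneg _) (by positivity)
    _ = _ := by ring

theorem aestronglyMeasurable_partial (hp : IsPDFSolution ν T C p₀ p) {t : ℝ} (ht : t ∈ Icc 0 T)
    (x : R3) (i : Fin 3) : AEStronglyMeasurable fun u => partialD (fun y => p u y t) i x :=
  aestronglyMeasurable_partialD (f := fun u y => p u y t)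
    (fun y => (hp.continuous_u ht y).aestronglyMeasurable) fun u => hp.hasPartial_x ht u x i

theorem aestronglyMeasurable_second_partial (hp : IsPDFSolution ν T C p₀ p)
    (hD : HasVelocityDecay T m l p) {t : ℝ} (ht : t ∈ Ioc 0 T) (x : R3) (i : Fin 3) :
    AEStronglyMeasurable fun u => partialD (fun y => partialD (fun z => p u z t) i y) i x :=
  aestronglyMeasurable_partialD (f := fun u y => partialD (fun z => p u z t) i y)
    (fun y => aestronglyMeasurable_partial hp (Ioc_subset_Icc_self ht) y i)
    fun u => hD.second_partial t ht u x i

theorem totalMass_line (hp : IsPDFSolution ν T C p₀ p) (hD : HasVelocityDecay T m l p)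
    (hm : 4 < m) {t : ℝ} (ht : t ∈ Ioc 0 T) (x : R3) (i : Fin 3) :
    HasDerivAt (fun s : ℝ => totalMass p t (x + s • stdVec i))
      (∫ u, partialD (fun y => p u y t) i x) 0 := by
  obtain ⟨A, hA, h⟩ := hD.bound_partial t ht.1 i
  have htI := Ioc_subset_Icc_self ht
  exact integral_line_hasDerivAt (f := fun u y => p u y t) hA
    (integrable_decayWeight (m := m) (by linarith)) (fun u => (decayWeight_pos _ u).le)
    (fun y => (hp.continuous_u htI y).aestronglyMeasurable) (fun u y => hp.hasPartial_x htI u y i)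
    (fun y => hD.integrable hp hm htI y) (fun u y => h t ⟨le_rfl, ht.2⟩ u y) x

theorem integrable_partial (hp : IsPDFSolution ν T C p₀ p) (hD : HasVelocityDecay T m l p)
    (hm : 4 < m) {t : ℝ} (ht : t ∈ Ioc 0 T) (x : R3) (i : Fin 3) :
    Integrable fun u => partialD (fun y => p u y t) i x := by
  obtain ⟨A, hA, h⟩ := hD.bound_partial t ht.1 i
  exact integrable_of_decay (aestronglyMeasurable_partial hp (Ioc_subset_Icc_self ht) x i)
    (integrable_decayWeight (m := m) (by linarith)) fun u => h t ⟨le_rfl, ht.2⟩ u x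

theorem integrable_coord_mul_partial (hp : IsPDFSolution ν T C p₀ p) (hD : HasVelocityDecay T m l p)
    (hm : 4 < m) {t : ℝ} (ht : t ∈ Ioc 0 T) (x : R3) (i : Fin 3) :
    Integrable fun u => u i * partialD (fun y => p u y t) i x := by
  obtain ⟨A, hA, h⟩ := hD.bound_partial t ht.1 i
  exact integrable_of_decay ((Continuous.aestronglyMeasurable (by fun_prop)).mul
      (aestronglyMeasurable_partial hp (Ioc_subset_Icc_self ht) x i))
    (integrable_decayWeight (m := m - 1) (by linarith))
    fun u => abs_coord_mul_decay_le i (h t ⟨le_rfl, ht.2⟩ u x)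

theorem integrable_second_partial (hp : IsPDFSolution ν T C p₀ p) (hD : HasVelocityDecay T m l p)
    (hm : 4 < m) {t : ℝ} (ht : t ∈ Ioc 0 T) (x : R3) (i : Fin 3) :
    Integrable fun u => partialD (fun y => partialD (fun z => p u z t) i y) i x := by
  obtain ⟨A, hA, h⟩ := hD.bound_second_partial t ht.1 i
  exact integrable_of_decay (hD.aestronglyMeasurable_second_partial hp ht x i)
    (integrable_decayWeight (m := m) (by linarith)) fun u => h t ⟨le_rfl, ht.2⟩ u x

theorem totalMass_partial_line (hp : IsPDFSolution ν T C p₀ p) (hD : HasVelocityDecay T m l p)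
    (hm : 4 < m) {t : ℝ} (ht : t ∈ Ioc 0 T) (x : R3) (i : Fin 3) :
    HasDerivAt (fun s : ℝ => ∫ u, partialD (fun y => p u y t) i (x + s • stdVec i))
      (∫ u, partialD (fun y => partialD (fun z => p u z t) i y) i x) 0 := by
  obtain ⟨A, hA, h⟩ := hD.bound_second_partial t ht.1 i
  have htI := Ioc_subset_Icc_self ht
  exact integral_line_hasDerivAt (f := fun u y => partialD (fun y => p u y t) i y) hA
    (integrable_decayWeight (m := m) (by linarith)) (fun u => (decayWeight_pos _ u).le)
    (fun y => aestronglyMeasurable_partial hp htI y i) (fun u y => hD.second_partial t ht u y i)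
    (fun y => hD.integrable_partial hp hm ht y i) (fun u y => h t ⟨le_rfl, ht.2⟩ u y) x

theorem firstMoment_line (hp : IsPDFSolution ν T C p₀ p) (hD : HasVelocityDecay T m l p)
    (hm : 4 < m) {t : ℝ} (ht : t ∈ Ioc 0 T) (x : R3) (i : Fin 3) :
    HasDerivAt (fun s : ℝ => firstMoment p t i (x + s • stdVec i))
      (∫ u : R3, u i * partialD (fun y => p u y t) i x) 0 := by
  obtain ⟨A, hA, h⟩ := hD.bound_partial t ht.1 i
  have htI := Ioc_subset_Icc_self ht
  have := integral_line_hasDerivAt (f := fun u y => u i * p u y t) (i := i) hA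
    (integrable_decayWeight (m := m - 1) (by linarith)) (fun u => (decayWeight_pos _ u).le)
    (fun y => (hD.integrable_coord_mul hp hm htI y i).aestronglyMeasurable)
    (fun u y => (hp.hasPartial_x htI u y i).const_mul)
    (fun y => hD.integrable_coord_mul hp hm htI y i) (l := l) (fun u y => by
      rw [partialD_const_mul]
      exact abs_coord_mul_decay_le i (h t ⟨le_rfl, ht.2⟩ u y)) x
  simp only [partialD_const_mul] at this
  exact this

theorem continuousOn_totalMass (hp : IsPDFSolution ν T C p₀ p) (hD : HasVelocityDecay T m l p)
    (hm : 4 < m) :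
    ContinuousOn (fun w : R3 × ℝ => totalMass p w.2 w.1) (univ ×ˢ Icc 0 T) := by
  obtain ⟨A, hA, h⟩ := hD.bound
  intro w hw
  refine continuousWithinAt_of_dominated
    (bound := fun u => A * decayWeight m u * (1 + (‖w.1‖ + 1)) ^ l) ?_ ?_ ?_ ?_
  · filter_upwards [self_mem_nhdsWithin] with v hv
    exact (hp.continuous_u hv.2 v.1).aestronglyMeasurable
  · filter_upwards [self_mem_nhdsWithin, mem_nhdsWithin_of_mem_nhds (Metric.ball_mem_nhds w one_pos)]
      with v hv hvb
    rw [Metric.mem_ball, Prod.dist_eq, max_lt_iff] at hvb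
    refine Filter.Eventually.of_forall fun u => (h v.2 hv.2 u v.1).trans ?_
    have h1 := norm_sub_norm_le v.1 w.1
    rw [← dist_eq_norm] at h1
    have h2 : ‖v.1‖ ≤ ‖w.1‖ + 1 := by linarith [hvb.1]
    have := decayWeight_pos m u
    gcongr
  · exact ((integrable_decayWeight (by linarith)).const_mul A).mul_const _
  · refine Filter.Eventually.of_forall fun u => ?_
    exact hp.continuousOn.comp (f := fun w : R3 × ℝ => (u, w.1, w.2)) (by fun_prop)
      (fun v hv => mem_slab hv.2) w hw

/-- Lets an identity for the divergence of the first moment pass from `t < T` to `t = T`. -/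
theorem continuousOn_moment_partial (hT : 0 < T) (hp : IsPDFSolution ν T C p₀ p)
    (hD : HasVelocityDecay T m l p) (hm : 4 < m) {δ : ℝ} (hδ : 0 < δ) (x : R3) (i : Fin 3) :
    ContinuousOn (fun t => ∫ u : R3, u i * partialD (fun y => p u y t) i x) (Icc δ T) := by
  obtain ⟨A, hA, h⟩ := hD.bound_partial δ hδ i
  have hsub : Icc δ T ⊆ Icc 0 T := Icc_subset_Icc_left hδ.le
  refine continuousOn_of_dominated
    (bound := fun u => A * decayWeight (m - 1) u * (1 + ‖x‖) ^ l) (fun t ht => ?_) (fun t ht => ?_)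
    (((integrable_decayWeight (by linarith)).const_mul A).mul_const _) ?_
  · exact (hD.integrable_coord_mul_partial hp hm ⟨hδ.trans_le ht.1, ht.2⟩ x i).aestronglyMeasurable
  · exact Filter.Eventually.of_forall fun u => abs_coord_mul_decay_le i (h t ht u x)
  · refine Filter.Eventually.of_forall fun u => continuousOn_const.mul ?_
    have h1 : ContinuousOn (fun t => slabDeriv T p (u, x, t) (0, stdVec i, 0)) (Icc δ T) :=
      ((hp.continuousOn_slabDeriv hT).comp (f := fun t : ℝ => (u, x, t)) (by fun_prop)
        fun t ht => mem_slab (hsub ht)).clm_apply continuousOn_const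
    exact h1.congr fun t ht => hp.partialD_x (hsub ht) u x i

end HasVelocityDecay

end Mass

/-! ### Velocity cutoffs -/

/-- Dilate one smooth bump by the factor `n + 1`; its Lipschitz constant is divided by the same
factor. -/
theorem exists_cutoff : ∃ (χ : ℕ → R3 → ℝ) (B : ℝ), 0 ≤ B ∧ ∀ n, ContDiff ℝ 1 (χ n) ∧
    HasCompactSupport (χ n) ∧ (∀ u, 0 ≤ χ n u) ∧ (∀ u, χ n u ≤ 1) ∧
    (∀ u, ‖u‖ ≤ (n : ℝ) + 1 → χ n u = 1) ∧ ∀ i u, |partialD (χ n) i u| ≤ B / ((n : ℝ) + 1) := by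
  let b : ContDiffBump (0 : R3) := ⟨1, 2, one_pos, one_lt_two⟩
  have hb : ContDiff ℝ 1 (b : R3 → ℝ) := b.contDiff
  obtain ⟨Lb, hLb⟩ := hb.lipschitzWith_of_hasCompactSupport b.hasCompactSupport one_ne_zero
  refine ⟨fun n u => b (((n : ℝ) + 1)⁻¹ • u), Lb, Lb.2, fun n => ?_⟩
  have hn : (0 : ℝ) < (n : ℝ) + 1 := by positivity
  have hsm : ∀ u : R3, ‖((n : ℝ) + 1)⁻¹ • u‖ = ‖u‖ / ((n : ℝ) + 1) := fun u => by
    rw [norm_smul, norm_inv, Real.norm_eq_abs, abs_of_pos hn, inv_mul_eq_div]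
  refine ⟨hb.comp (contDiff_const_smul _), b.hasCompactSupport.comp_smul (inv_ne_zero hn.ne'),
    fun u => b.nonneg, fun u => b.le_one, fun u hu => ?_, fun i u => ?_⟩
  · refine b.one_of_mem_closedBall ?_
    rw [mem_closedBall_zero_iff, hsm]
    exact (div_le_one hn).2 hu
  · have hl : LipschitzWith (Lb * ⟨((n : ℝ) + 1)⁻¹, (inv_pos.2 hn).le⟩)
        (fun u : R3 => b (((n : ℝ) + 1)⁻¹ • u)) := by
      refine hLb.comp (LipschitzWith.of_dist_le_mul fun v w => ?_)
      rw [dist_eq_norm, ← smul_sub, hsm, dist_eq_norm, div_eq_inv_mul]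
      exact le_rfl
    have := norm_lineDeriv_le_of_lipschitz ℝ (x₀ := u) (v := stdVec i) hl
    rwa [norm_stdVec, mul_one] at this

theorem ContDiff.hasPartial {f : R3 → ℝ} (hf : ContDiff ℝ 1 f) (i : Fin 3) (u : R3) :
    HasPartial f i u :=
  (hf.differentiable one_ne_zero u).lineDifferentiableAt

theorem ContDiff.continuous_partialD {f : R3 → ℝ} (hf : ContDiff ℝ 1 f) (i : Fin 3) :
    Continuous (partialD f i) := by
  have h : partialD f i = fun u => fderiv ℝ f u (stdVec i) :=
    funext fun u => (hf.differentiable one_ne_zero u).lineDeriv_eq_fderiv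
  rw [h]
  exact (hf.continuous_fderiv one_ne_zero).clm_apply continuous_const

/-- Integration by parts for a product with a Lipschitz factor. -/
theorem integral_cutoff_mul_partialD {f g χ : R3 → ℝ} {K : ℝ≥0} (hf : LipschitzWith K f)
    (hg : ContDiff ℝ 1 g) (hχ : ContDiff ℝ 1 χ) (hs : HasCompactSupport χ) (i : Fin 3) :
    Integrable (fun u => χ u * (g u * partialD f i u + f u * partialD g i u)) ∧
    ∫ u, χ u * (g u * partialD f i u + f u * partialD g i u) =
      -∫ u, g u * partialD χ i u * f u := by
  have hχg : ContDiff ℝ 1 (fun u => χ u * g u) := hχ.mul hg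
  have hsg : HasCompactSupport (fun u => χ u * g u) := hs.mul_right
  have hsd : HasCompactSupport (partialD χ i) := by
    refine hs.mono' fun u hu => ?_
    by_contra hnot
    refine hu ?_
    have h0 : χ =ᶠ[nhds u] fun _ => 0 := notMem_tsupport_iff_eventuallyEq.1 hnot
    have h1 := h0.fderiv_eq (𝕜 := ℝ)
    rw [partialD, (hχ.differentiable one_ne_zero u).lineDeriv_eq_fderiv, h1]
    simp
  have hgc := hg.continuous
  have hχc := hχ.continuous
  have hfc := hf.continuous
  have hpg := hg.continuous_partialD i
  have hpχ := hχ.continuous_partialD i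
  obtain ⟨D, hD⟩ := hχg.lipschitzWith_of_hasCompactSupport hsg one_ne_zero
  have h1 := hf.integral_lineDeriv_mul_eq (μ := volume) hD hsg (stdVec i)
  have h2 : ∀ u, lineDeriv ℝ (fun u => χ u * g u) u (-stdVec i) =
      -(partialD χ i u * g u + χ u * partialD g i u) := by
    intro u
    rw [lineDeriv_neg]
    congr 1
    have := (hχ.hasPartial i u).hasDerivAt.mul (hg.hasPartial i u).hasDerivAt
    simp only [zero_smul, add_zero] at this
    exact this.deriv
  simp only [h2] at h1
  have hi1 : Integrable fun u => lineDeriv ℝ f u (stdVec i) * (χ u * g u) := by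
    refine Integrable.bdd_mul (c := K * ‖stdVec i‖) (hχg.continuous.integrable_of_hasCompactSupport hsg)
      (measurable_lineDeriv hfc).aestronglyMeasurable
      (Filter.Eventually.of_forall fun u => norm_lineDeriv_le_of_lipschitz ℝ hf)
  have hi2 : Integrable fun u => χ u * (f u * partialD g i u) :=
    Continuous.integrable_of_hasCompactSupport (by fun_prop) hs.mul_right
  have hi3 : Integrable fun u => g u * partialD χ i u * f u :=
    Continuous.integrable_of_hasCompactSupport (by fun_prop) (hsd.mul_left.mul_right)
  have he : (fun u => χ u * (g u * partialD f i u + f u * partialD g i u)) =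
      fun u => lineDeriv ℝ f u (stdVec i) * (χ u * g u) + χ u * (f u * partialD g i u) := by
    funext u
    simp only [partialD]
    ring
  rw [he]
  refine ⟨hi1.add hi2, ?_⟩
  rw [integral_add hi1 hi2, h1, ← integral_add _ hi2, ← integral_neg]
  · exact integral_congr_ae (Filter.Eventually.of_forall fun u => by simp only []; ring)
  · have : (fun u => -(partialD χ i u * g u + χ u * partialD g i u) * f u) =
        fun u => -(g u * partialD χ i u * f u) - χ u * (f u * partialD g i u) := by
      funext u; ring
    rw [this]
    exact hi3.neg.sub hi2

/-! ### The mass balance equation -/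

section MassBalance

variable {ν T m : ℝ} {l : ℕ} {K : ℝ≥0} {C : R3 → ℝ → R3} {p₀ : R3 → R3 → ℝ} {p : R3 → R3 → ℝ → ℝ}

theorem IsPDFSolution.contDiff_u (hp : IsPDFSolution ν T C p₀ p) {t : ℝ} (ht : t ∈ Icc 0 T) (x : R3) :
    ContDiff ℝ 1 fun u => p u x t :=
  contDiffOn_univ.1 (hp.contDiffOn.comp (f := fun u : R3 => (u, x, t))
    (contDiff_id.prodMk contDiff_const).contDiffOn fun _ _ => mem_slab ht)

/-- The velocity integrand of the mass balance. -/
noncomputable def massFlux (ν : ℝ) (p : R3 → R3 → ℝ → ℝ) (t : ℝ) (x u : R3) : ℝ :=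
  ν * laplacianP (fun y => p u y t) x - ∑ i, u i * partialD (fun y => p u y t) i x

theorem IsPDFSolution.time_derivative_eq (hp : IsPDFSolution ν T C p₀ p)
    (hC : IsLipschitzField T K C) {t : ℝ} (ht : t ∈ Ioo 0 T) (u x : R3) :
    slabDeriv T p (u, x, t) (0, 0, 1) = massFlux ν p t x u +
      ∑ i, (p u x t * partialD (fun v => C v t i) i u + C u t i * partialD (fun v => p v x t) i u) := by
  have h := hp.equation_expanded hC ht u x
  have htI := Ioo_subset_Icc_self ht
  rw [slabDeriv_apply, divergence] at h
  simp only [massFlux, Finset.sum_add_distrib, hp.partialD_x htI, hp.partialD_u htI, ← Finset.mul_sum]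
  simp only [PiLp.neg_apply, neg_mul, Finset.sum_neg_distrib, one_mul] at h
  linarith

theorem HasVelocityDecay.integrable_massFlux (hp : IsPDFSolution ν T C p₀ p)
    (hD : HasVelocityDecay T m l p) (hm : 4 < m) {t : ℝ} (ht : t ∈ Ioc 0 T) (x : R3) :
    Integrable (massFlux ν p t x) :=
  ((integrable_finsetSum _ fun i _ => hD.integrable_second_partial hp hm ht x i).const_mul ν).sub
    (integrable_finsetSum _ fun i _ => hD.integrable_coord_mul_partial hp hm ht x i)

theorem HasVelocityDecay.massFlux_bound (hν : 0 < ν) (hD : HasVelocityDecay T m l p)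
    {δ : ℝ} (hδ : 0 < δ) : ∃ A : ℝ, 0 ≤ A ∧ ∀ t ∈ Icc δ T, ∀ x u,
      |massFlux ν p t x u| ≤ A * decayWeight (m - 1) u * (1 + ‖x‖) ^ l := by
  choose A₁ hA₁ h₁ using hD.bound_partial δ hδ
  choose A₂ hA₂ h₂ using hD.bound_second_partial δ hδ
  refine ⟨ν * ∑ i, A₂ i + ∑ i, A₁ i, add_nonneg (mul_nonneg hν.le (Finset.sum_nonneg fun i _ => hA₂ i))
    (Finset.sum_nonneg fun i _ => hA₁ i), fun t ht x u => ?_⟩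
  rw [massFlux, laplacianP]
  refine (abs_sub _ _).trans ?_
  rw [abs_mul, abs_of_pos hν]
  have hw : decayWeight m u ≤ decayWeight (m - 1) u := by
    rw [← one_add_norm_mul_decayWeight]
    have := decayWeight_pos m u
    nlinarith [norm_nonneg u]
  have e1 : |∑ i, partialD (fun y => partialD (fun y => p u y t) i y) i x| ≤
      ∑ i, A₂ i * decayWeight (m - 1) u * (1 + ‖x‖) ^ l :=
    (Finset.abs_sum_le_sum_abs _ _).trans (Finset.sum_le_sum fun i _ => (h₂ i t ht u x).trans (by
      have := hA₂ i
      gcongr))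
  have e2 : |∑ i, u i * partialD (fun y => p u y t) i x| ≤
      ∑ i, A₁ i * decayWeight (m - 1) u * (1 + ‖x‖) ^ l :=
    (Finset.abs_sum_le_sum_abs _ _).trans
      (Finset.sum_le_sum fun i _ => abs_coord_mul_decay_le i (h₁ i t ht u x))
  simp only [← Finset.sum_mul] at e1 e2
  have := mul_le_mul_of_nonneg_left e1 hν.le
  calc _ ≤ _ := add_le_add this e2
    _ = _ := by ring

/-- No decay of `∂p/∂u` is available, so the divergence term cannot be integrated directly. With a
cutoff it is integrated by parts; the remainder contains `|∂χ| ≤ B / (n + 1)` and `p C`, which is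
integrable because `C` grows linearly. It therefore tends to zero uniformly in time. -/
theorem HasVelocityDecay.totalMass_time (hν : 0 < ν) (hT : 0 < T) (hC : IsLipschitzField T K C)
    (hp : IsPDFSolution ν T C p₀ p) (hD : HasVelocityDecay T m l p) (hm : 4 < m) {t : ℝ}
    (ht : t ∈ Ioo 0 T) (x : R3) :
    HasDerivAt (fun τ => totalMass p τ x) (∫ u, massFlux ν p t x u) t := by
  obtain ⟨χ, B, hB, hχ⟩ := exists_cutoff
  obtain ⟨C₀, hC₀, hgr⟩ := hC.exists_growth
  obtain ⟨A₀, hA₀, hb₀⟩ := hD.bound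
  obtain ⟨A₁, hA₁, hb₁⟩ := hD.massFlux_bound hν (half_pos ht.1)
  have hw := integrable_decayWeight (m := m - 1) (by linarith)
  set X : ℝ := (1 + ‖x‖) ^ l
  have hX : 0 ≤ X := by positivity
  -- tail estimates
  set e : ℕ → ℝ := fun n => ∫ u, (1 - χ n u) * decayWeight (m - 1) u with he
  have hχc : ∀ n, Continuous (χ n) := fun n => (hχ n).1.continuous
  have hχi : ∀ n, Integrable (χ n) := fun n => (hχc n).integrable_of_hasCompactSupport (hχ n).2.1
  have hei : ∀ n, Integrable fun u => (1 - χ n u) * decayWeight (m - 1) u := fun n =>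
    hw.mono' ((Continuous.aestronglyMeasurable (by have := hχc n; fun_prop)).mul hw.aestronglyMeasurable)
      (Filter.Eventually.of_forall fun u => by
        rw [Real.norm_eq_abs, abs_of_nonneg (mul_nonneg (by linarith [(hχ n).2.2.2.1 u])
          (decayWeight_pos _ u).le)]
        have h1 := (hχ n).2.2.1 u
        have h2 := decayWeight_pos (m - 1) u
        nlinarith)
  have helim : Filter.Tendsto e Filter.atTop (nhds 0) := by
    have h1 := tendsto_integral_of_dominated_convergence (μ := volume)
      (F := fun n u => (1 - χ n u) * decayWeight (m - 1) u) (f := fun _ => (0 : ℝ))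
      (decayWeight (m - 1)) (fun n => (hei n).aestronglyMeasurable) hw
      (fun n => Filter.Eventually.of_forall fun u => by
        rw [Real.norm_eq_abs, abs_of_nonneg (mul_nonneg (by linarith [(hχ n).2.2.2.1 u])
          (decayWeight_pos _ u).le)]
        have h1 := (hχ n).2.2.1 u
        have h2 := decayWeight_pos (m - 1) u
        nlinarith)
      (Filter.Eventually.of_forall fun u => by
        refine tendsto_const_nhds.congr' ?_
        obtain ⟨N, hN⟩ := exists_nat_ge ‖u‖
        filter_upwards [Filter.eventually_ge_atTop N] with n hn
        have hNn : (N : ℝ) ≤ n := by exact_mod_cast hn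
        rw [(hχ n).2.2.2.2.1 u (by linarith)]
        simp)
    simpa using h1
  have htail : ∀ (G : R3 → ℝ) (A : ℝ), Integrable G →
      (∀ u, |G u| ≤ A * decayWeight (m - 1) u * X) → ∀ n,
      |(∫ u, G u) - ∫ u, χ n u * G u| ≤ A * X * e n := by
    intro G A hG hGb n
    have hχG : Integrable fun u => χ n u * G u :=
      hG.bdd_mul (c := 1) (hχc n).aestronglyMeasurable (Filter.Eventually.of_forall fun u => by
        rw [Real.norm_eq_abs, abs_of_nonneg ((hχ n).2.2.1 u)]; exact (hχ n).2.2.2.1 u)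
    rw [← integral_sub hG hχG, he, ← integral_const_mul, ← Real.norm_eq_abs]
    refine norm_integral_le_of_norm_le ((hei n).const_mul _) (Filter.Eventually.of_forall fun u => ?_)
    have h1 : 0 ≤ 1 - χ n u := by linarith [(hχ n).2.2.2.1 u]
    rw [Real.norm_eq_abs, show G u - χ n u * G u = (1 - χ n u) * G u by ring, abs_mul, abs_of_nonneg h1]
    calc _ ≤ (1 - χ n u) * (A * decayWeight (m - 1) u * X) := mul_le_mul_of_nonneg_left (hGb u) h1
      _ = _ := by ring
  -- the cut-off mass
  set J : ℕ → ℝ → ℝ := fun n τ => ∑ i, ∫ u, p u x τ * partialD (χ n) i u * C u τ i with hJ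
  have hder : ∀ n, ∀ τ ∈ Ioo (t / 2) T, HasDerivAt (fun τ => ∫ u, χ n u * p u x τ)
      ((∫ u, χ n u * massFlux ν p τ x u) - J n τ) τ := by
    intro n τ hτ
    have hτ0 : τ ∈ Ioo 0 T := ⟨(half_pos ht.1).trans hτ.1, hτ.2⟩
    have hτI := Ioo_subset_Icc_self hτ0
    -- On the support of the cutoff the time derivative of `p` is bounded for all times at once,
    -- which justifies differentiating the cut-off mass.
    have hcpt : IsCompact (tsupport (χ n) ×ˢ (({x} : Set R3) ×ˢ Icc 0 T)) :=
      (hχ n).2.1.isCompact.prod (isCompact_singleton.prod isCompact_Icc)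
    obtain ⟨BD, hBD⟩ := hcpt.exists_bound_of_continuousOn
      (((hp.continuousOn_slabDeriv hT).clm_apply
        (continuousOn_const (c := ((0 : R3), (0 : R3), (1 : ℝ))))).mono
        (prod_mono (subset_univ _) (prod_mono_left (subset_univ _))))
    have hcd : ∀ σ ∈ Ioo 0 T, Continuous fun u => slabDeriv T p (u, x, σ) (0, 0, 1) := fun σ hσ =>
      continuousOn_univ.1 (((hp.continuousOn_slabDeriv hT).comp (f := fun u : R3 => (u, x, σ))
        (by fun_prop) fun u _ => mem_slab (Ioo_subset_Icc_self hσ)).clm_apply continuousOn_const)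
    have h1 := (hasDerivAt_integral_of_dominated_loc_of_deriv_le (μ := volume)
      (F := fun σ u => χ n u * p u x σ)
      (F' := fun σ u => χ n u * slabDeriv T p (u, x, σ) (0, 0, 1)) (x₀ := τ) (s := Ioo 0 T)
      (bound := fun u => χ n u * BD) (Ioo_mem_nhds hτ0.1 hτ0.2) ?_ ?_ ?_ ?_ ((hχi n).mul_const _) ?_).2
    · refine h1.congr_deriv ?_
      simp only [hp.time_derivative_eq hC hτ0, mul_add, Finset.mul_sum]
      have hint := fun i => integral_cutoff_mul_partialD (hC.lipschitz_coord hτI i)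
        (hp.contDiff_u hτI x) (hχ n).1 (hχ n).2.1 i
      have hG := hD.integrable_massFlux hp hm (Ioo_subset_Ioc_self hτ0) x
      have hχG : Integrable fun u => χ n u * massFlux ν p τ x u :=
        hG.bdd_mul (c := 1) (hχc n).aestronglyMeasurable (Filter.Eventually.of_forall fun u => by
          rw [Real.norm_eq_abs, abs_of_nonneg ((hχ n).2.2.1 u)]; exact (hχ n).2.2.2.1 u)
      simp only [mul_add] at hint
      rw [integral_add hχG (integrable_finsetSum _ fun i _ => (hint i).1),
        integral_finsetSum _ fun i _ => (hint i).1]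
      simp only [fun i => (hint i).2, Finset.sum_neg_distrib, hJ]
      ring
    · filter_upwards [Ioo_mem_nhds hτ0.1 hτ0.2] with σ hσ
      exact ((hχc n).mul (hp.continuous_u (Ioo_subset_Icc_self hσ) x)).aestronglyMeasurable
    · exact ((hχc n).mul (hp.continuous_u hτI x)).integrable_of_hasCompactSupport (hχ n).2.1.mul_right
    · exact ((hχc n).mul (hcd τ hτ0)).aestronglyMeasurable
    · refine Filter.Eventually.of_forall fun u σ hσ => ?_
      rw [norm_mul, Real.norm_eq_abs, abs_of_nonneg ((hχ n).2.2.1 u)]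
      by_cases hu : u ∈ tsupport (χ n)
      · exact mul_le_mul_of_nonneg_left (hBD (u, x, σ) ⟨hu, rfl, Ioo_subset_Icc_self hσ⟩)
          ((hχ n).2.2.1 u)
      · rw [image_eq_zero_of_notMem_tsupport hu, zero_mul, zero_mul]
    · exact Filter.Eventually.of_forall fun u σ hσ => (hp.time_hasDerivAt hσ u x).const_mul _
  -- the flux through the cutoff
  set c : ℝ := A₀ * X * (K + C₀) * ∫ u, decayWeight (m - 1) u with hc
  have hJb : ∀ n, ∀ τ ∈ Ioo (t / 2) T, |J n τ| ≤ 3 * (B / ((n : ℝ) + 1) * c) := by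
    intro n τ hτ
    have hτI : τ ∈ Icc 0 T := ⟨((half_pos ht.1).trans hτ.1).le, hτ.2.le⟩
    refine (Finset.abs_sum_le_sum_abs _ _).trans ((Finset.sum_le_sum fun i _ =>
      (?_ : _ ≤ B / ((n : ℝ) + 1) * c)).trans (by simp))
    rw [hc, ← integral_const_mul, ← integral_const_mul, ← Real.norm_eq_abs]
    refine norm_integral_le_of_norm_le ((hw.const_mul _).const_mul _)
      (Filter.Eventually.of_forall fun u => ?_)
    rw [Real.norm_eq_abs, abs_mul, abs_mul]
    have h1 := hb₀ τ hτI u x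
    have h2 := (hχ n).2.2.2.2.2 i u
    have h3 : |C u τ i| ≤ (K + C₀) * (1 + ‖u‖) := by
      refine (PiLp.norm_apply_le (C u τ) i).trans ((hgr τ hτI u).trans ?_)
      nlinarith [mul_nonneg hC₀ (norm_nonneg u), K.2, norm_nonneg u]
    have hw0 := decayWeight_pos m u
    calc _ ≤ (A₀ * decayWeight m u * X) * (B / ((n : ℝ) + 1)) * ((K + C₀) * (1 + ‖u‖)) := by gcongr
      _ = B / ((n : ℝ) + 1) * (A₀ * X * (K + C₀) * ((1 + ‖u‖) * decayWeight m u)) := by ring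
      _ = _ := by rw [one_add_norm_mul_decayWeight]
  -- passage to the limit
  have hlim : Filter.Tendsto (fun n : ℕ => A₁ * X * e n + 3 * (B / ((n : ℝ) + 1) * c)) Filter.atTop
      (nhds 0) := by
    have h1 : Filter.Tendsto (fun n : ℕ => B / ((n : ℝ) + 1)) Filter.atTop (nhds 0) := by
      have := (tendsto_one_div_add_atTop_nhds_zero_nat (𝕜 := ℝ)).const_mul B
      simpa [div_eq_mul_inv] using this
    have h2 := (helim.const_mul (A₁ * X)).add ((h1.mul_const c).const_mul 3)
    simpa using h2
  -- The derivatives converge uniformly on `(t / 2, T)`, where the bounds on `x`-derivatives have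
  -- one common constant, and the cut-off masses converge pointwise; so the limit can be
  -- differentiated.
  refine hasDerivAt_of_tendstoUniformlyOn (l := Filter.atTop) (s := Ioo (t / 2) T) isOpen_Ioo
    (f := fun n τ => ∫ u, χ n u * p u x τ)
    (f' := fun n τ => (∫ u, χ n u * massFlux ν p τ x u) - J n τ)
    (g' := fun τ => ∫ u, massFlux ν p τ x u) ?_ (Filter.Eventually.of_forall hder) ?_
    ⟨half_lt_self ht.1, ht.2⟩
  · rw [Metric.tendstoUniformlyOn_iff]
    intro ε hε
    filter_upwards [hlim.eventually (gt_mem_nhds hε)] with n hn τ hτ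
    have hτI : τ ∈ Ioc 0 T := ⟨(half_pos ht.1).trans hτ.1, hτ.2.le⟩
    have h1 := htail (massFlux ν p τ x) A₁ (hD.integrable_massFlux hp hm hτI x)
      (fun u => hb₁ τ (Ioo_subset_Icc_self hτ) x u) n
    have h2 := hJb n τ hτ
    rw [Real.dist_eq]
    refine lt_of_le_of_lt ?_ hn
    have h3 := abs_add_le ((∫ u, massFlux ν p τ x u) - ∫ u, χ n u * massFlux ν p τ x u) (J n τ)
    rw [show (∫ u, massFlux ν p τ x u) - ((∫ u, χ n u * massFlux ν p τ x u) - J n τ) =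
      ((∫ u, massFlux ν p τ x u) - ∫ u, χ n u * massFlux ν p τ x u) + J n τ by ring]
    linarith
  · intro τ hτ
    have hτI : τ ∈ Icc 0 T := ⟨((half_pos ht.1).trans hτ.1).le, hτ.2.le⟩
    have hb : ∀ u, |p u x τ| ≤ A₀ * decayWeight (m - 1) u * X := fun u => by
      refine (hb₀ τ hτI u x).trans ?_
      have hwm : decayWeight m u ≤ decayWeight (m - 1) u := by
        rw [← one_add_norm_mul_decayWeight]
        have := decayWeight_pos m u
        nlinarith [norm_nonneg u]
      gcongr
    have h1 := htail (fun u => p u x τ) A₀ (hD.integrable hp hm hτI x) hb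
    rw [tendsto_iff_dist_tendsto_zero]
    refine squeeze_zero (fun _ => dist_nonneg) (fun n => ?_)
      (by simpa using helim.const_mul (A₀ * X))
    rw [dist_comm, Real.dist_eq]
    exact h1 n

end MassBalance

/-! ### Conservation of mass and the divergence of the first moment -/

section MassConservation

variable {ν T m : ℝ} {l : ℕ} {K : ℝ≥0} {C : R3 → ℝ → R3} {p₀ : R3 → R3 → ℝ} {p : R3 → R3 → ℝ → ℝ}

namespace HasVelocityDecay

theorem partialD_totalMass (hp : IsPDFSolution ν T C p₀ p) (hD : HasVelocityDecay T m l p)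
    (hm : 4 < m) {t : ℝ} (ht : t ∈ Ioc 0 T) (i : Fin 3) :
    partialD (totalMass p t) i = fun x => ∫ u, partialD (fun y => p u y t) i x :=
  funext fun x => (hD.totalMass_line hp hm ht x i).partialD_eq

theorem integral_massFlux (hp : IsPDFSolution ν T C p₀ p) (hD : HasVelocityDecay T m l p)
    (hm : 4 < m) {t : ℝ} (ht : t ∈ Ioc 0 T) (x : R3) :
    ∫ u, massFlux ν p t x u =
      ν * laplacianP (totalMass p t) x - ∑ i, partialD (firstMoment p t i) i x := by
  have h1 : ∀ i, partialD (fun y => partialD (totalMass p t) i y) i x =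
      ∫ u, partialD (fun y => partialD (fun z => p u z t) i y) i x := fun i => by
    rw [hD.partialD_totalMass hp hm ht]
    exact (hD.totalMass_partial_line hp hm ht x i).partialD_eq
      (f := fun x => ∫ u, partialD (fun y => p u y t) i x)
  simp only [massFlux, laplacianP, h1, fun i => (hD.firstMoment_line hp hm ht x i).partialD_eq]
  rw [integral_sub, integral_const_mul, integral_finsetSum, integral_finsetSum]
  · exact fun i _ => hD.integrable_coord_mul_partial hp hm ht x i
  · exact fun i _ => hD.integrable_second_partial hp hm ht x i
  · exact (integrable_finsetSum _ fun i _ => hD.integrable_second_partial hp hm ht x i).const_mul ν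
  · exact integrable_finsetSum _ fun i _ => hD.integrable_coord_mul_partial hp hm ht x i

/-- Conservation of mass forces the first moment to be divergence free. -/
theorem sum_partialD_firstMoment_eq_zero (hν : 0 < ν) (hT : 0 < T) (hC : IsLipschitzField T K C)
    (hp : IsPDFSolution ν T C p₀ p) (hD : HasVelocityDecay T m l p) (hm : 4 < m)
    (hM : ∀ t ∈ Ioc 0 T, ∀ x, totalMass p t x = 1) {t : ℝ} (ht : t ∈ Ioc 0 T) (x : R3) :
    ∑ i, partialD (firstMoment p t i) i x = 0 := by
  have hint : ∀ t ∈ Ioo 0 T, ∑ i, partialD (firstMoment p t i) i x = 0 := by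
    intro t ht
    have h1 := hD.totalMass_time hν hT hC hp hm ht x
    rw [hD.integral_massFlux hp hm (Ioo_subset_Ioc_self ht)] at h1
    have h2 : HasDerivAt (fun τ => totalMass p τ x) 0 t := by
      refine (hasDerivAt_const t (1 : ℝ)).congr_of_eventuallyEq ?_
      filter_upwards [Ioo_mem_nhds ht.1 ht.2] with τ hτ using hM τ (Ioo_subset_Ioc_self hτ) x
    have h3 : laplacianP (totalMass p t) x = 0 := by
      have h4 : totalMass p t = fun _ => 1 := funext fun y => hM t (Ioo_subset_Ioc_self ht) y
      simp [laplacianP, partialD, lineDeriv, h4]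
    have h5 := h1.unique h2
    rw [h3] at h5
    linarith
  rcases ht.2.lt_or_eq with h | h
  · exact hint t ⟨ht.1, h⟩
  subst h
  -- At the final time the balance equation is not available; the identity is obtained there as a
  -- limit from the left.
  have hc : ContinuousOn (fun τ => ∑ i, ∫ u : R3, u i * partialD (fun y => p u y τ) i x)
      (Icc (t / 2) t) := continuousOn_finsetSum _ fun i _ =>
    hD.continuousOn_moment_partial hT hp hm (half_pos ht.1) x i
  have hlt : t / 2 < t := half_lt_self ht.1
  have h1 := (hc t ⟨hlt.le, le_rfl⟩).mono_left (nhdsWithin_mono t Ioo_subset_Icc_self)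
  have h2 : Filter.Tendsto (fun τ => ∑ i, ∫ u : R3, u i * partialD (fun y => p u y τ) i x)
      (nhdsWithin t (Ioo (t / 2) t)) (nhds 0) := by
    refine tendsto_const_nhds.congr' ?_
    filter_upwards [self_mem_nhdsWithin] with τ hτ
    have hτ0 : τ ∈ Ioo 0 t := ⟨(half_pos ht.1).trans hτ.1, hτ.2⟩
    rw [← hint τ hτ0]
    exact Finset.sum_congr rfl fun i _ =>
      (hD.firstMoment_line hp hm (Ioo_subset_Ioc_self hτ0) x i).partialD_eq
  have : (nhdsWithin t (Ioo (t / 2) t)).NeBot := right_nhdsWithin_Ioo_neBot hlt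
  rw [← tendsto_nhds_unique h1 h2]
  exact Finset.sum_congr rfl fun i _ => (hD.firstMoment_line hp hm ht x i).partialD_eq

/-- If the first moment is divergence free, then mass is conserved. -/
theorem totalMass_eq_one (hν : 0 < ν) (hT : 0 < T) (hC : IsLipschitzField T K C)
    (hp : IsPDFSolution ν T C p₀ p) (hD : HasVelocityDecay T m l p) (hm : 4 < m)
    (h0 : ∀ x, ∫ u, p₀ u x = 1)
    (hF : ∀ t ∈ Ioc 0 T, ∀ x, ∑ i, partialD (firstMoment p t i) i x = 0) {t : ℝ} (ht : t ∈ Icc 0 T)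
    (x : R3) : totalMass p t x = 1 := by
  have hc := hD.continuousOn_totalMass hp hm
  have hinit : ∀ x, totalMass p 0 x = 1 := fun x => by simp only [totalMass, hp.initial, h0]
  have hder : ∀ τ ∈ Ioo 0 T, ∀ x, HasDerivAt (fun τ => totalMass p τ x)
      (ν * laplacianP (totalMass p τ) x) τ := by
    intro τ hτ x
    refine (hD.totalMass_time hν hT hC hp hm hτ x).congr_deriv ?_
    rw [hD.integral_massFlux hp hm (Ioo_subset_Ioc_self hτ), hF τ (Ioo_subset_Ioc_self hτ), sub_zero]
  -- Uniqueness is applied on `[0, t]` with `t < T`, so that the balance equation holds up to and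
  -- including the right endpoint; the time `T` is then reached by continuity.
  have hint : ∀ t ∈ Ioo 0 T, ∀ x, totalMass p t x = 1 := by
    intro t ht x
    have hsub : Icc 0 t ⊆ Icc 0 T := Icc_subset_Icc_right ht.2.le
    obtain ⟨A, hA, hb⟩ := hD.bound
    have hw0 : 0 ≤ ∫ u, decayWeight m u := integral_nonneg fun u => (decayWeight_pos m u).le
    have key := heat_unique (t := t) hν (f := fun x τ => totalMass p τ x - 1)
      (L := A * (∫ u, decayWeight m u) + 1) (l := l) ?_ ?_ ?_ ?_ ?_ x t ⟨ht.1.le, le_rfl⟩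
    · exact sub_eq_zero.1 key
    · exact (hc.mono (prod_mono_right hsub)).sub continuousOn_const
    · intro z τ hτ
      have h1 := norm_integral_le_of_norm_le (f := fun u => p u z τ)
        (((integrable_decayWeight (m := m) (by linarith)).const_mul A).mul_const ((1 + ‖z‖) ^ l))
        (Filter.Eventually.of_forall fun u => hb τ (hsub hτ) u z)
      rw [integral_mul_const, integral_const_mul, Real.norm_eq_abs] at h1
      have h2 : (1 : ℝ) ≤ (1 + ‖z‖) ^ l := one_le_pow₀ (by linarith [norm_nonneg z])
      refine (abs_sub _ _).trans ?_
      rw [abs_one, add_mul, one_mul]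
      exact add_le_add h1 h2
    · intro z
      rw [hinit, sub_self]
    · intro R δ hδ
      obtain ⟨B, hB, hbB⟩ := hD.massFlux_bound hν hδ.1
      have hw := integrable_decayWeight (m := m - 1) (by linarith)
      have hw1 : 0 ≤ ∫ u, decayWeight (m - 1) u :=
        integral_nonneg fun u => (decayWeight_pos _ u).le
      refine ⟨Real.toNNReal (B * (∫ u, decayWeight (m - 1) u) * (1 + |R|) ^ l), fun z hz => ?_⟩
      refine (convex_Icc δ t).lipschitzOnWith_of_nnnorm_hasDerivWithin_le
        (f' := fun τ => ∫ u, massFlux ν p τ z u) (fun τ hτ => ?_) (fun τ hτ => ?_)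
      · exact ((hD.totalMass_time hν hT hC hp hm
          ⟨hδ.1.trans_le hτ.1, hτ.2.trans_lt ht.2⟩ z).sub_const 1).hasDerivWithinAt
      · rw [← NNReal.coe_le_coe, coe_nnnorm, Real.coe_toNNReal _ (by positivity)]
        have h1 := norm_integral_le_of_norm_le (f := massFlux ν p τ z) ((hw.const_mul B).mul_const ((1 + ‖z‖) ^ l))
          (Filter.Eventually.of_forall fun u => hbB τ ⟨hτ.1, hτ.2.trans ht.2.le⟩ z u)
        rw [integral_mul_const, integral_const_mul] at h1
        refine h1.trans ?_
        have : ‖z‖ ≤ |R| := hz.trans (le_abs_self R)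
        gcongr
    -- With no divergence left, the balance equation is the heat equation for the mass, and here it
    -- holds at every time rather than almost every time.
    · refine Filter.Eventually.of_forall fun τ hτ z => ?_
      have hτT : τ ∈ Ioo 0 T := ⟨hτ.1, hτ.2.trans ht.2⟩
      have hτc := Ioo_subset_Ioc_self hτT
      have hP : ∀ y i, HasPartial (fun y => totalMass p τ y) i y := fun y i =>
        (hD.totalMass_line hp hm hτc y i).hasPartial
      have hc1 : ∀ y i, HasPartial (fun _ : R3 => (1 : ℝ)) i y := fun y i =>
        differentiableAt_const _
      have hpd : ∀ i, (fun y => partialD (fun y => totalMass p τ y - 1) i y) =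
          partialD (totalMass p τ) i := by
        intro i
        funext y
        rw [partialD_sub (hP y i) (hc1 y i)]
        simp [partialD, lineDeriv]
      refine ⟨fun i => (hP z i).sub (hc1 z i), fun i => ?_, ?_⟩
      · rw [hpd, hD.partialD_totalMass hp hm hτc]
        exact (hD.totalMass_partial_line hp hm hτc z i).hasPartial
          (f := fun x => ∫ u, partialD (fun y => p u y τ) i x)
      · simp only [hpd]
        exact (hder τ hτT z).sub_const 1
  have hct : ContinuousOn (fun τ => totalMass p τ x) (Icc 0 T) :=
    hc.comp (f := fun τ : ℝ => (x, τ)) (by fun_prop) fun τ hτ => ⟨mem_univ _, hτ⟩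
  have heq : EqOn (fun τ => totalMass p τ x) (fun _ => 1) (closure (Ioo 0 T)) :=
    EqOn.of_subset_closure (fun τ hτ => hint τ hτ x) (by rwa [closure_Ioo hT.ne])
      continuousOn_const subset_closure subset_rfl
  rw [closure_Ioo hT.ne] at heq
  exact heq ht

end HasVelocityDecay

end MassConservation

/-! ### The main theorem -/

theorem mainTheorem5 (ν T : ℝ) (hν : 0 < ν) (hT : 0 < T)
    (C : R3 → ℝ → R3) (K : ℝ≥0)
    (hLip : ∀ t ∈ Icc 0 T, LipschitzWith K (fun u => C u t))
    (hUnif : ∀ u, UniformContinuousOn (fun t => C u t) (Icc 0 T))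
    (hDiff : ∀ t ∈ Icc 0 T, ∀ u, ∀ i, HasPartial (fun v => C v t i) i u)
    (p₀ : R3 → R3 → ℝ) (p : R3 → R3 → ℝ → ℝ)
    (hp : IsPDFSolution ν T C p₀ p) (hGrowth : HasPolyGrowth T p) :
    -- the characteristic system has a unique solution
    (∀ t ∈ Ioc 0 T, ∀ u, ∃ (Y : ℝ → R3) (q : ℝ → ℝ), IsCharacteristic C t u Y q ∧
      ∀ (Y' : ℝ → R3) (q' : ℝ → ℝ), IsCharacteristic C t u Y' q' →
        EqOn Y' Y (Icc 0 t) ∧ EqOn q' q (Icc 0 t)) ∧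
    -- representation formula
    (∀ t ∈ Ioc 0 T, ∀ u, ∀ (Y : ℝ → R3) (q : ℝ → ℝ), IsCharacteristic C t u Y q → ∀ x,
      Integrable (fun z => heatKernelH ν Y x t z * p₀ (Y t) z) ∧
      p u x t = q t * ∫ z, heatKernelH ν Y x t z * p₀ (Y t) z) ∧
    -- positivity
    ((∀ u x, 0 ≤ p₀ u x) → ∀ t ∈ Icc 0 T, ∀ u x, 0 ≤ p u x t) ∧
    -- mass preservation
    (∀ m : ℝ, 4 < m →
      TendstoUniformly (fun u x : R3 => ‖u‖ ^ m * p₀ u x) (fun _ => 0)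
        (Bornology.cobounded R3) →
      (∀ x, IsPDF (fun u => p₀ u x)) →
      (∀ t ∈ Ioc 0 T, ∀ x, Integrable (fun u => ‖u‖ * p u x t) ∧
        ∀ i, HasPartial (firstMoment p t i) i x) ∧
      ((∀ t ∈ Ioc 0 T, ∀ x, IsPDF (fun u => p u x t)) ↔
        ∀ t ∈ Ioc 0 T, ∀ x, ∑ i, partialD (firstMoment p t i) i x = 0)) := by
  have hC : IsLipschitzField T K C := ⟨hLip, fun u => (hUnif u).continuousOn, hDiff⟩
  have hkernel : ∀ (Y : ℝ → R3) (t : ℝ) (x : R3), heatKernelH ν Y x t =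
      fun z => gaussK ν t (z - (x - ∫ s in (0 : ℝ)..t, Y s)) := fun Y t x => by
    funext z
    rw [heatKernelH, gaussK, sub_add]
  have hpos : (∀ u x, 0 ≤ p₀ u x) → ∀ t ∈ Icc 0 T, ∀ u x, 0 ≤ p u x t := by
    intro h0 t ht u x
    rcases ht.1.eq_or_lt with h | h
    · rw [← h, hp.initial]; exact h0 u x
    · obtain ⟨Y, q, hY⟩ := hC.exists_characteristic ht.1 ht.2 u
      rw [hp.eq_heatSG hν hT hC hGrowth ⟨h, ht.2⟩ hY, hY.q_eq hC ht.2 ⟨ht.1, le_rfl⟩]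
      exact mul_nonneg (Real.exp_pos _).le
        (integral_nonneg fun z => mul_nonneg (gaussK_nonneg hν h.le _) (h0 _ _))
  obtain ⟨L, l, hL⟩ := hGrowth
  refine ⟨fun t ht u => ?_, fun t ht u Y q hY x => ?_, hpos, fun m hm hdec hpdf => ?_⟩
  · obtain ⟨Y, q, hY⟩ := hC.exists_characteristic ht.1.le ht.2 u
    exact ⟨Y, q, hY, fun Y' q' hY' => hY.unique hC ht.1.le ht.2 hY'⟩
  · rw [hkernel]
    exact ⟨heatSG_integrable hν ht.1 (hp.continuous_initial hT _) (hp.initial_bound_fixed hT hL _) _,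
      hp.eq_heatSG hν hT hC ⟨L, l, hL⟩ ht hY x⟩
  · have hD := hp.hasVelocityDecay hν hT hC hL (by linarith) hdec
    refine ⟨fun t ht x => ⟨hD.integrable_norm_mul hp hm (Ioc_subset_Icc_self ht) x, fun i =>
      (hD.firstMoment_line hp hm ht x i).hasPartial⟩, fun h t ht x => ?_, fun h t ht x => ?_⟩
    · exact hD.sum_partialD_firstMoment_eq_zero hν hT hC hp hm (fun t ht x => (h t ht x).2.2) ht x
    · have htI := Ioc_subset_Icc_self ht
      exact ⟨fun u => hpos (fun u x => (hpdf x).1 u) t htI u x, hD.integrable hp hm htI x,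
        hD.totalMass_eq_one hν hT hC hp hm (fun x => (hpdf x).2.2) h htI x⟩
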